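/- A \emph{quantile function} is a nondecreasing, right-continuous, nonnegative function on $[0,1)$ with finite integral (it may be unbounded near $1$). For quantile functions, write $X\prec_w Q$ if $\int_t^1 X(s)\,ds\le\int_t^1 Q(s)\,ds$ for all $t\in[0,1]$, and $W\prec V$ if moreover (with $W,V$ in place of $X,Q$) equality holds at $t=0$. For quantile functions $W$ and $X$, the revenue is $$R(W,X)=W(0)X(0)+\int_{(0,1)}(1-t)\,W(t)\,dX(t)\in[0,\infty]$$ (Lebesgue--Stieltjes integral). A \emph{partition of quantiles} $P$ is given by countably many pairwise disjoint nonempty intervals $[a_i,b_i)\subseteq[0,1)$, $i\in I$ (the pooling intervals). The \emph{monotone partitional} function generated by $P$ from $V$ equals $\frac1{b_i-a_i}\int_{a_i}^{b_i}V(s)\,ds$ on each $[a_i,b_i)$ and equals $V$ outside $\bigcup_i[a_i,b_i)$. A function $X$ is \emph{weak monotone partitional} from $Q$ with partition $P$ if $X(t)=\widehat X(t)\,\mathbf 1_{t\ge t_m}$ for some $t_m\in[0,1]$, where $\widehat X$ is generated by $P$ from $Q$, and, if $t_m>0$, the excluded interval $[0,t_m)$ is itself one of the intervals of $P$. \textbf{Proposition.}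 Let $V$ and $Q$ be quantile functions. The problem $$\max_{W\prec V,\ X\prec_w Q}R(W,X)$$ over quantile functions $W,X$ has a solution $(W^*,X^*)$ (where the maximum may be $+\infty$) with monotone partitional structure and common support: there is a single partition of quantiles $P$ such that $W^*$ is the monotone partitional function generated by $P$ from $V$ and $X^*$ is weak monotone partitional from $Q$ with the same partition $P$; moreover, for all $s<t$ in $[0,1)$, $W^*$ is constant on $[s,t)$ if and only if $X^*$ is constant on $[s,t)$. In particular $W^*$ is an extreme point of $\{W:W\prec V\}$ and $X^*$ is an extreme point of $\{X:X\prec_w Q\}$. -/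

import Mathlib

open MeasureTheory
open scoped ENNReal

/-- Quantiles. The endpoint `1` is left out, because a quantile function may be unbounded there;
it carries no mass and gets weight `1 - t = 0` in the revenue. -/
abbrev Quantile : Type := Set.Ico (0 : ℝ) 1

/-- Lebesgue measure on the quantiles. -/
noncomputable instance Quantile.instMeasureSpace : MeasureSpace Quantile :=
  Measure.Subtype.measureSpace

instance Quantile.instCompactIccSpace : CompactIccSpace Quantile where
  isCompact_Icc {a b} := by
    rw [Subtype.isCompact_iff]
    have h : (Subtype.val '' Set.Icc a b : Set ℝ) = Set.Icc (a : ℝ) (b : ℝ) := by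
      ext x
      constructor
      · rintro ⟨y, hy, rfl⟩
        exact hy
      · intro hx
        exact ⟨⟨x, a.2.1.trans hx.1, hx.2.trans_lt b.2.2⟩, hx, rfl⟩
    rw [h]
    exact isCompact_Icc

/-- A quantile function: nondecreasing and right-continuous on `[0, 1)` (this is contained in
`StieltjesFunction Quantile`), nonnegative, and with a finite mean. -/
structure IsQuantileFunction (f : StieltjesFunction Quantile) : Prop where
  nonneg : ∀ t, 0 ≤ f t
  integrable : Integrable (fun t : Quantile => f t)

/-- `X ≺_w Q`: the integral of `X` over `[t, 1)` never exceeds that of `Q`. -/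
def WeaklyMajorizedBy (X Q : StieltjesFunction Quantile) : Prop :=
  ∀ t : Quantile, ∫ s in Set.Ici t, X s ≤ ∫ s in Set.Ici t, Q s

/-- `W ≺ V`: as weak majorization, with equality of the total integrals. -/
def MajorizedBy (W V : StieltjesFunction Quantile) : Prop :=
  WeaklyMajorizedBy W V ∧ ∫ s, W s = ∫ s, V s

/-- The quantile functions `W` with `W ≺ V`. -/
def feasibleValues (V : StieltjesFunction Quantile) : Set (StieltjesFunction Quantile) :=
  {W | IsQuantileFunction W ∧ MajorizedBy W V}

/-- The quantile functions `X` with `X ≺_w Q`. -/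
def feasibleAllocations (Q : StieltjesFunction Quantile) : Set (StieltjesFunction Quantile) :=
  {X | IsQuantileFunction X ∧ WeaklyMajorizedBy X Q}

/-- The revenue `R(W, X) = W(0) X(0) + ∫ (1 - t) W(t) dX(t)`, a Lebesgue-Stieltjes integral over
`(0, 1)` with values in `[0, ∞]`. The measure `X.measure` gives `(a, b]` the mass `X b - X a` and
gives no mass to the least quantile `0`. -/
noncomputable def revenue (W X : StieltjesFunction Quantile) : ℝ≥0∞ :=
  ENNReal.ofReal (W 0 * X 0) + ∫⁻ t : Quantile, ENNReal.ofReal ((1 - (t : ℝ)) * W t) ∂X.measure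

/-- `(W, X)` solves the joint problem of maximizing `R` over `W ≺ V` and `X ≺_w Q`. -/
def IsJointSolution (V Q W X : StieltjesFunction Quantile) : Prop :=
  (W ∈ feasibleValues V ∧ X ∈ feasibleAllocations Q) ∧
    ∀ W' ∈ feasibleValues V, ∀ X' ∈ feasibleAllocations Q, revenue W' X' ≤ revenue W X

/-- `W` is an extreme point of a set of quantile functions (a subset of the real vector space of
functions on `[0, 1)`). -/
def IsExtremePointOf (W : StieltjesFunction Quantile) (S : Set (StieltjesFunction Quantile)) :
    Prop :=
  (fun t => W t : Quantile → ℝ) ∈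
    Set.extremePoints ℝ ((fun (f : StieltjesFunction Quantile) (t : Quantile) => f t) '' S)

/-- The quantiles in the interval `[p.1, p.2)`. -/
def cell (p : ℝ × ℝ) : Set Quantile := {t | p.1 ≤ (t : ℝ) ∧ (t : ℝ) < p.2}

/-- A partition of the quantiles, given by its pooling intervals: countably many pairwise disjoint
nonempty intervals `[p.1, p.2)` in `[0, 1)`. Quantiles outside all of them are separated. -/
structure IsQuantilePartition (P : Set (ℝ × ℝ)) : Prop where
  countable : P.Countable
  bounds : ∀ p ∈ P, 0 ≤ p.1 ∧ p.1 < p.2 ∧ p.2 ≤ 1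
  disjoint : P.PairwiseDisjoint cell

/-- `W` is the monotone partitional function that `P` generates from `V`: it is the average of `V`
on each pooling interval, and `V` elsewhere. -/
def IsMonotonePartitional (V : StieltjesFunction Quantile) (P : Set (ℝ × ℝ)) (W : Quantile → ℝ) :
    Prop :=
  (∀ t, (∀ p ∈ P, t ∉ cell p) → W t = V t) ∧
    ∀ p ∈ P, ∀ t ∈ cell p, W t = (∫ s in cell p, V s) / (p.2 - p.1)

/-- `X` is a weak monotone partitional function with partition `P`: the product of a monotone
partitional function with the indicator of `[tm, 1)`. The excluded quantiles `[0, tm)`, which all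
get quality `0`, form one interval of the partition unless there are none. -/
def IsWeakMonotonePartitional (Q : StieltjesFunction Quantile) (P : Set (ℝ × ℝ))
    (X : Quantile → ℝ) : Prop :=
  ∃ (Xhat : Quantile → ℝ) (tm : ℝ), IsMonotonePartitional Q P Xhat ∧ 0 ≤ tm ∧ tm ≤ 1 ∧
    (0 < tm → ((0 : ℝ), tm) ∈ P) ∧
    ∀ t : Quantile, X t = Xhat t * Set.indicator {u : Quantile | tm ≤ (u : ℝ)} (fun _ => (1 : ℝ)) t

/-- `W` and `X` pool the same quantiles: an interval `[s, t)` of quantiles gets one expected value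
if and only if it gets one quality. -/
def HaveSamePools (W X : Quantile → ℝ) : Prop :=
  ∀ s t : Quantile, (∀ u ∈ Set.Ico s t, W u = W s) ↔ (∀ u ∈ Set.Ico s t, X u = X s)

/-!
A partition of the quantiles is encoded by its closed set `C ⊆ [0, 1]` of cut points (`IsCut`), and
`pool hf hC` is the function that it generates from `f`. The proof rests on five observations.

*Pooling one function along the pools of the other raises revenue.* If `X` is constant on the
intervals of `C`, it jumps only at their left ends, where averaging `W` over the intervals moves it
up (`revenue_le_pool_left`). Integrating by parts, revenue is the integral of
`∫_{[s, 1)} X - (1 - s) X(s-)` against the jumps of `W`; if `W` is constant on the intervals of `C`,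
these jumps are at cut points `s`, where averaging `X` preserves the tail integral and lowers the
left limit (`revenue_le_pool_right`).

*Ironing on a finite grid.* If one function is pooled on a finite grid, revenue is a finite sum,
linear in its tail integral. Dropping the grid points where the integrand is not concave, as in the
algorithm that pools adjacent violators, does not lower the sum. After that, summation by parts
shows that the tail integral should be as large as possible, so that `V`, or `Q` without its lowest
quantiles, generates the optimum. Alternating with the first observation, each feasible pair with
`W` pooled on a finite grid does no better than some common partition; arbitrary pairs follow with
finer and finer grids and Fatou's lemma (`revenue_le_of_forall_pool`).

*Compactness.* If the surplus `∫ V Q` is finite, it bounds the revenue from high quantiles uniformly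
(`revenue_tail_le`). Closed sets of cut points converge along an ultrafilter, the pooled functions
then converge on a dense set of quantiles, and comparison with upper Riemann-Stieltjes sums shows
that revenue is upper semicontinuous (`le_revenue_of_tendsto`). So the supremum over common
partitions is attained. If the surplus is infinite, a partition on whose intervals the averages of
`Q` at least double has infinite revenue (`exists_revenue_eq_top`).

*Common support.* From an optimal partition, first drop the cut points around which `W` is constant.
This does not change `W`, and pooling `X` along the remaining cut points does not lower revenue; if
the exclusion threshold was dropped, revenue is affine in how much of the lowest interval is
excluded, so excluding all or none of it is as good. Then drop the cut points around which `X` is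
constant. Pooling `W` once more cannot make it constant around a remaining cut point
(`constNear_of_constNear_pool`), so that now both functions change at every cut point.

*Extreme points.* If the pooled function is a convex combination of feasible functions, then these
are constant on its intervals and have the largest tail integrals at the cut points, and are hence
equal to it (`eq_pool_of_stepOn`).
-/

namespace QuantilePooling

open Set Filter Topology

section

/-! ### Cells, tail integrals and averages -/

lemma coe_zero : ((0 : Quantile) : ℝ) = 0 := rfl

lemma zero_le (t : Quantile) : (0 : Quantile) ≤ t := t.2.1

lemma measurableSet_cell (p : ℝ × ℝ) : MeasurableSet (cell p) :=
  (measurableSet_le measurable_const measurable_subtype_coe).inter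
    (measurableSet_lt measurable_subtype_coe measurable_const)

lemma volume_cell {a b : ℝ} (ha : 0 ≤ a) (hb : b ≤ 1) :
    volume (cell (a, b)) = ENNReal.ofReal (b - a) := by
  have h : (Subtype.val '' cell (a, b) : Set ℝ) = Ico a b := by
    ext x
    constructor
    · rintro ⟨y, hy, rfl⟩
      exact hy
    · intro hx
      exact ⟨⟨x, ha.trans hx.1, hx.2.trans_le hb⟩, hx, rfl⟩
  rw [Measure.Subtype.volume_def,
    (MeasurableEmbedding.subtype_coe measurableSet_Ico).comap_apply, h, Real.volume_Ico]

lemma volume_singleton (t : Quantile) : volume ({t} : Set Quantile) = 0 := by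
  rw [Measure.Subtype.volume_def,
    (MeasurableEmbedding.subtype_coe measurableSet_Ico).comap_apply]
  simp

lemma Ici_eq_cell (t : Quantile) : Ici t = cell ((t : ℝ), 1) := by
  ext s
  exact ⟨fun h => ⟨h, s.2.2⟩, fun h => h.1⟩

lemma cell_union {a b c : ℝ} (hab : a ≤ b) (hbc : b ≤ c) :
    cell (a, b) ∪ cell (b, c) = cell (a, c) := by
  ext s
  simp only [cell, mem_union, mem_ofPred_eq]
  constructor
  · rintro (h | h)
    · exact ⟨h.1, h.2.trans_le hbc⟩
    · exact ⟨hab.trans h.1, h.2⟩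
  · intro h
    rcases lt_or_ge (s : ℝ) b with hs | hs
    · exact Or.inl ⟨h.1, hs⟩
    · exact Or.inr ⟨hs, h.2⟩

lemma cell_disjoint (a b c : ℝ) : Disjoint (cell (a, b)) (cell (b, c)) :=
  Set.disjoint_left.2 fun _ h h' => absurd h.2 (not_lt.2 h'.1)

/-- The integral of `f` over the quantiles `≥ t`. -/
noncomputable def tailInt (f : StieltjesFunction Quantile) (t : ℝ) : ℝ :=
  ∫ s in cell (t, 1), f s

/-- The average of `f` over `[a, b)`, written with tail integrals. -/
noncomputable def avg (f : StieltjesFunction Quantile) (a b : ℝ) : ℝ :=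
  (tailInt f a - tailInt f b) / (b - a)

variable {f g : StieltjesFunction Quantile}

lemma tailInt_one (f : StieltjesFunction Quantile) : tailInt f 1 = 0 := by
  have : cell ((1 : ℝ), 1) = ∅ := by
    ext s
    simp only [cell, mem_ofPred_eq, mem_empty_iff_false, iff_false, not_and, not_lt]
    exact fun h => h
  simp [tailInt, this]

lemma cell_zero_one : cell ((0 : ℝ), 1) = univ := by
  ext s
  simp only [cell, mem_ofPred_eq, mem_univ, iff_true]
  exact ⟨s.2.1, s.2.2⟩

lemma tailInt_zero (f : StieltjesFunction Quantile) : tailInt f 0 = ∫ s, f s := by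
  simp [tailInt, cell_zero_one]

lemma integral_Ici_eq (f : StieltjesFunction Quantile) (t : Quantile) :
    ∫ s in Ici t, f s = tailInt f t := by
  rw [Ici_eq_cell]; rfl

lemma integral_cell (hf : IsQuantileFunction f) {a b : ℝ} (hab : a ≤ b) (hb : b ≤ 1) :
    ∫ s in cell (a, b), f s = tailInt f a - tailInt f b := by
  rw [eq_sub_iff_add_eq, tailInt, tailInt, ← cell_union hab hb]
  exact (setIntegral_union (cell_disjoint a b 1) (measurableSet_cell _)
    hf.integrable.integrableOn hf.integrable.integrableOn).symm

lemma avg_eq_integral_div (hf : IsQuantileFunction f) {a b : ℝ} (hab : a ≤ b) (hb : b ≤ 1) :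
    avg f a b = (∫ s in cell (a, b), f s) / (b - a) := by
  rw [avg, integral_cell hf hab hb]

lemma avg_le (hf : IsQuantileFunction f) {a b c : ℝ} (ha : 0 ≤ a) (hab : a < b) (hb : b ≤ 1)
    (h : ∀ s ∈ cell (a, b), f s ≤ c) : avg f a b ≤ c := by
  rw [avg_eq_integral_div hf hab.le hb, div_le_iff₀ (sub_pos.2 hab)]
  have hv : volume (cell (a, b)) ≠ ∞ := by rw [volume_cell ha hb]; exact ENNReal.ofReal_ne_top
  have := setIntegral_mono_on (μ := volume) hf.integrable.integrableOn
    (integrableOn_const hv) (measurableSet_cell (a, b)) h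
  simpa [measureReal_def, volume_cell ha hb, ENNReal.toReal_ofReal (sub_pos.2 hab).le,
    mul_comm] using this

lemma le_avg (hf : IsQuantileFunction f) {a b c : ℝ} (ha : 0 ≤ a) (hab : a < b) (hb : b ≤ 1)
    (h : ∀ s ∈ cell (a, b), c ≤ f s) : c ≤ avg f a b := by
  rw [avg_eq_integral_div hf hab.le hb, le_div_iff₀ (sub_pos.2 hab)]
  have hv : volume (cell (a, b)) ≠ ∞ := by rw [volume_cell ha hb]; exact ENNReal.ofReal_ne_top
  have := setIntegral_mono_on (μ := volume) (integrableOn_const hv)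
    hf.integrable.integrableOn (measurableSet_cell (a, b)) h
  simpa [measureReal_def, volume_cell ha hb, ENNReal.toReal_ofReal (sub_pos.2 hab).le,
    mul_comm] using this

lemma tailInt_nonneg (hf : IsQuantileFunction f) (t : ℝ) : 0 ≤ tailInt f t :=
  integral_nonneg fun s => hf.nonneg s

lemma tailInt_antitone (hf : IsQuantileFunction f) {a b : ℝ} (hab : a ≤ b) (hb : b ≤ 1) :
    tailInt f b ≤ tailInt f a := by
  rw [← sub_nonneg, ← integral_cell hf hab hb]
  exact integral_nonneg fun s => hf.nonneg s

lemma avg_nonneg (hf : IsQuantileFunction f) {a b : ℝ} (hab : a ≤ b) (hb : b ≤ 1) :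
    0 ≤ avg f a b :=
  div_nonneg (sub_nonneg.2 (tailInt_antitone hf hab hb)) (sub_nonneg.2 hab)

/-- The tail integral of a quantile function is concave: averages over later cells are larger. -/
lemma avg_le_avg (hf : IsQuantileFunction f) {a b c : ℝ} (ha : 0 ≤ a) (hab : a < b) (hbc : b < c)
    (hc : c ≤ 1) : avg f a b ≤ avg f b c := by
  have hb : 0 ≤ b := ha.trans hab.le
  have hb1 : b < 1 := hbc.trans_le hc
  refine (avg_le (c := f ⟨b, hb, hb1⟩) hf ha hab hb1.le fun s hs => f.mono ?_).trans
    (le_avg hf hb hbc hc fun s hs => f.mono hs.1)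
  exact hs.2.le

lemma tailInt_sub (f : StieltjesFunction Quantile) {a b : ℝ} (hab : a < b) :
    tailInt f a - tailInt f b = avg f a b * (b - a) :=
  (div_mul_cancel₀ _ (sub_pos.2 hab).ne').symm

/-- An average over an interval lies between the averages over its two parts. -/
lemma avg_mem_of_split (hf : IsQuantileFunction f) {a b c : ℝ} (ha : 0 ≤ a) (hab : a < b)
    (hbc : b < c) (hc : c ≤ 1) : avg f a b ≤ avg f a c ∧ avg f a c ≤ avg f b c := by
  have h := avg_le_avg hf ha hab hbc hc
  have h1 := tailInt_sub f hab
  have h2 := tailInt_sub f hbc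
  have h3 := tailInt_sub f (hab.trans hbc)
  constructor <;> nlinarith

lemma avg_mono_right (hf : IsQuantileFunction f) {a b c : ℝ} (ha : 0 ≤ a) (hab : a < b)
    (hbc : b ≤ c) (hc : c ≤ 1) : avg f a b ≤ avg f a c := by
  rcases hbc.eq_or_lt with rfl | hbc
  · exact le_rfl
  · exact (avg_mem_of_split hf ha hab hbc hc).1

lemma avg_mono_left (hf : IsQuantileFunction f) {a b c : ℝ} (ha : 0 ≤ a) (hab : a ≤ b)
    (hbc : b < c) (hc : c ≤ 1) : avg f a c ≤ avg f b c := by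
  rcases hab.eq_or_lt with rfl | hab
  · exact le_rfl
  · exact (avg_mem_of_split hf ha hab hbc hc).2

lemma apply_le_avg (hf : IsQuantileFunction f) (s : Quantile) {b : ℝ} (hab : (s : ℝ) < b)
    (hb : b ≤ 1) : f s ≤ avg f s b :=
  le_avg hf s.2.1 hab hb fun _ hu => f.mono hu.1

lemma avg_le_apply (hf : IsQuantileFunction f) {a : ℝ} (ha : 0 ≤ a) (s : Quantile)
    (hab : a < s) : avg f a s ≤ f s :=
  avg_le hf ha hab s.2.2.le fun _ hu => f.mono (show _ ≤ (s : ℝ) from hu.2.le)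

lemma continuous_tailInt (hf : IsQuantileFunction f) : Continuous (tailInt f) := by
  rw [continuous_iff_continuousAt]
  intro t₀
  have h : tailInt f = fun t => ∫ s, (cell (t, 1)).indicator (fun s => f s) s := by
    ext t
    rw [integral_indicator (measurableSet_cell _), tailInt]
  rw [h]
  refine continuousAt_of_dominated (bound := fun s => f s) ?_ ?_ hf.integrable ?_
  · exact Eventually.of_forall fun t =>
      (hf.integrable.indicator (measurableSet_cell _)).aestronglyMeasurable
  · refine Eventually.of_forall fun t => Eventually.of_forall fun s => ?_
    refine (norm_indicator_le_norm_self _ _).trans ?_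
    rw [Real.norm_of_nonneg (hf.nonneg s)]
  · have h0 : ∀ᵐ s : Quantile, (s : ℝ) ≠ t₀ := by
      by_cases ht : t₀ ∈ Ico (0 : ℝ) 1
      · refine measure_mono_null ?_ (volume_singleton ⟨t₀, ht⟩)
        intro s hs
        simpa [Subtype.ext_iff] using hs
      · exact Eventually.of_forall fun s hs => ht (hs ▸ s.2)
    filter_upwards [h0] with s hs
    rcases lt_or_gt_of_ne hs with hs | hs
    · refine continuousAt_const.congr (f := fun _ => (0 : ℝ)) ?_
      filter_upwards [lt_mem_nhds hs] with t ht
      exact (indicator_of_notMem (fun h => absurd h.1 (not_le.2 ht)) _).symm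
    · refine continuousAt_const.congr (f := fun _ => f s) ?_
      filter_upwards [gt_mem_nhds hs] with t ht
      exact (indicator_of_mem (show s ∈ cell (t, 1) from ⟨le_of_lt ht, s.2.2⟩) _).symm

/-- Averages depend continuously on the end points of the interval. -/
lemma tendsto_avg (hf : IsQuantileFunction f) {ι : Type*} {l : Filter ι} {u v : ι → ℝ} {a b : ℝ}
    (hu : Tendsto u l (𝓝 a)) (hv : Tendsto v l (𝓝 b)) (hab : a < b) :
    Tendsto (fun i => avg f (u i) (v i)) l (𝓝 (avg f a b)) :=
  ((((continuous_tailInt hf).tendsto a).comp hu).sub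
    (((continuous_tailInt hf).tendsto b).comp hv)).div (hv.sub hu) (sub_pos.2 hab).ne'

/-- A right-continuous function is determined by its tail integrals. -/
lemma ext_of_tailInt (hf : IsQuantileFunction f) (hg : IsQuantileFunction g)
    (h : ∀ t : Quantile, tailInt f t = tailInt g t) : f = g := by
  have key : ∀ {f g : StieltjesFunction Quantile}, IsQuantileFunction f → IsQuantileFunction g →
      (∀ t : Quantile, tailInt f t = tailInt g t) → ∀ t, f t ≤ g t := by
    intro f g hf hg h t
    have : Tendsto g (𝓝[>] t) (𝓝 (g t)) := (g.right_continuous t).mono_left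
      (nhdsWithin_mono _ Ioi_subset_Ici_self)
    refine ge_of_tendsto this ?_
    filter_upwards [self_mem_nhdsWithin] with u hu
    have h1 := apply_le_avg hf t (b := u) hu u.2.2.le
    have h2 := avg_le_apply hg t.2.1 u hu
    have h3 : avg f t u = avg g t u := by rw [avg, avg, h t, h u]
    linarith
  exact StieltjesFunction.ext fun t =>
    le_antisymm (key hf hg h t) (key hg hf (fun t => (h t).symm) t)

end

section

/-! ### Pooling along a closed set of cut points -/

/-- A partition of the quantiles encoded by its closed set of cut points: the pooling intervals are
the `[a, b)` with `a < b` consecutive cut points, and cut points that are accumulated from the right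
are separated. -/
structure IsCut (C : Set ℝ) : Prop where
  isClosed : IsClosed C
  subset : C ⊆ Icc 0 1
  zero_mem : (0 : ℝ) ∈ C
  one_mem : (1 : ℝ) ∈ C

/-- The last cut point `≤ t`. -/
noncomputable def lo (C : Set ℝ) (t : ℝ) : ℝ := sSup (C ∩ Iic t)

/-- The infimum of the cut points `> t`; it is `t` itself if these accumulate at `t`. -/
noncomputable def hi (C : Set ℝ) (t : ℝ) : ℝ := sInf (C ∩ Ioi t)

/-- `W` is constant on all pooling intervals of `C`: it agrees at `s ≤ t` if no cut point lies in
`(s, t]`. -/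
def StepOn (C : Set ℝ) (W : Quantile → ℝ) : Prop :=
  ∀ s t : Quantile, s ≤ t → (∀ c ∈ C, c ≤ t → c ≤ s) → W s = W t

variable {f g : StieltjesFunction Quantile} {C D : Set ℝ}

section Cut

variable (hC : IsCut C) (t : Quantile)
include hC

lemma IsCut.bddAbove : BddAbove C := ⟨1, fun _ hc => (hC.subset hc).2⟩

lemma IsCut.bddBelow : BddBelow C := ⟨0, fun _ hc => (hC.subset hc).1⟩

lemma IsCut.lo_mem' : lo C t ∈ C ∩ Iic (t : ℝ) :=
  (hC.isClosed.inter isClosed_Iic).csSup_mem ⟨0, hC.zero_mem, t.2.1⟩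
    (hC.bddAbove.mono inter_subset_left)

lemma IsCut.lo_mem : lo C t ∈ C := (hC.lo_mem' t).1

lemma IsCut.lo_le : lo C t ≤ t := (hC.lo_mem' t).2

lemma IsCut.lo_nonneg : 0 ≤ lo C t := (hC.subset (hC.lo_mem t)).1

lemma IsCut.le_lo {c : ℝ} (hc : c ∈ C) (hct : c ≤ t) : c ≤ lo C t :=
  le_csSup (hC.bddAbove.mono inter_subset_left) ⟨hc, hct⟩

lemma IsCut.le_hi : (t : ℝ) ≤ hi C t :=
  le_csInf ⟨1, hC.one_mem, t.2.2⟩ fun _ hc => le_of_lt hc.2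

lemma IsCut.hi_le {c : ℝ} (hc : c ∈ C) (htc : (t : ℝ) < c) : hi C t ≤ c :=
  csInf_le (hC.bddBelow.mono inter_subset_left) ⟨hc, htc⟩

lemma IsCut.hi_le_one : hi C t ≤ 1 := hC.hi_le t hC.one_mem t.2.2

lemma IsCut.hi_mem : hi C t ∈ C := by
  have := csInf_mem_closure (s := C ∩ Ioi (t : ℝ)) ⟨1, hC.one_mem, t.2.2⟩
    (hC.bddBelow.mono inter_subset_left)
  exact hC.isClosed.closure_subset_iff.2 inter_subset_left this

lemma IsCut.eq_of_not_lt (h : ¬ lo C t < hi C t) : lo C t = t ∧ hi C t = t := by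
  have h1 := hC.lo_le t
  have h2 := hC.le_hi t
  constructor <;> linarith

lemma IsCut.lt_hi (h : lo C t < hi C t) : (t : ℝ) < hi C t := by
  refine lt_of_le_of_ne (hC.le_hi t) fun h' => ?_
  have := hC.le_lo t (hC.hi_mem t) h'.ge
  linarith

/-- Quantiles of one pooling interval have the same end points. -/
lemma IsCut.lo_hi_eq {s t : Quantile} (hs : s ∈ cell (lo C t, hi C t)) :
    lo C s = lo C t ∧ hi C s = hi C t := by
  have hgap : ∀ c ∈ C, c ≤ lo C t ∨ hi C t ≤ c := fun c hc =>
    (le_or_gt c t).imp (hC.le_lo t hc) (hC.hi_le t hc)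
  constructor
  · refine le_antisymm ?_ (hC.le_lo s (hC.lo_mem t) hs.1)
    exact (hgap _ (hC.lo_mem s)).resolve_right fun h' =>
      absurd (hs.2.trans_le h') (not_lt.2 (hC.lo_le s))
  · refine le_antisymm (hC.hi_le s (hC.hi_mem t) hs.2) ?_
    refine le_csInf ⟨1, hC.one_mem, s.2.2⟩ fun c hc => ?_
    exact (hgap c hc.1).resolve_left fun h' => absurd hc.2 (not_lt.2 (h'.trans hs.1))

lemma IsCut.mem_cell (h : lo C t < hi C t) : t ∈ cell (lo C t, hi C t) :=
  ⟨hC.lo_le t, hC.lt_hi t h⟩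

/-- Without a cut point in `(s, t]`, the quantiles `s` and `t` lie in one pooling interval. -/
lemma IsCut.lo_hi_eq_of_noCut {s t : Quantile} (hst : s ≤ t) (h : ∀ c ∈ C, c ≤ t → c ≤ s) :
    lo C s = lo C t ∧ hi C s = hi C t := by
  rcases hst.eq_or_lt with rfl | hst
  · exact ⟨rfl, rfl⟩
  have hlt : (t : ℝ) < hi C s := by
    by_contra! h'
    have h1 := h _ (hC.hi_mem s) h'
    have h2 := hC.le_hi s
    have h3 : hi C s = s := le_antisymm h1 h2
    have h4 : (s : ℝ) < t := hst
    obtain ⟨c, hc, hct⟩ := exists_lt_of_csInf_lt (s := C ∩ Ioi (s : ℝ)) ⟨1, hC.one_mem, s.2.2⟩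
      (show hi C s < t by rw [h3]; exact h4)
    exact absurd (h c hc.1 hct.le) (not_le.2 hc.2)
  have hlt' : lo C s < hi C s := ((hC.lo_le s).trans_lt hst).trans hlt
  have := hC.lo_hi_eq (s := t) ⟨(hC.lo_le s).trans hst.le, hlt⟩
  exact ⟨this.1.symm, this.2.symm⟩

/-- Consecutive cut points `a < b` are the end points of a pooling interval. -/
lemma IsCut.lo_hi_eq_of_consecutive {a b : ℝ} (ha : a ∈ C) (hb : b ∈ C)
    (h : ∀ c ∈ C, c ≤ a ∨ b ≤ c) {t : Quantile} (ht : t ∈ cell (a, b)) :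
    lo C t = a ∧ hi C t = b := by
  constructor
  · refine le_antisymm ?_ (hC.le_lo t ha ht.1)
    exact (h _ (hC.lo_mem t)).resolve_right fun h' =>
      absurd (ht.2.trans_le h') (not_lt.2 (hC.lo_le t))
  · refine le_antisymm (hC.hi_le t hb ht.2) ?_
    refine le_csInf ⟨1, hC.one_mem, t.2.2⟩ fun c hc => ?_
    exact (h c hc.1).resolve_left fun h' => absurd hc.2 (not_lt.2 (h'.trans ht.1))

end Cut

/-- The monotone partitional function generated from `f` by the cut points `C`. -/
noncomputable def poolFun (f : StieltjesFunction Quantile) (C : Set ℝ) (t : Quantile) : ℝ :=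
  open Classical in if lo C t < hi C t then avg f (lo C t) (hi C t) else f t

lemma poolFun_of_lt {t : Quantile} (h : lo C t < hi C t) :
    poolFun f C t = avg f (lo C t) (hi C t) := if_pos h

lemma poolFun_of_not_lt {t : Quantile} (h : ¬ lo C t < hi C t) : poolFun f C t = f t := if_neg h

lemma poolFun_eq_avg (hC : IsCut C) {a b : ℝ} (ha : a ∈ C) (hb : b ∈ C)
    (h : ∀ c ∈ C, c ≤ a ∨ b ≤ c) {t : Quantile} (ht : t ∈ cell (a, b)) :
    poolFun f C t = avg f a b := by
  obtain ⟨h1, h2⟩ := hC.lo_hi_eq_of_consecutive ha hb h ht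
  rw [poolFun_of_lt, h1, h2]
  rw [h1, h2]
  exact ht.1.trans_lt ht.2

section Pool

variable (hf : IsQuantileFunction f) (hC : IsCut C)
include hf hC

lemma poolFun_le_leftLim {t c : Quantile} (htc : t < c) (hc : (c : ℝ) ∈ C) :
    poolFun f C t ≤ Function.leftLim f c := by
  have hhi := hC.hi_le t hc htc
  by_cases h : lo C t < hi C t
  · rw [poolFun_of_lt h]
    exact avg_le hf (hC.lo_nonneg t) h (hC.hi_le_one t) fun s hs =>
      f.mono.le_leftLim (show (s : ℝ) < c from hs.2.trans_le hhi)
  · rw [poolFun_of_not_lt h]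
    exact f.mono.le_leftLim htc

lemma poolFun_le {t c : Quantile} (htc : t < c) (hc : (c : ℝ) ∈ C) : poolFun f C t ≤ f c :=
  (poolFun_le_leftLim hf hC htc hc).trans (f.mono.leftLim_le le_rfl)

lemma le_poolFun {c t : Quantile} (hct : c ≤ t) (hc : (c : ℝ) ∈ C) : f c ≤ poolFun f C t := by
  by_cases h : lo C t < hi C t
  · rw [poolFun_of_lt h]
    exact le_avg hf (hC.lo_nonneg t) h (hC.hi_le_one t) fun s hs =>
      f.mono (show (c : ℝ) ≤ s from (hC.le_lo t hc hct).trans hs.1)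
  · rw [poolFun_of_not_lt h]
    exact f.mono hct

omit hf in
lemma stepOn_poolFun : StepOn C (poolFun f C) := by
  intro s t hst h
  obtain ⟨h1, h2⟩ := hC.lo_hi_eq_of_noCut hst h
  by_cases hl : lo C t < hi C t
  · rw [poolFun_of_lt hl, poolFun_of_lt (by rwa [h1, h2]), h1, h2]
  · have hs := hC.eq_of_not_lt s (by rwa [h1, h2])
    have ht := hC.eq_of_not_lt t hl
    rw [show s = t from Subtype.ext (by rw [← hs.1, h1, ht.1])]

lemma poolFun_monotone : Monotone (poolFun f C) := by
  intro s t hst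
  by_cases h : ∀ c ∈ C, c ≤ t → c ≤ s
  · exact (stepOn_poolFun hC s t hst h).le
  · push Not at h
    obtain ⟨c, hc, hct, hsc⟩ := h
    have hc' : c ∈ Ico (0 : ℝ) 1 := ⟨(hC.subset hc).1, hct.trans_lt t.2.2⟩
    exact (poolFun_le hf hC (c := ⟨c, hc'⟩) hsc hc).trans (le_poolFun hf hC (c := ⟨c, hc'⟩) hct hc)

lemma poolFun_right_continuous (t : Quantile) : ContinuousWithinAt (poolFun f C) (Ici t) t := by
  by_cases h : ∃ t' : Quantile, t < t' ∧ ∀ c ∈ C, c ≤ t' → c ≤ t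
  · obtain ⟨t', htt', h⟩ := h
    refine continuousWithinAt_const.congr_of_eventuallyEq (f := fun _ => poolFun f C t) ?_ rfl
    filter_upwards [self_mem_nhdsWithin, mem_nhdsWithin_of_mem_nhds (Iio_mem_nhds htt')]
      with u hu hut'
    exact (stepOn_poolFun hC t u hu fun c hc hcu =>
      h c hc (hcu.trans (le_of_lt (show (u : ℝ) < t' from hut')))).symm
  · push Not at h
    -- the cut points accumulate at `t` from the right, so `t` is separated
    have hhi : hi C t = t := by
      refine le_antisymm (le_of_forall_gt_imp_ge_of_dense fun x hx => ?_) (hC.le_hi t)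
      rcases lt_or_ge x 1 with hx1 | hx1
      · obtain ⟨c, hc, hcx, htc⟩ := h ⟨x, t.2.1.trans hx.le, hx1⟩ hx
        exact (hC.hi_le t hc htc).trans hcx
      · exact (hC.hi_le_one t).trans hx1
    have heq : poolFun f C t = f t :=
      poolFun_of_not_lt fun h' => absurd (hC.lt_hi t h') (by rw [hhi]; exact lt_irrefl _)
    have hft : Tendsto f (𝓝[≥] t) (𝓝 (f t)) := f.right_continuous t
    refine tendsto_order.2 ⟨fun a ha => ?_, fun a ha => ?_⟩
    · filter_upwards [self_mem_nhdsWithin] with u hu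
      exact ha.trans_le (poolFun_monotone hf hC hu)
    · rw [heq] at ha
      have hev : ∀ᶠ u in 𝓝[>] t, f u < a :=
        (hft.eventually_lt_const ha).filter_mono (nhdsWithin_mono _ Ioi_subset_Ici_self)
      obtain ⟨t', ht', htt'⟩ := (hev.and self_mem_nhdsWithin).exists
      obtain ⟨c, hc, hct', htc⟩ := h t' htt'
      have hc' : c ∈ Ico (0 : ℝ) 1 := ⟨(hC.subset hc).1, hct'.trans_lt t'.2.2⟩
      filter_upwards [mem_nhdsWithin_of_mem_nhds (Iio_mem_nhds (show t < ⟨c, hc'⟩ from htc))]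
        with u hu
      exact ((poolFun_le hf hC hu hc).trans
        (f.mono (show (⟨c, hc'⟩ : Quantile) ≤ t' from hct'))).trans_lt ht'

end Pool

/-- `poolFun` as a right-continuous monotone function. -/
noncomputable def pool (hf : IsQuantileFunction f) (hC : IsCut C) : StieltjesFunction Quantile where
  toFun := poolFun f C
  mono' := poolFun_monotone hf hC
  right_continuous' := poolFun_right_continuous hf hC

lemma pool_apply (hf : IsQuantileFunction f) (hC : IsCut C) (t : Quantile) :
    pool hf hC t = poolFun f C t := rfl

/-- The pooling intervals of the cut points `C`. -/
def cells (C : Set ℝ) : Set (ℝ × ℝ) :=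
  {p | ∃ t : Quantile, lo C t < hi C t ∧ p = (lo C t, hi C t)}

lemma isQuantilePartition_cells (hC : IsCut C) : IsQuantilePartition (cells C) := by
  have hcell : ∀ p ∈ cells C, ∀ s : Quantile, s ∈ cell p → p = (lo C s, hi C s) := by
    rintro p ⟨t, ht, rfl⟩ s hs
    obtain ⟨h1, h2⟩ := hC.lo_hi_eq hs
    rw [h1, h2]
  have hbd : ∀ p ∈ cells C, 0 ≤ p.1 ∧ p.1 < p.2 ∧ p.2 ≤ 1 := by
    rintro p ⟨t, ht, rfl⟩
    exact ⟨hC.lo_nonneg t, ht, hC.hi_le_one t⟩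
  have hdisj : (cells C).PairwiseDisjoint cell := by
    intro p hp q hq hpq
    refine Set.disjoint_left.2 fun s hs hs' => hpq ?_
    rw [hcell p hp s hs, hcell q hq s hs']
  refine ⟨?_, hbd, hdisj⟩
  refine Set.PairwiseDisjoint.countable_of_nonempty_interior (s := fun p : ℝ × ℝ => Ico p.1 p.2)
    (fun p hp q hq hpq => ?_) fun p hp => ?_
  · refine Set.disjoint_left.2 fun x hx hx' => ?_
    have hx01 : x ∈ Ico (0 : ℝ) 1 := ⟨(hbd p hp).1.trans hx.1, hx.2.trans_le (hbd p hp).2.2⟩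
    exact Set.disjoint_left.1 (hdisj hp hq hpq) (show (⟨x, hx01⟩ : Quantile) ∈ cell p from hx) hx'
  · rw [interior_Ico]
    exact nonempty_Ioo.2 (hbd p hp).2.1

lemma isMonotonePartitional_pool (hf : IsQuantileFunction f) (hC : IsCut C) :
    IsMonotonePartitional f (cells C) (pool hf hC) := by
  constructor
  · intro t ht
    exact poolFun_of_not_lt fun h => ht _ ⟨t, h, rfl⟩ (hC.mem_cell t h)
  · rintro p ⟨s, hs, rfl⟩ t ht
    obtain ⟨h1, h2⟩ := hC.lo_hi_eq ht
    rw [pool_apply, poolFun_of_lt (by rwa [h1, h2]), h1, h2,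
      avg_eq_integral_div hf hs.le (hC.hi_le_one s)]

section Pool

variable (hf : IsQuantileFunction f) (hC : IsCut C)
include hf hC

lemma poolFun_nonneg (t : Quantile) : 0 ≤ poolFun f C t :=
  (hf.nonneg 0).trans (le_poolFun hf hC (zero_le t) hC.zero_mem)

/-- Pooling preserves the integral over `[c, 1)` for a cut point `c`: the integral is preserved on
each of the countably many pooling intervals. -/
lemma lintegral_poolFun {c : ℝ} (hc : c ∈ C) :
    ∫⁻ t in cell (c, 1), ENNReal.ofReal (poolFun f C t)
      = ∫⁻ t in cell (c, 1), ENNReal.ofReal (f t) := by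
  set P : Set (ℝ × ℝ) := {p ∈ cells C | c ≤ p.1} with hP
  set U : Set Quantile := ⋃ p ∈ P, cell p with hU
  have hpart := isQuantilePartition_cells hC
  have hPc : P.Countable := hpart.countable.mono (sep_subset _ _)
  have hPd : P.PairwiseDisjoint cell := hpart.disjoint.subset (sep_subset _ _)
  have hUm : MeasurableSet U := MeasurableSet.biUnion hPc fun p _ => measurableSet_cell p
  have hUsub : cell (c, 1) ∩ U = U := by
    refine inter_eq_right.2 (iUnion₂_subset fun p hp s hs => ⟨hp.2.trans hs.1, s.2.2⟩)
  rw [← lintegral_inter_add_sdiff _ (cell (c, 1)) hUm,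
    ← lintegral_inter_add_sdiff (fun t => ENNReal.ofReal (f t)) (cell (c, 1)) hUm, hUsub]
  congr 1
  · rw [hU, lintegral_biUnion hPc (fun p _ => measurableSet_cell p) hPd,
      lintegral_biUnion hPc (fun p _ => measurableSet_cell p) hPd]
    refine tsum_congr fun p => ?_
    obtain ⟨h0, h1, h2⟩ := hpart.bounds p p.2.1
    have hconst : ∀ t ∈ cell p, ENNReal.ofReal (poolFun f C t)
        = ENNReal.ofReal (avg f (p : ℝ × ℝ).1 (p : ℝ × ℝ).2) := fun t ht => by
      rw [avg_eq_integral_div hf h1.le h2]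
      exact congrArg _ ((isMonotonePartitional_pool hf hC).2 p p.2.1 t ht)
    rw [setLIntegral_congr_fun (measurableSet_cell _) hconst, setLIntegral_const,
      volume_cell h0 h2, ← ENNReal.ofReal_mul (avg_nonneg hf h1.le h2), ← tailInt_sub f h1,
      ← integral_cell hf h1.le h2,
      ofReal_integral_eq_lintegral_ofReal hf.integrable.integrableOn
        (Eventually.of_forall fun s => hf.nonneg s)]
  · refine setLIntegral_congr_fun ((measurableSet_cell _).diff hUm) fun t ht => ?_
    rw [poolFun_of_not_lt fun h => ?_]
    exact ht.2 (mem_biUnion (show (lo C t, hi C t) ∈ P from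
      ⟨⟨t, h, rfl⟩, hC.le_lo t hc ht.1.1⟩) (hC.mem_cell t h))

lemma isQuantileFunction_pool : IsQuantileFunction (pool hf hC) := by
  refine ⟨poolFun_nonneg hf hC, ?_⟩
  have hm : Measurable (fun t => poolFun f C t) := (poolFun_monotone hf hC).measurable
  refine ⟨hm.aestronglyMeasurable, ?_⟩
  refine (hasFiniteIntegral_iff_ofReal (Eventually.of_forall (poolFun_nonneg hf hC))).2 ?_
  have h := lintegral_poolFun hf hC hC.zero_mem
  rw [cell_zero_one, setLIntegral_univ, setLIntegral_univ] at h
  refine lt_of_eq_of_lt h ?_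
  exact (hasFiniteIntegral_iff_ofReal (Eventually.of_forall hf.nonneg)).1 hf.integrable.2

lemma tailInt_pool_of_mem {c : ℝ} (hc : c ∈ C) : tailInt (pool hf hC) c = tailInt f c := by
  have h := lintegral_poolFun hf hC hc
  have hp := isQuantileFunction_pool hf hC
  rw [tailInt, tailInt, integral_eq_lintegral_of_nonneg_ae (Eventually.of_forall hp.nonneg)
      hp.integrable.integrableOn.1, integral_eq_lintegral_of_nonneg_ae
      (Eventually.of_forall hf.nonneg) hf.integrable.integrableOn.1]
  exact congrArg _ h

lemma tailInt_pool_le (t : Quantile) : tailInt (pool hf hC) t ≤ tailInt f t := by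
  by_cases h : lo C t < hi C t
  · have ht := hC.lt_hi t h
    have hp := isQuantileFunction_pool hf hC
    have h1 : tailInt (pool hf hC) t - tailInt (pool hf hC) (hi C t) ≤
        tailInt f t - tailInt f (hi C t) := by
      rw [tailInt_sub _ ht, tailInt_sub _ ht]
      refine mul_le_mul_of_nonneg_right ?_ (sub_pos.2 ht).le
      refine (avg_le hp t.2.1 ht (hC.hi_le_one t) (c := avg f (lo C t) (hi C t))
        fun s hs => ?_).trans (avg_mono_left hf (hC.lo_nonneg t) (hC.lo_le t) ht (hC.hi_le_one t))
      obtain ⟨h1, h2⟩ := hC.lo_hi_eq ⟨(hC.lo_le t).trans hs.1, hs.2⟩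
      rw [pool_apply, poolFun_of_lt (by rwa [h1, h2]), h1, h2]
    rw [tailInt_pool_of_mem hf hC (hC.hi_mem t)] at h1
    linarith
  · rw [tailInt_pool_of_mem hf hC]
    rw [← (hC.eq_of_not_lt t h).1]
    exact hC.lo_mem t

lemma pool_mem_feasibleValues : pool hf hC ∈ feasibleValues f := by
  refine ⟨isQuantileFunction_pool hf hC, fun t => ?_, ?_⟩
  · rw [integral_Ici_eq, integral_Ici_eq]
    exact tailInt_pool_le hf hC t
  · rw [← tailInt_zero, ← tailInt_zero]
    exact tailInt_pool_of_mem hf hC hC.zero_mem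

/-- A step function with the right tail integrals at the cut points is the pooled function. -/
lemma eq_pool_of_stepOn (hg : IsQuantileFunction g) (hstep : StepOn C g)
    (h : ∀ c ∈ C, tailInt g c = tailInt f c) : g = pool hf hC := by
  refine ext_of_tailInt hg (isQuantileFunction_pool hf hC) fun t => ?_
  have hp := isQuantileFunction_pool hf hC
  by_cases hl : lo C t < hi C t
  · have ht := hC.lt_hi t hl
    -- on a pooling interval both functions are constant, with the same average
    have key : ∀ {k : StieltjesFunction Quantile}, IsQuantileFunction k → StepOn C k →
        avg k t (hi C t) = avg k (lo C t) (hi C t) := by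
      intro k hk hks
      have hcst : ∀ s ∈ cell (lo C t, hi C t), k s = k t := by
        intro s hs
        have hgap : ∀ c ∈ C, c ≤ lo C t ∨ hi C t ≤ c := fun c hc =>
          (le_or_gt c t).imp (hC.le_lo t hc) (hC.hi_le t hc)
        rcases le_total s t with hst | hst
        · refine hks s t hst fun c hc hct => (hC.le_lo t hc hct).trans hs.1
        · exact (hks t s hst fun c hc hcs => ((hgap c hc).resolve_right fun h' =>
            absurd (hs.2.trans_le h') (not_lt.2 hcs)).trans (hC.lo_le t)).symm
      have e1 : avg k t (hi C t) = k t :=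
        le_antisymm (avg_le hk t.2.1 ht (hC.hi_le_one t) fun s hs =>
          (hcst s ⟨(hC.lo_le t).trans hs.1, hs.2⟩).le)
        (le_avg hk t.2.1 ht (hC.hi_le_one t) fun s hs =>
          (hcst s ⟨(hC.lo_le t).trans hs.1, hs.2⟩).ge)
      have e2 : avg k (lo C t) (hi C t) = k t :=
        le_antisymm (avg_le hk (hC.lo_nonneg t) hl (hC.hi_le_one t) fun s hs => (hcst s hs).le)
        (le_avg hk (hC.lo_nonneg t) hl (hC.hi_le_one t) fun s hs => (hcst s hs).ge)
      rw [e1, e2]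
    have hlo : tailInt g (lo C t) = tailInt (pool hf hC) (lo C t) := by
      rw [h _ (hC.lo_mem t), tailInt_pool_of_mem hf hC (hC.lo_mem t)]
    have hhi : tailInt g (hi C t) = tailInt (pool hf hC) (hi C t) := by
      rw [h _ (hC.hi_mem t), tailInt_pool_of_mem hf hC (hC.hi_mem t)]
    have e : avg g t (hi C t) = avg (pool hf hC) t (hi C t) := by
      rw [key hg hstep, key hp (stepOn_poolFun hC), avg, avg, hlo, hhi]
    have e1 := tailInt_sub g ht
    have e2 := tailInt_sub (pool hf hC) ht
    rw [e, ← e2, hhi] at e1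
    linarith
  · have ht : (t : ℝ) ∈ C := by rw [← (hC.eq_of_not_lt t hl).1]; exact hC.lo_mem t
    rw [h _ ht, tailInt_pool_of_mem hf hC ht]

end Pool

/-- Pooling twice, the second time along fewer cut points, is pooling once. -/
lemma pool_pool (hf : IsQuantileFunction f) (hC : IsCut C) (hD : IsCut D) (hDC : D ⊆ C) :
    pool (isQuantileFunction_pool hf hC) hD = pool hf hD := by
  refine eq_pool_of_stepOn hf hD (isQuantileFunction_pool _ hD) (stepOn_poolFun hD) fun c hc => ?_
  rw [tailInt_pool_of_mem _ hD hc, tailInt_pool_of_mem hf hC (hDC hc)]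

/-! ### Excluding low quantiles -/

/-- The function `Q · 1_{[b, 1)}`. -/
noncomputable def cut {Q : StieltjesFunction Quantile} (hQ : IsQuantileFunction Q) (b : ℝ) :
    StieltjesFunction Quantile where
  toFun t := open Classical in if b ≤ t then Q t else 0
  mono' s t hst := by
    dsimp only
    by_cases hs : b ≤ s
    · rw [if_pos hs, if_pos (hs.trans hst)]
      exact Q.mono hst
    · rw [if_neg hs]
      split_ifs
      exacts [hQ.nonneg t, le_rfl]
  right_continuous' t := by
    by_cases ht : b ≤ t
    · refine (Q.right_continuous t).congr (fun u hu => if_pos (ht.trans hu)) (if_pos ht)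
    · refine continuousWithinAt_const.congr_of_eventuallyEq (f := fun _ => (0 : ℝ)) ?_ (if_neg ht)
      have : ∀ᶠ u : Quantile in 𝓝 t, (u : ℝ) < b :=
        (continuous_subtype_val.tendsto t).eventually_lt_const (not_le.1 ht)
      filter_upwards [mem_nhdsWithin_of_mem_nhds this] with u hu
      exact if_neg (not_le.2 hu)

section Excl

variable {Q : StieltjesFunction Quantile} (hQ : IsQuantileFunction Q) {b : ℝ}

lemma cut_of_le {t : Quantile} (h : b ≤ t) : cut hQ b t = Q t := if_pos h

lemma cut_of_lt {t : Quantile} (h : (t : ℝ) < b) : cut hQ b t = 0 := if_neg (not_le.2 h)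

lemma cut_le (b : ℝ) (t : Quantile) : cut hQ b t ≤ Q t := by
  rcases le_or_gt b t with h | h
  · rw [cut_of_le hQ h]
  · rw [cut_of_lt hQ h]
    exact hQ.nonneg t

lemma cut_zero : cut hQ 0 = Q := StieltjesFunction.ext fun t => cut_of_le hQ t.2.1

lemma isQuantileFunction_cut (b : ℝ) : IsQuantileFunction (cut hQ b) := by
  have hn : ∀ t, 0 ≤ cut hQ b t := fun t => by
    rcases le_or_gt b t with h | h
    · rw [cut_of_le hQ h]
      exact hQ.nonneg t
    · rw [cut_of_lt hQ h]
  refine ⟨hn, hQ.integrable.mono' (cut hQ b).mono.measurable.aestronglyMeasurable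
    (Eventually.of_forall fun t => ?_)⟩
  rw [Real.norm_of_nonneg (hn t)]
  exact cut_le hQ b t

lemma tailInt_cut_of_le {t : ℝ} (h : b ≤ t) : tailInt (cut hQ b) t = tailInt Q t :=
  setIntegral_congr_fun (measurableSet_cell _) fun _ hs => cut_of_le hQ (h.trans hs.1)

lemma tailInt_cut_of_ge {t : ℝ} (h : t ≤ b) (hb : b ≤ 1) :
    tailInt (cut hQ b) t = tailInt Q b := by
  rw [← tailInt_cut_of_le hQ (le_refl b), ← sub_eq_zero,
    ← integral_cell (isQuantileFunction_cut hQ b) h hb,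
    setIntegral_congr_fun (measurableSet_cell (t, b)) fun _ hs => cut_of_lt hQ hs.2]
  simp

/-- Excluding the quantiles below a cut point commutes with pooling. -/
lemma poolFun_cut (hC : IsCut C) (hb : b ∈ C) (t : Quantile) :
    poolFun (cut hQ b) C t = if b ≤ t then poolFun Q C t else 0 := by
  by_cases h : lo C t < hi C t
  · rw [poolFun_of_lt h, poolFun_of_lt h]
    split_ifs with hbt
    · have h1 := hC.le_lo t hb hbt
      rw [avg, avg, tailInt_cut_of_le hQ h1, tailInt_cut_of_le hQ (h1.trans h.le)]
    · have h1 := hC.hi_le t hb (not_le.1 hbt)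
      have hb1 := (hC.subset hb).2
      rw [avg, tailInt_cut_of_ge hQ h1 hb1, tailInt_cut_of_ge hQ (h.le.trans h1) hb1, sub_self,
        zero_div]
  · rw [poolFun_of_not_lt h, poolFun_of_not_lt h]
    rfl

lemma pool_cut_mem_feasibleAllocations (hC : IsCut C) (hb1 : b ≤ 1) :
    pool (isQuantileFunction_cut hQ b) hC ∈ feasibleAllocations Q := by
  refine ⟨isQuantileFunction_pool _ hC, fun t => ?_⟩
  rw [integral_Ici_eq, integral_Ici_eq]
  refine (tailInt_pool_le _ hC t).trans ?_
  rcases le_total b t with h | h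
  · rw [tailInt_cut_of_le hQ h]
  · rw [tailInt_cut_of_ge hQ h hb1]
    exact tailInt_antitone hQ h hb1

/-- The pooled function without the quantiles below `b` is weak monotone partitional, if `[0, b)`
is empty or one of the pooling intervals. -/
lemma isWeakMonotonePartitional_pool_cut (hC : IsCut C) (hb : b ∈ C)
    (hgap : ∀ c ∈ C, c ≤ 0 ∨ b ≤ c) :
    IsWeakMonotonePartitional Q (cells C) (pool (isQuantileFunction_cut hQ b) hC) := by
  refine ⟨pool hQ hC, b, isMonotonePartitional_pool hQ hC, (hC.subset hb).1, (hC.subset hb).2,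
    fun hb0 => ?_, fun t => ?_⟩
  · obtain ⟨h1, h2⟩ := hC.lo_hi_eq_of_consecutive hC.zero_mem hb hgap (t := 0) ⟨le_rfl, hb0⟩
    exact ⟨0, by rw [h1, h2]; exact hb0, by rw [h1, h2]⟩
  · rw [pool_apply, pool_apply, poolFun_cut hQ hC hb]
    split_ifs with h
    · rw [indicator_of_mem (show t ∈ {u : Quantile | b ≤ (u : ℝ)} from h), mul_one]
    · rw [indicator_of_notMem (show t ∉ {u : Quantile | b ≤ (u : ℝ)} from h), mul_zero]

end Excl

end

section

/-! ### Revenue as an integral against the jump measure -/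

variable {f V Q W X : StieltjesFunction Quantile} {C : Set ℝ}

/-- The Lebesgue-Stieltjes measure of `X` on `[0, 1)` including the jump from `0` to `X 0` at the
least quantile, so that `[0, t]` has mass `X t`. -/
noncomputable def jumpMeasure (X : StieltjesFunction Quantile) : Measure Quantile :=
  X.measure + ENNReal.ofReal (X 0) • Measure.dirac 0

/-- The left limit of `X` at `s`, which is `0` at the least quantile. -/
noncomputable def leftVal (X : StieltjesFunction Quantile) (s : Quantile) : ℝ :=
  open Classical in if s = 0 then 0 else Function.leftLim X s

instance : IsFiniteMeasure (volume : Measure Quantile) where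
  measure_univ_lt_top := by
    rw [← cell_zero_one, volume_cell le_rfl le_rfl]
    exact ENNReal.ofReal_lt_top

instance (X : StieltjesFunction Quantile) : SFinite (jumpMeasure X) := by
  unfold jumpMeasure; infer_instance

lemma leftVal_zero (X : StieltjesFunction Quantile) : leftVal X 0 = 0 := if_pos rfl

lemma leftVal_of_ne (X : StieltjesFunction Quantile) {s : Quantile} (hs : s ≠ 0) :
    leftVal X s = Function.leftLim X s := if_neg hs

lemma leftVal_le (hX : IsQuantileFunction X) (s : Quantile) : leftVal X s ≤ X s := by
  rcases eq_or_ne s 0 with rfl | hs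
  · rw [leftVal_zero]; exact hX.nonneg 0
  · rw [leftVal_of_ne X hs]; exact X.mono.leftLim_le le_rfl

lemma leftVal_nonneg (hX : IsQuantileFunction X) (s : Quantile) : 0 ≤ leftVal X s := by
  rcases eq_or_ne s 0 with rfl | hs
  · rw [leftVal_zero]
  · rw [leftVal_of_ne X hs]
    exact (hX.nonneg 0).trans (X.mono.le_leftLim (lt_of_le_of_ne (zero_le s) hs.symm))

lemma nhdsLT_neBot {s : Quantile} (hs : s ≠ 0) : (𝓝[<] s).NeBot :=
  nhdsLT_neBot_of_exists_lt ⟨0, lt_of_le_of_ne (zero_le s) hs.symm⟩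

lemma jumpMeasure_Icc (hX : IsQuantileFunction X) {s u : Quantile} (hsu : s ≤ u) :
    jumpMeasure X (Icc s u) = ENNReal.ofReal (X u - leftVal X s) := by
  rw [jumpMeasure, Measure.add_apply, Measure.smul_apply, StieltjesFunction.measure_Icc,
    Measure.dirac_apply' _ measurableSet_Icc, smul_eq_mul]
  rcases eq_or_ne s 0 with rfl | hs
  · rw [leftLim_eq_of_isBot (fun t => zero_le t), leftVal_zero,
      indicator_of_mem (show (0 : Quantile) ∈ Icc 0 u from ⟨le_rfl, hsu⟩), Pi.one_apply, mul_one,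
      ← ENNReal.ofReal_add (sub_nonneg.2 (X.mono hsu)) (hX.nonneg 0)]
    simp
  · rw [leftVal_of_ne X hs, indicator_of_notMem, mul_zero, add_zero]
    exact fun h => hs (le_antisymm h.1 (zero_le s))

lemma jumpMeasure_Icc_zero (hX : IsQuantileFunction X) (u : Quantile) :
    jumpMeasure X (Icc 0 u) = ENNReal.ofReal (X u) := by
  rw [jumpMeasure_Icc hX (zero_le u), leftVal_zero, sub_zero]

lemma jumpMeasure_Ioc (X : StieltjesFunction Quantile) (s u : Quantile) :
    jumpMeasure X (Ioc s u) = ENNReal.ofReal (X u - X s) := by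
  rw [jumpMeasure, Measure.add_apply, Measure.smul_apply, StieltjesFunction.measure_Ioc,
    Measure.dirac_apply' _ measurableSet_Ioc, indicator_of_notMem, smul_zero, add_zero]
  exact fun h => absurd h.1 (not_lt.2 (zero_le s))

lemma jumpMeasure_singleton (hX : IsQuantileFunction X) (s : Quantile) :
    jumpMeasure X {s} = ENNReal.ofReal (X s - leftVal X s) := by
  rw [← Icc_self, jumpMeasure_Icc hX le_rfl]

lemma measurable_payoff (W : StieltjesFunction Quantile) :
    Measurable fun t : Quantile => ENNReal.ofReal ((1 - (t : ℝ)) * W t) :=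
  ((measurable_const.sub measurable_subtype_coe).mul W.mono.measurable).ennreal_ofReal

lemma revenue_eq_lintegral (W X : StieltjesFunction Quantile) (hW : IsQuantileFunction W) :
    revenue W X = ∫⁻ t : Quantile, ENNReal.ofReal ((1 - (t : ℝ)) * W t) ∂jumpMeasure X := by
  rw [jumpMeasure, lintegral_add_measure, lintegral_smul_measure,
    lintegral_dirac' _ (measurable_payoff W), revenue, add_comm, coe_zero, sub_zero, one_mul,
    smul_eq_mul, mul_comm (W 0), ENNReal.ofReal_mul' (hW.nonneg 0)]

/-- Exchange of the order of integration over `c ≤ t ≤ u`. -/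
lemma lintegral_lintegral_Ici (μ ν : Measure Quantile) [SFinite μ] [SFinite ν]
    {g : Quantile → ℝ≥0∞} (hg : Measurable g) (c : Quantile) :
    ∫⁻ t in Ici c, (∫⁻ u in Ici t, g u ∂ν) ∂μ = ∫⁻ u in Ici c, g u * μ (Icc c u) ∂ν := by
  have hset : MeasurableSet {p : Quantile × Quantile | c ≤ p.1 ∧ p.1 ≤ p.2} :=
    (measurableSet_le (f := fun _ : Quantile × Quantile => c) (g := fun p => p.1)
      measurable_const measurable_fst).inter
      (measurableSet_le (f := fun p : Quantile × Quantile => p.1) (g := fun p => p.2)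
        measurable_fst measurable_snd)
  have h1 : ∫⁻ t in Ici c, (∫⁻ u in Ici t, g u ∂ν) ∂μ = ∫⁻ t, ∫⁻ u,
      {p : Quantile × Quantile | c ≤ p.1 ∧ p.1 ≤ p.2}.indicator (fun p => g p.2) (t, u) ∂ν ∂μ := by
    rw [← lintegral_indicator measurableSet_Ici]
    refine lintegral_congr fun t => ?_
    by_cases ht : c ≤ t
    · rw [indicator_of_mem (show t ∈ Ici c from ht), ← lintegral_indicator measurableSet_Ici]
      refine lintegral_congr fun u => ?_
      by_cases hu : t ≤ u
      · rw [indicator_of_mem (show u ∈ Ici t from hu), indicator_of_mem]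
        exact ⟨ht, hu⟩
      · rw [indicator_of_notMem (show u ∉ Ici t from hu), indicator_of_notMem]
        exact fun h => hu h.2
    · rw [indicator_of_notMem (show t ∉ Ici c from ht)]
      refine (lintegral_eq_zero_of_ae_eq_zero (Eventually.of_forall fun u => ?_)).symm
      exact indicator_of_notMem (fun h => ht h.1) _
  have hm : AEMeasurable (Function.uncurry fun t u : Quantile =>
      {p : Quantile × Quantile | c ≤ p.1 ∧ p.1 ≤ p.2}.indicator (fun p => g p.2) (t, u))
      (μ.prod ν) := ((hg.comp measurable_snd).indicator hset).aemeasurable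
  rw [h1, lintegral_lintegral_swap hm, ← lintegral_indicator measurableSet_Ici]
  refine lintegral_congr fun u => ?_
  have h2 : ∀ t, {p : Quantile × Quantile | c ≤ p.1 ∧ p.1 ≤ p.2}.indicator (fun p => g p.2) (t, u)
      = (Icc c u).indicator (fun _ => g u) t := by
    intro t
    by_cases h : c ≤ t ∧ t ≤ u
    · rw [indicator_of_mem (show t ∈ Icc c u from h), indicator_of_mem]
      exact h
    · rw [indicator_of_notMem (show t ∉ Icc c u from h), indicator_of_notMem]
      exact h
  rw [lintegral_congr h2, lintegral_indicator_const measurableSet_Icc]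
  by_cases hu : c ≤ u
  · rw [indicator_of_mem (show u ∈ Ici c from hu)]
  · rw [indicator_of_notMem (show u ∉ Ici c from hu), Icc_eq_empty hu, measure_empty, mul_zero]

lemma Ici_zero : Ici (0 : Quantile) = univ := eq_univ_of_forall zero_le

lemma volume_Ici (t : Quantile) : volume (Ici t) = ENNReal.ofReal (1 - (t : ℝ)) := by
  rw [Ici_eq_cell, volume_cell t.2.1 le_rfl]

lemma volume_real_Ici (t : Quantile) : volume.real (Ici t) = 1 - (t : ℝ) := by
  rw [measureReal_def, volume_Ici, ENNReal.toReal_ofReal (sub_nonneg.2 t.2.2.le)]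

lemma measurable_ofReal_apply (f : StieltjesFunction Quantile) :
    Measurable fun t => ENNReal.ofReal (f t) := f.mono.measurable.ennreal_ofReal

lemma ofReal_tailInt (hf : IsQuantileFunction f) (t : Quantile) :
    ENNReal.ofReal (tailInt f t) = ∫⁻ u in Ici t, ENNReal.ofReal (f u) := by
  rw [← integral_Ici_eq, ofReal_integral_eq_lintegral_ofReal hf.integrable.integrableOn
    (Eventually.of_forall hf.nonneg)]

/-- The mass `∫_{[s, 1)} (1 - t) dX(t)` that `X` puts on raising `W` from `s` on. -/
lemma lintegral_one_sub (hX : IsQuantileFunction X) (s : Quantile) :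
    ∫⁻ t in Ici s, ENNReal.ofReal (1 - (t : ℝ)) ∂jumpMeasure X
      = ENNReal.ofReal (tailInt X s - (1 - s) * leftVal X s) := by
  have h1 : ∀ t : Quantile, ENNReal.ofReal (1 - (t : ℝ)) = ∫⁻ _ in Ici t, 1 := fun t => by
    rw [setLIntegral_one, volume_Ici]
  simp_rw [h1]
  rw [lintegral_lintegral_Ici _ _ measurable_const]
  have h2 : ∀ u ∈ Ici s, 1 * jumpMeasure X (Icc s u) = ENNReal.ofReal (X u - leftVal X s) :=
    fun u hu => by rw [one_mul, jumpMeasure_Icc hX hu]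
  have hc : IntegrableOn (fun _ : Quantile => leftVal X s) (Ici s) volume :=
    integrableOn_const (by rw [volume_Ici]; exact ENNReal.ofReal_ne_top)
  have hi : IntegrableOn (fun u => X u - leftVal X s) (Ici s) volume :=
    hX.integrable.integrableOn.sub hc
  rw [setLIntegral_congr_fun measurableSet_Ici h2, ← ofReal_integral_eq_lintegral_ofReal hi,
    integral_sub hX.integrable.integrableOn hc,
    setIntegral_const, volume_real_Ici, integral_Ici_eq, smul_eq_mul]
  filter_upwards [ae_restrict_mem measurableSet_Ici] with u hu
  exact sub_nonneg.2 ((leftVal_le hX s).trans (X.mono hu))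

/-- Revenue as an integral against the jumps of `W`. -/
lemma revenue_eq_lintegral_jump (hW : IsQuantileFunction W) (hX : IsQuantileFunction X) :
    revenue W X = ∫⁻ s : Quantile,
      ENNReal.ofReal (tailInt X s - (1 - s) * leftVal X s) ∂jumpMeasure W := by
  have h1 : ∀ t : Quantile, ENNReal.ofReal ((1 - (t : ℝ)) * W t)
      = ENNReal.ofReal (1 - (t : ℝ)) * jumpMeasure W (Icc 0 t) := fun t => by
    rw [jumpMeasure_Icc_zero hW, ENNReal.ofReal_mul (sub_nonneg.2 t.2.2.le)]
  have hm : Measurable fun t : Quantile => ENNReal.ofReal (1 - (t : ℝ)) :=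
    (measurable_const.sub measurable_subtype_coe).ennreal_ofReal
  rw [revenue_eq_lintegral W X hW, lintegral_congr h1, ← setLIntegral_univ, ← Ici_zero,
    ← lintegral_lintegral_Ici _ _ hm, Ici_zero, setLIntegral_univ]
  exact lintegral_congr fun s => lintegral_one_sub hX s

/-- A step function jumps only at cut points. -/
lemma jumpMeasure_compl (hC : IsCut C) (hstep : StepOn C X) :
    jumpMeasure X {t : Quantile | (t : ℝ) ∉ C} = 0 := by
  refine measure_null_of_locally_null _ fun t ht => ?_
  have h1 : lo C t < t := lt_of_le_of_ne (hC.lo_le t) fun h => ht (h ▸ hC.lo_mem t)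
  have h2 : t < hi C t := lt_of_le_of_ne (hC.le_hi t) fun h => ht (h ▸ hC.hi_mem t)
  obtain ⟨b, htb, hb⟩ := exists_between h2
  let a' : Quantile := ⟨lo C t, hC.lo_nonneg t, h1.trans t.2.2⟩
  let b' : Quantile := ⟨b, t.2.1.trans htb.le, hb.trans_le (hC.hi_le_one t)⟩
  refine ⟨Ioc a' b', mem_nhdsWithin_of_mem_nhds (mem_of_superset
    (Ioo_mem_nhds (show a' < t from h1) (show t < b' from htb)) Ioo_subset_Ioc_self), ?_⟩
  rw [jumpMeasure_Ioc, hstep a' b' (h1.trans htb).le fun c hc hcb => ?_, sub_self,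
    ENNReal.ofReal_zero]
  by_contra h
  rcases le_or_gt c t with hct | hct
  · exact h (hC.le_lo t hc hct)
  · exact absurd (hC.hi_le t hc hct) (not_le.2 (lt_of_le_of_lt hcb hb))

lemma ae_mem_cut (hC : IsCut C) (hstep : StepOn C X) :
    ∀ᵐ (t : Quantile) ∂jumpMeasure X, (t : ℝ) ∈ C :=
  jumpMeasure_compl hC hstep

/-- Pooling `W` on intervals where `X` is constant raises revenue: `X` only jumps at their left
ends, and there `W` goes up. -/
lemma revenue_le_pool_left (hW : IsQuantileFunction W) (hC : IsCut C) (hstep : StepOn C X) :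
    revenue W X ≤ revenue (pool hW hC) X := by
  rw [revenue_eq_lintegral W X hW, revenue_eq_lintegral _ X (isQuantileFunction_pool hW hC)]
  refine lintegral_mono_ae ?_
  filter_upwards [ae_mem_cut hC hstep] with t ht
  exact ENNReal.ofReal_le_ofReal (mul_le_mul_of_nonneg_left (le_poolFun hW hC le_rfl ht)
    (sub_nonneg.2 t.2.2.le))

/-- Pooling `X` on intervals where `W` is constant raises revenue: `W` only jumps at cut points `s`,
where pooling preserves the tail integral of `X` and lowers its left limit. -/
lemma revenue_le_pool_right (hW : IsQuantileFunction W) (hX : IsQuantileFunction X) (hC : IsCut C)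
    (hstep : StepOn C W) : revenue W X ≤ revenue W (pool hX hC) := by
  rw [revenue_eq_lintegral_jump hW hX,
    revenue_eq_lintegral_jump hW (isQuantileFunction_pool hX hC)]
  refine lintegral_mono_ae ?_
  filter_upwards [ae_mem_cut hC hstep] with s hs
  refine ENNReal.ofReal_le_ofReal ?_
  rw [tailInt_pool_of_mem hX hC hs]
  refine sub_le_sub_left (mul_le_mul_of_nonneg_left ?_ (sub_nonneg.2 s.2.2.le)) _
  rcases eq_or_ne s 0 with rfl | h0
  · rw [leftVal_zero, leftVal_zero]
  · rw [leftVal_of_ne _ h0, leftVal_of_ne _ h0]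
    have := nhdsLT_neBot h0
    refine le_of_tendsto ((pool hX hC).mono.tendsto_leftLim s) ?_
    filter_upwards [self_mem_nhdsWithin] with u hu
    exact poolFun_le_leftLim hX hC hu hs

/-! ### Revenue on the tail is bounded by the efficient surplus -/

lemma tailInt_le_of_weaklyMajorizedBy {A W : StieltjesFunction Quantile}
    (h : WeaklyMajorizedBy A W) {c : ℝ} (hc : c ∈ Icc (0 : ℝ) 1) : tailInt A c ≤ tailInt W c := by
  rcases hc.2.eq_or_lt with rfl | hc1
  · rw [tailInt_one, tailInt_one]
  · have := h ⟨c, hc.1, hc1⟩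
    rwa [integral_Ici_eq, integral_Ici_eq] at this

lemma tailInt_zero_of_mem_feasibleValues (hW : W ∈ feasibleValues V) :
    tailInt W 0 = tailInt V 0 := by
  rw [tailInt_zero, tailInt_zero]
  exact hW.2.2

lemma one_sub_mul_le_tailInt (hW : IsQuantileFunction W) (t : Quantile) :
    (1 - (t : ℝ)) * W t ≤ tailInt W t := by
  have h1 := apply_le_avg hW t t.2.2 le_rfl
  have h2 := tailInt_sub W t.2.2
  rw [tailInt_one] at h2
  nlinarith [t.2.2]

lemma lintegral_mul_eq (hV : IsQuantileFunction V) (hX : IsQuantileFunction X) (c : Quantile) :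
    ∫⁻ u in Ici c, ENNReal.ofReal (X u) * ENNReal.ofReal (V u)
      = ENNReal.ofReal (tailInt X c) * ENNReal.ofReal (leftVal V c)
        + ∫⁻ t in Ici c, ENNReal.ofReal (tailInt X t) ∂jumpMeasure V := by
  simp_rw [ofReal_tailInt hX]
  rw [lintegral_lintegral_Ici _ _ (measurable_ofReal_apply X),
    ← lintegral_mul_const _ (measurable_ofReal_apply X), ← lintegral_add_left
      ((measurable_ofReal_apply X).mul_const _)]
  refine setLIntegral_congr_fun measurableSet_Ici fun u hu => ?_
  rw [← mul_add, jumpMeasure_Icc hV hu, ← ENNReal.ofReal_add (leftVal_nonneg hV c)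
    (sub_nonneg.2 ((leftVal_le hV c).trans (V.mono hu))), add_sub_cancel]

/-- The revenue from the quantiles `≥ c` is at most the surplus `∫_{[c, 1)} V Q`. -/
lemma revenue_tail_le (hV : IsQuantileFunction V) (hQ : IsQuantileFunction Q)
    (hW : W ∈ feasibleValues V) (hX : X ∈ feasibleAllocations Q) (c : Quantile) :
    ∫⁻ t in Ici c, ENNReal.ofReal ((1 - (t : ℝ)) * W t) ∂jumpMeasure X
      ≤ ∫⁻ u in Ici c, ENNReal.ofReal (Q u) * ENNReal.ofReal (V u) := by
  calc ∫⁻ t in Ici c, ENNReal.ofReal ((1 - (t : ℝ)) * W t) ∂jumpMeasure X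
      ≤ ∫⁻ t in Ici c, (∫⁻ u in Ici t, ENNReal.ofReal (V u)) ∂jumpMeasure X := by
        refine lintegral_mono fun t => ?_
        dsimp only
        rw [← ofReal_tailInt hV]
        exact ENNReal.ofReal_le_ofReal ((one_sub_mul_le_tailInt hW.1 t).trans
          (tailInt_le_of_weaklyMajorizedBy hW.2.1 ⟨t.2.1, t.2.2.le⟩))
    _ = ∫⁻ u in Ici c, ENNReal.ofReal (V u) * jumpMeasure X (Icc c u) :=
        lintegral_lintegral_Ici _ _ (measurable_ofReal_apply V) c
    _ ≤ ∫⁻ u in Ici c, ENNReal.ofReal (X u) * ENNReal.ofReal (V u) := by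
        refine lintegral_mono fun u => ?_
        dsimp only
        rw [mul_comm]
        refine mul_le_mul_left ?_ _
        rw [← jumpMeasure_Icc_zero hX.1]
        exact measure_mono (Icc_subset_Icc_left (zero_le c))
    _ ≤ ∫⁻ u in Ici c, ENNReal.ofReal (Q u) * ENNReal.ofReal (V u) := by
        rw [lintegral_mul_eq hV hX.1, lintegral_mul_eq hV hQ]
        have h := fun t : Quantile => ENNReal.ofReal_le_ofReal
          (tailInt_le_of_weaklyMajorizedBy hX.2 ⟨t.2.1, t.2.2.le⟩)
        exact add_le_add (mul_le_mul_left (h c) _) (lintegral_mono fun t => h t)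

end

section

/-! ### Ironing on a finite grid -/

/-- The average rate at which `m` decreases between `a` and `b`. -/
noncomputable def decSlope (m : ℝ → ℝ) (a b : ℝ) : ℝ := (m a - m b) / (b - a)

/-- The grid point after the current one; the last grid point is followed by `1`. -/
def next (l : List ℝ) : ℝ := l.headD 1

/-- The sum, over the intervals `[a, b)` of a grid, of the decrease of `m` times the average rate of
decrease of `J`. If `J` is the tail integral of a function `Y` that is pooled on the grid, this is
`∫ m dY`. The end point `1` of the grid is left implicit. -/
noncomputable def gridSum (m J : ℝ → ℝ) : List ℝ → ℝ
  | [] => 0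
  | a :: l => decSlope m a (next l) * (J a - J (next l)) + gridSum m J l

/-- The piecewise linear interpolation of `m` on the grid is concave. -/
def ConcaveOnGrid (m : ℝ → ℝ) : List ℝ → Prop
  | [] => True
  | a :: l => (∀ b l', l = b :: l' → decSlope m a b ≤ decSlope m b (next l')) ∧ ConcaveOnGrid m l

variable {m J K : ℝ → ℝ}

lemma decSlope_mul (m : ℝ → ℝ) {a b : ℝ} (h : a < b) : decSlope m a b * (b - a) = m a - m b :=
  div_mul_cancel₀ _ (sub_pos.2 h).ne'

lemma next_mem_Icc {a : ℝ} {l : List ℝ} (hp : (a :: l).Pairwise (· < ·))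
    (hl : ∀ x ∈ a :: l, x < 1) : a < next l ∧ next l ≤ 1 := by
  cases l with
  | nil => exact ⟨hl a (by simp), le_rfl⟩
  | cons b l => exact ⟨(List.pairwise_cons.1 hp).1 b (by simp), (hl b (by simp)).le⟩

lemma gridSum_sub (m J K : ℝ → ℝ) (l : List ℝ) :
    gridSum m (fun x => K x - J x) l = gridSum m K l - gridSum m J l := by
  induction l with
  | nil => simp [gridSum]
  | cons a l ih =>
    simp only [gridSum, ih]
    ring

lemma gridSum_congr {l : List ℝ} (h : ∀ x ∈ l, J x = K x) (h1 : J 1 = K 1) :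
    gridSum m J l = gridSum m K l := by
  induction l with
  | nil => rfl
  | cons a l ih =>
    have hn : J (next l) = K (next l) := by
      cases l with
      | nil => exact h1
      | cons b l => exact h b (by simp)
    simp only [gridSum, ih fun x hx => h x (by simp [hx]), h a (by simp), hn]

/-- Summation by parts: on a grid where `m` is concave, `∫ m dY` increases in the tail integral. -/
lemma decSlope_mul_le_gridSum (D : ℝ → ℝ) (hD1 : D 1 = 0) {a : ℝ} {l : List ℝ}
    (hm : ConcaveOnGrid m (a :: l)) (hD : ∀ x ∈ a :: l, 0 ≤ D x) :
    decSlope m a (next l) * D a ≤ gridSum m D (a :: l) := by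
  induction l generalizing a with
  | nil => simp [gridSum, next, hD1]
  | cons b l ih =>
    have h1 := ih (a := b) hm.2 fun x hx => hD x (List.mem_cons_of_mem _ hx)
    have h2 := hm.1 b l rfl
    have h3 := hD b (by simp)
    have h4 : gridSum m D (a :: b :: l) = decSlope m a b * (D a - D b) + gridSum m D (b :: l) := rfl
    rw [h4, show next (b :: l) = b from rfl]
    nlinarith

/-- Dropping a grid point at which `m` lies below its chord. -/
lemma gridSum_drop (hJ : ∀ a b c, 0 ≤ a → a < b → b < c → c ≤ 1 → decSlope J a b ≤ decSlope J b c)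
    {a b c : ℝ} (ha : 0 ≤ a) (hab : a < b) (hbc : b < c) (hc : c ≤ 1)
    (hm : decSlope m b c ≤ decSlope m a b) :
    decSlope m a b * (J a - J b) + decSlope m b c * (J b - J c)
      ≤ decSlope m a c * (J a - J c) := by
  have h1 := decSlope_mul m hab
  have h2 := decSlope_mul m hbc
  have h3 := decSlope_mul J hab
  have h4 := decSlope_mul J hbc
  have hj := hJ a b c ha hab hbc hc
  have hca : 0 < c - a := by linarith
  have h5 : decSlope m a c = (decSlope m a b * (b - a) + decSlope m b c * (c - b)) / (c - a) := by
    rw [h1, h2, decSlope]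
    ring
  rw [h5, show J a - J c = decSlope J a b * (b - a) + decSlope J b c * (c - b) by
    rw [h3, h4]; ring, ← h3, ← h4, div_mul_eq_mul_div, le_div_iff₀ hca]
  have h6 : 0 ≤ (b - a) * (c - b) * ((decSlope m a b - decSlope m b c)
      * (decSlope J b c - decSlope J a b)) :=
    mul_nonneg (mul_nonneg (by linarith) (by linarith))
      (mul_nonneg (by linarith) (by linarith))
  nlinarith

lemma concaveOnGrid_or_exists_shorter
    (hJ : ∀ a b c, 0 ≤ a → a < b → b < c → c ≤ 1 → decSlope J a b ≤ decSlope J b c) (l : List ℝ)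
    (hp : l.Pairwise (· < ·)) (hl : ∀ x ∈ l, 0 ≤ x ∧ x < 1) :
    ConcaveOnGrid m l ∨ ∃ l' : List ℝ, l'.length < l.length ∧ l'.Sublist l ∧
      l'.head? = l.head? ∧ gridSum m J l ≤ gridSum m J l' := by
  induction l with
  | nil => exact Or.inl trivial
  | cons a l ih =>
    have hp' := (List.pairwise_cons.1 hp).2
    have hl' : ∀ x ∈ l, 0 ≤ x ∧ x < 1 := fun x hx => hl x (List.mem_cons_of_mem _ hx)
    rcases ih hp' hl' with h | ⟨l', h1, h2, h3, h4⟩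
    · by_cases hv : ∀ b l', l = b :: l' → decSlope m a b ≤ decSlope m b (next l')
      · exact Or.inl ⟨hv, h⟩
      · push Not at hv
        obtain ⟨b, l', rfl, hv⟩ := hv
        refine Or.inr ⟨a :: l', by simp, (List.sublist_cons_self b l').cons_cons a, rfl, ?_⟩
        have hb := next_mem_Icc hp' fun x hx => (hl' x hx).2
        have hab : a < b := (List.pairwise_cons.1 hp).1 b (by simp)
        have := gridSum_drop hJ (hl a (by simp)).1 hab hb.1 hb.2 hv.le
        have h4 : gridSum m J (a :: b :: l') = decSlope m a b * (J a - J b) +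
          (decSlope m b (next l') * (J b - J (next l')) + gridSum m J l') := rfl
        have h5 : gridSum m J (a :: l') =
          decSlope m a (next l') * (J a - J (next l')) + gridSum m J l' := rfl
        linarith
    · refine Or.inr ⟨a :: l', by simpa using h1, h2.cons_cons a, rfl, ?_⟩
      have hn : next l' = next l := by
        cases l <;> cases l' <;> simp_all [next]
      simp only [gridSum, hn]
      linarith

/-- Pooling adjacent violators: dropping grid points at which `m` is not concave raises `∫ m dY`. -/
lemma exists_concaveOnGrid
    (hJ : ∀ a b c, 0 ≤ a → a < b → b < c → c ≤ 1 → decSlope J a b ≤ decSlope J b c) (l : List ℝ)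
    (hp : l.Pairwise (· < ·)) (hl : ∀ x ∈ l, 0 ≤ x ∧ x < 1) :
    ∃ l' : List ℝ, l'.Sublist l ∧ l'.head? = l.head? ∧ ConcaveOnGrid m l' ∧
      gridSum m J l ≤ gridSum m J l' := by
  induction hn : l.length using Nat.strong_induction_on generalizing l with
  | _ n ih =>
    rcases concaveOnGrid_or_exists_shorter (m := m) hJ l hp hl with h | ⟨l', h1, h2, h3, h4⟩
    · exact ⟨l, List.Sublist.refl l, rfl, h, le_rfl⟩
    · obtain ⟨l'', h5, h6, h7, h8⟩ := ih l'.length (hn ▸ h1) l' (hp.sublist h2)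
        (fun x hx => hl x (h2.subset hx)) rfl
      exact ⟨l'', h5.trans h2, h6.trans h3, h7, h4.trans h8⟩

/-- Under majorization, `m` can be replaced by its concave envelope on the grid, and against a
concave `m` the larger tail integral `K` is better. -/
lemma exists_grid_of_majorized
    (hJ : ∀ a b c, 0 ≤ a → a < b → b < c → c ≤ 1 → decSlope J a b ≤ decSlope J b c)
    (hJ1 : J 1 = 0) (hK1 : K 1 = 0) {a : ℝ} (l : List ℝ) (hp : (a :: l).Pairwise (· < ·))
    (hl : ∀ x ∈ a :: l, 0 ≤ x ∧ x < 1) (hJK : ∀ x ∈ a :: l, J x ≤ K x) (ha : J a = K a) :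
    ∃ l' : List ℝ, (a :: l').Sublist (a :: l) ∧ gridSum m J (a :: l) ≤ gridSum m K (a :: l') := by
  obtain ⟨l', h1, h2, h3, h4⟩ := exists_concaveOnGrid (m := m) hJ (a :: l) hp hl
  cases l' with
  | nil => simp at h2
  | cons b l' =>
    obtain rfl : b = a := by simpa using h2
    refine ⟨l', h1, h4.trans ?_⟩
    have := decSlope_mul_le_gridSum (fun x => K x - J x) (by simp [hJ1, hK1]) h3
      fun x hx => sub_nonneg.2 (hJK x (h1.subset hx))
    rw [gridSum_sub] at this
    rw [ha, sub_self, mul_zero] at this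
    linarith

/-- Under weak majorization, the intervals on which `m` increases are given up; by concavity they
are the lowest ones. -/
lemma exists_grid_of_weaklyMajorized
    (hJ : ∀ a b c, 0 ≤ a → a < b → b < c → c ≤ 1 → decSlope J a b ≤ decSlope J b c)
    (hJ1 : J 1 = 0) (hK1 : K 1 = 0) (hJa : ∀ a b, a < b → b ≤ 1 → J b ≤ J a) (l : List ℝ)
    (hp : l.Pairwise (· < ·)) (hl : ∀ x ∈ l, 0 ≤ x ∧ x < 1) (hJK : ∀ x ∈ l, J x ≤ K x) :
    ∃ l' : List ℝ, l'.Sublist l ∧ gridSum m J l ≤ gridSum m K l' := by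
  obtain ⟨l', h1, -, h3, h4⟩ := exists_concaveOnGrid (m := m) hJ l hp hl
  suffices h : ∃ l'' : List ℝ, l''.Sublist l' ∧ gridSum m J l' ≤ gridSum m K l'' by
    obtain ⟨l'', h5, h6⟩ := h
    exact ⟨l'', h5.trans h1, h4.trans h6⟩
  have hp' := hp.sublist h1
  have hl' : ∀ x ∈ l', x < 1 := fun x hx => (hl x (h1.subset hx)).2
  have hJK' : ∀ x ∈ l', J x ≤ K x := fun x hx => hJK x (h1.subset hx)
  clear h1 h4
  induction l' with
  | nil => exact ⟨[], List.Sublist.refl _, le_rfl⟩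
  | cons a l' ih =>
    rcases le_or_gt 0 (decSlope m a (next l')) with hs | hs
    · refine ⟨a :: l', List.Sublist.refl _, ?_⟩
      have := decSlope_mul_le_gridSum (fun x => K x - J x) (by simp [hJ1, hK1]) h3
        fun x hx => sub_nonneg.2 (hJK' x hx)
      rw [gridSum_sub] at this
      have h5 := mul_nonneg hs (sub_nonneg.2 (hJK' a (by simp)))
      linarith
    · obtain ⟨l'', h5, h6⟩ := ih h3.2 (List.pairwise_cons.1 hp').2
        (fun x hx => hl' x (List.mem_cons_of_mem _ hx))
        (fun x hx => hJK' x (List.mem_cons_of_mem _ hx))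
      refine ⟨l'', h5.trans (List.sublist_cons_self a l'), le_trans ?_ h6⟩
      have hn := next_mem_Icc hp' hl'
      have := mul_nonpos_of_nonpos_of_nonneg hs.le (sub_nonneg.2 (hJa a _ hn.1 hn.2))
      simp only [gridSum]
      linarith

/-! ### Revenue of functions pooled on a finite grid -/

variable {Q W X Y : StieltjesFunction Quantile} {C : Set ℝ}

/-- The extension of a function on the quantiles to `ℝ` by `0`. -/
noncomputable def extendZero (φ : Quantile → ℝ) (t : ℝ) : ℝ :=
  open Classical in if h : t ∈ Ico (0 : ℝ) 1 then φ ⟨t, h⟩ else 0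

lemma extendZero_coe (φ : Quantile → ℝ) (t : Quantile) : extendZero φ t = φ t := dif_pos t.2

lemma extendZero_one (φ : Quantile → ℝ) : extendZero φ 1 = 0 := dif_neg fun h => lt_irrefl _ h.2

lemma leftVal_eq_of_const {a b : Quantile} (hab : a < b)
    (h : ∀ s ∈ cell ((a : ℝ), (b : ℝ)), Y s = Y a) : leftVal Y b = Y a := by
  have hb : b ≠ 0 := (lt_of_le_of_lt (zero_le a) hab).ne'
  have := nhdsLT_neBot hb
  rw [leftVal_of_ne Y hb]
  refine tendsto_nhds_unique (Y.mono.tendsto_leftLim b) (tendsto_const_nhds.congr' ?_)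
  filter_upwards [self_mem_nhdsWithin, mem_nhdsWithin_of_mem_nhds (Ioi_mem_nhds hab)] with s hs hs'
  exact (h s ⟨le_of_lt hs', hs⟩).symm

/-- A step function on a finite grid turns integrals against its jumps into grid sums. -/
lemma lintegral_jumpMeasure_grid (hY : IsQuantileFunction Y) (hC : IsCut C) (hstep : StepOn C Y)
    (φ : Quantile → ℝ) (hφ : ∀ t, 0 ≤ φ t) (l : List ℝ) (a : Quantile)
    (hp : ((a : ℝ) :: l).Pairwise (· < ·)) (hl : ∀ x ∈ (a : ℝ) :: l, x ∈ C ∧ x < 1)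
    (hCl : ∀ c ∈ C, a ≤ c → c ∈ (a : ℝ) :: l ∨ c = 1) :
    0 ≤ gridSum (extendZero φ) (tailInt Y) ((a : ℝ) :: l) - φ a * leftVal Y a ∧
    ∫⁻ t in cell ((a : ℝ), 1), ENNReal.ofReal (φ t) ∂jumpMeasure Y
      = ENNReal.ofReal
        (gridSum (extendZero φ) (tailInt Y) ((a : ℝ) :: l) - φ a * leftVal Y a) := by
  induction l generalizing a with
  | nil =>
    have hcst : ∀ s ∈ cell ((a : ℝ), 1), Y s = Y a := fun s hs => by
      refine (hstep a s hs.1 fun c hc hcs => ?_).symm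
      by_contra h
      rcases hCl c hc (not_le.1 h).le with h' | h'
      · rw [List.mem_singleton] at h'
        exact h h'.le
      · rw [h'] at hcs
        exact absurd hcs (not_le.2 s.2.2)
    have havg : tailInt Y a - tailInt Y 1 = Y a * (1 - a) := by
      rw [tailInt_sub Y a.2.2, le_antisymm (avg_le hY a.2.1 a.2.2 le_rfl fun s hs => (hcst s hs).le)
        (le_avg hY a.2.1 a.2.2 le_rfl fun s hs => (hcst s hs).ge)]
    have h1 : (1 - (a : ℝ)) ≠ 0 := (sub_pos.2 a.2.2).ne'
    have hsum : gridSum (extendZero φ) (tailInt Y) [(a : ℝ)] = φ a * Y a := by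
      simp only [gridSum, next, List.headD, decSlope, havg, extendZero_coe, extendZero_one]
      field_simp
      ring
    rw [hsum, ← mul_sub]
    have hj := sub_nonneg.2 (leftVal_le hY a)
    refine ⟨mul_nonneg (hφ a) hj, ?_⟩
    have hset : cell ((a : ℝ), 1) =ᵐ[jumpMeasure Y] ({a} : Set Quantile) := by
      filter_upwards [ae_mem_cut hC hstep] with s hs
      refine propext ⟨fun h => Subtype.ext ?_, ?_⟩
      · rcases hCl s hs h.1 with h' | h'
        · simpa using h'
        · exact absurd s.2.2 (by rw [h']; exact lt_irrefl _)
      · rintro rfl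
        exact ⟨le_rfl, s.2.2⟩
    rw [setLIntegral_congr hset, lintegral_singleton, jumpMeasure_singleton hY,
      ENNReal.ofReal_mul (hφ a)]
  | cons b l ih =>
    have hab : (a : ℝ) < b := (List.pairwise_cons.1 hp).1 b (by simp)
    have hb1 : b < 1 := (hl b (by simp)).2
    have hb0 : 0 ≤ b := a.2.1.trans hab.le
    lift b to Quantile using ⟨hb0, hb1⟩
    have hgap : ∀ c ∈ C, c ≤ a ∨ b ≤ c := fun c hc => by
      by_contra! h
      rcases hCl c hc h.1.le with h' | h'
      · rcases List.mem_cons.1 h' with h' | h'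
        · exact h.1.ne' h'
        · rcases List.mem_cons.1 h' with h' | h'
          · exact h.2.ne h'
          · exact absurd h.2 (not_lt.2
              ((List.pairwise_cons.1 (List.pairwise_cons.1 hp).2).1 c h').le)
      · exact absurd (h'.symm.trans_lt h.2) (not_lt.2 hb1.le)
    have hcst : ∀ s ∈ cell ((a : ℝ), (b : ℝ)), Y s = Y a := fun s hs =>
      (hstep a s hs.1 fun c hc hcs => (hgap c hc).resolve_right fun h =>
        absurd (hs.2.trans_le h) (not_lt.2 hcs)).symm
    have havg : tailInt Y a - tailInt Y b = Y a * (b - a) := by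
      rw [tailInt_sub Y hab, le_antisymm (avg_le hY a.2.1 hab hb1.le fun s hs => (hcst s hs).le)
        (le_avg hY a.2.1 hab hb1.le fun s hs => (hcst s hs).ge)]
    obtain ⟨ih1, ih2⟩ := ih b (List.pairwise_cons.1 hp).2
      (fun x hx => hl x (List.mem_cons_of_mem _ hx)) fun c hc hbc => by
        rcases hCl c hc (hab.le.trans hbc) with h | h
        · refine Or.inl ((List.mem_cons.1 h).resolve_left fun h' => ?_)
          rw [h'] at hbc
          exact absurd hbc (not_le.2 hab)
        · exact Or.inr h
    rw [leftVal_eq_of_const hab hcst] at ih1 ih2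
    have h1 : ((b : ℝ) - (a : ℝ)) ≠ 0 := (sub_pos.2 hab).ne'
    have hsum : gridSum (extendZero φ) (tailInt Y) ((a : ℝ) :: b :: l) - φ a * leftVal Y a
        = φ a * (Y a - leftVal Y a) +
          (gridSum (extendZero φ) (tailInt Y) ((b : ℝ) :: l) - φ b * Y a) := by
      rw [gridSum]
      simp only [next, List.headD, decSlope, havg, extendZero_coe]
      field_simp
      ring
    have hj := mul_nonneg (hφ a) (sub_nonneg.2 (leftVal_le hY a))
    rw [hsum]
    refine ⟨add_nonneg hj ih1, ?_⟩
    have hset : cell ((a : ℝ), (b : ℝ)) =ᵐ[jumpMeasure Y] ({a} : Set Quantile) := by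
      filter_upwards [ae_mem_cut hC hstep] with s hs
      refine propext ⟨fun h => Subtype.ext ?_, ?_⟩
      · exact le_antisymm ((hgap s hs).resolve_right (not_le.2 h.2)) h.1
      · rintro rfl
        exact ⟨le_rfl, hab⟩
    rw [← cell_union hab.le hb1.le, lintegral_union (measurableSet_cell _) (cell_disjoint _ _ _),
      ih2, setLIntegral_congr hset, lintegral_singleton, jumpMeasure_singleton hY,
      ← ENNReal.ofReal_mul (hφ a), ← ENNReal.ofReal_add hj ih1]

/-- The cut points of a finite grid. -/
def gridSet (l : List ℝ) : Set ℝ := {x | x ∈ (0 : ℝ) :: l ∨ x = 1}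

lemma isCut_gridSet {l : List ℝ} (hl : ∀ x ∈ l, 0 ≤ x ∧ x < 1) : IsCut (gridSet l) := by
  have hfin : (gridSet l).Finite :=
    ((List.finite_toSet ((0 : ℝ) :: l)).union (finite_singleton 1)).subset fun x hx => hx
  refine ⟨hfin.isClosed, ?_, Or.inl (by simp), Or.inr rfl⟩
  rintro x (hx | rfl)
  · rcases List.mem_cons.1 hx with rfl | hx
    · exact ⟨le_rfl, zero_le_one⟩
    · exact ⟨(hl x hx).1, (hl x hx).2.le⟩
  · exact ⟨zero_le_one, le_rfl⟩

lemma sub_mul_leftVal_nonneg (hX : IsQuantileFunction X) (s : Quantile) :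
    0 ≤ tailInt X s - (1 - s) * leftVal X s := by
  have := one_sub_mul_le_tailInt hX s
  have := mul_le_mul_of_nonneg_left (leftVal_le hX s) (sub_nonneg.2 s.2.2.le)
  linarith

/-- Revenue of a `W` that is constant on the intervals of a finite grid. -/
lemma revenue_of_stepOn_gridSet (hW : IsQuantileFunction W) (hX : IsQuantileFunction X)
    {l : List ℝ} (hp : ((0 : ℝ) :: l).Pairwise (· < ·)) (hl : ∀ x ∈ l, 0 ≤ x ∧ x < 1)
    (hstep : StepOn (gridSet l) W) :
    revenue W X = ENNReal.ofReal (gridSum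
      (extendZero fun s => tailInt X s - (1 - s) * leftVal X s) (tailInt W) ((0 : ℝ) :: l)) := by
  have := (lintegral_jumpMeasure_grid hW (isCut_gridSet hl) hstep
    (fun s => tailInt X s - (1 - s) * leftVal X s) (sub_mul_leftVal_nonneg hX) l 0 hp
    (fun x hx => ⟨Or.inl hx, ?_⟩) fun c hc _ => hc).2
  · rw [leftVal_zero W, mul_zero, sub_zero, coe_zero, cell_zero_one, setLIntegral_univ] at this
    rw [revenue_eq_lintegral_jump hW hX, this]
  · rcases List.mem_cons.1 hx with rfl | hx
    · exact zero_lt_one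
    · exact (hl x hx).2

/-- Revenue of `Q` pooled on a finite grid whose least interval is excluded. -/
lemma ofReal_gridSum_le_revenue (hW : IsQuantileFunction W) (hQ : IsQuantileFunction Q)
    {b : Quantile} {l : List ℝ} (hp : ((b : ℝ) :: l).Pairwise (· < ·))
    (hl : ∀ x ∈ (b : ℝ) :: l, 0 ≤ x ∧ x < 1) :
    ENNReal.ofReal (gridSum (extendZero fun t => (1 - t) * W t) (tailInt Q) ((b : ℝ) :: l))
      ≤ revenue W (pool (isQuantileFunction_cut hQ b) (isCut_gridSet hl)) := by
  set C := gridSet ((b : ℝ) :: l)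
  have hC : IsCut C := isCut_gridSet hl
  have hb : (b : ℝ) ∈ C := Or.inl (by simp)
  set Y := pool (isQuantileFunction_cut hQ b) hC
  have hY : IsQuantileFunction Y := isQuantileFunction_pool _ hC
  have hW0 : ∀ t : Quantile, 0 ≤ (1 - (t : ℝ)) * W t := fun t =>
    mul_nonneg (sub_nonneg.2 t.2.2.le) (hW.nonneg t)
  have hlow : leftVal Y b = 0 := by
    rcases eq_or_ne b 0 with h | h
    · rw [h, leftVal_zero]
    · have := nhdsLT_neBot h
      rw [leftVal_of_ne Y h]
      refine tendsto_nhds_unique (Y.mono.tendsto_leftLim b) (tendsto_const_nhds.congr' ?_)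
      filter_upwards [self_mem_nhdsWithin] with s hs
      have : ¬ (b : ℝ) ≤ s := not_le.2 hs
      rw [pool_apply, poolFun_cut hQ hC hb, if_neg this]
  have := (lintegral_jumpMeasure_grid hY hC (stepOn_poolFun hC)
    (fun t => (1 - t) * W t) hW0 l b hp
    (fun x hx => ⟨Or.inl (List.mem_cons_of_mem _ hx), (hl x hx).2⟩) fun c hc hbc => by
      rcases hc with hc | hc
      · rcases List.mem_cons.1 hc with rfl | hc
        · refine Or.inl (List.mem_cons.2 (Or.inl (le_antisymm b.2.1 hbc)))
        · exact Or.inl hc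
      · exact Or.inr hc).2
  rw [hlow, mul_zero, sub_zero] at this
  rw [revenue_eq_lintegral W Y hW, gridSum_congr (K := tailInt Y), ← this]
  · exact setLIntegral_le_lintegral _ _
  · intro x hx
    rw [tailInt_pool_of_mem _ hC (Or.inl (List.mem_cons_of_mem _ hx)), tailInt_cut_of_le]
    rcases List.mem_cons.1 hx with rfl | hx
    · exact le_rfl
    · exact ((List.pairwise_cons.1 hp).1 x hx).le
  · rw [tailInt_one, tailInt_one]

end

section

/-! ### Pooling along a common partition loses no revenue -/

variable {f V Q W X : StieltjesFunction Quantile}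

/-- Revenue of an `X` that is constant on the intervals of a finite grid. -/
lemma revenue_of_stepOn_gridSet_right (hW : IsQuantileFunction W) (hX : IsQuantileFunction X)
    {l : List ℝ} (hp : ((0 : ℝ) :: l).Pairwise (· < ·)) (hl : ∀ x ∈ l, 0 ≤ x ∧ x < 1)
    (hstep : StepOn (gridSet l) X) :
    revenue W X = ENNReal.ofReal (gridSum
      (extendZero fun t => (1 - t) * W t) (tailInt X) ((0 : ℝ) :: l)) := by
  have := (lintegral_jumpMeasure_grid hX (isCut_gridSet hl) hstep
    (fun t => (1 - t) * W t) (fun t => mul_nonneg (sub_nonneg.2 t.2.2.le) (hW.nonneg t)) l 0 hp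
    (fun x hx => ⟨Or.inl hx, ?_⟩) fun c hc _ => hc).2
  · rw [leftVal_zero X, mul_zero, sub_zero, coe_zero, cell_zero_one, setLIntegral_univ] at this
    rw [revenue_eq_lintegral W X hW, this]
  · rcases List.mem_cons.1 hx with rfl | hx
    · exact zero_lt_one
    · exact (hl x hx).2

lemma decSlope_tailInt_mono (hf : IsQuantileFunction f) (a b c : ℝ) (ha : 0 ≤ a) (hab : a < b)
    (hbc : b < c) (hc : c ≤ 1) : decSlope (tailInt f) a b ≤ decSlope (tailInt f) b c :=
  avg_le_avg hf ha hab hbc hc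

/-- If `W` is pooled on a finite grid, some common partition does as well as `(W, X)`: iron `W`,
then pool `X` on the intervals of the ironed `W`, then iron `X`, then pool `W` once more. -/
lemma revenue_pool_gridSet_le (hV : IsQuantileFunction V) (hQ : IsQuantileFunction Q) {S : ℝ≥0∞}
    (hS : ∀ (C : Set ℝ) (hC : IsCut C) (b : ℝ), b ∈ C → (∀ c ∈ C, c ≤ 0 ∨ b ≤ c) →
      revenue (pool hV hC) (pool (isQuantileFunction_cut hQ b) hC) ≤ S)
    (hW : W ∈ feasibleValues V) (hX : X ∈ feasibleAllocations Q)
    {l : List ℝ} (hp : ((0 : ℝ) :: l).Pairwise (· < ·)) (hl : ∀ x ∈ l, 0 ≤ x ∧ x < 1) :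
    revenue (pool hW.1 (isCut_gridSet hl)) X ≤ S := by
  have h01 : ∀ {l : List ℝ}, (∀ x ∈ l, 0 ≤ x ∧ x < 1) → ∀ x ∈ (0 : ℝ) :: l, 0 ≤ x ∧ x < 1 := by
    intro l hl x hx
    rcases List.mem_cons.1 hx with rfl | hx
    · exact ⟨le_rfl, zero_lt_one⟩
    · exact hl x hx
  have hpool : ∀ {f : StieltjesFunction Quantile} (hf : IsQuantileFunction f) {l : List ℝ}
      (hl : ∀ x ∈ l, 0 ≤ x ∧ x < 1) (m : ℝ → ℝ),
      gridSum m (tailInt (pool hf (isCut_gridSet hl))) ((0 : ℝ) :: l)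
        = gridSum m (tailInt f) ((0 : ℝ) :: l) := fun hf l hl m =>
    gridSum_congr (fun x hx => tailInt_pool_of_mem hf _ (Or.inl hx))
      (tailInt_pool_of_mem hf _ (Or.inr rfl))
  obtain ⟨l₁, hs₁, hle₁⟩ := exists_grid_of_majorized
    (m := extendZero fun s => tailInt X s - (1 - s) * leftVal X s) (K := tailInt V)
    (decSlope_tailInt_mono hW.1) (tailInt_one W) (tailInt_one V) l hp (h01 hl)
    (fun x hx => tailInt_le_of_weaklyMajorizedBy hW.2.1 (Ico_subset_Icc_self (h01 hl x hx)))
    (tailInt_zero_of_mem_feasibleValues hW)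
  have hp₁ := hp.sublist hs₁
  have hl₁ : ∀ x ∈ l₁, 0 ≤ x ∧ x < 1 := fun x hx =>
    h01 hl x (hs₁.subset (List.mem_cons_of_mem _ hx))
  have hC₁ : IsCut (gridSet l₁) := isCut_gridSet hl₁
  set W₁ := pool hV hC₁
  have hqW₁ : IsQuantileFunction W₁ := isQuantileFunction_pool hV hC₁
  have hr₁ : revenue (pool hW.1 (isCut_gridSet hl)) X ≤ revenue W₁ X := by
    rw [revenue_of_stepOn_gridSet (isQuantileFunction_pool hW.1 _) hX.1 hp hl
      (stepOn_poolFun (isCut_gridSet hl)), revenue_of_stepOn_gridSet hqW₁ hX.1 hp₁ hl₁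
      (stepOn_poolFun hC₁), hpool hW.1 hl, hpool hV hl₁]
    exact ENNReal.ofReal_le_ofReal hle₁
  refine hr₁.trans ((revenue_le_pool_right hqW₁ hX.1 hC₁ (stepOn_poolFun hC₁)).trans ?_)
  rw [revenue_of_stepOn_gridSet_right hqW₁ (isQuantileFunction_pool hX.1 hC₁) hp₁ hl₁
    (stepOn_poolFun hC₁), hpool hX.1 hl₁]
  obtain ⟨l₂, hs₂, hle₂⟩ := exists_grid_of_weaklyMajorized
    (m := extendZero fun t => (1 - t) * W₁ t) (K := tailInt Q)
    (decSlope_tailInt_mono hX.1) (tailInt_one X) (tailInt_one Q)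
    (fun a b hab hb => tailInt_antitone hX.1 hab.le hb) _ hp₁ (h01 hl₁)
    (fun x hx => tailInt_le_of_weaklyMajorizedBy hX.2 (Ico_subset_Icc_self (h01 hl₁ x hx)))
  refine (ENNReal.ofReal_le_ofReal hle₂).trans ?_
  have hl₂ : ∀ x ∈ l₂, 0 ≤ x ∧ x < 1 := fun x hx => h01 hl₁ x (hs₂.subset hx)
  have hp₂ := hp₁.sublist hs₂
  cases l₂ with
  | nil => simp [gridSum]
  | cons b l₂ =>
    have hb := hl₂ b (by simp)
    lift b to Quantile using hb
    have hC₂ := isCut_gridSet hl₂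
    refine (ofReal_gridSum_le_revenue hqW₁ hQ hp₂ hl₂).trans
      ((revenue_le_pool_left hqW₁ hC₂ (stepOn_poolFun hC₂)).trans ?_)
    have hsub : gridSet ((b : ℝ) :: l₂) ⊆ gridSet l₁ := by
      rintro x (hx | rfl)
      · rcases List.mem_cons.1 hx with rfl | hx
        · exact hC₁.zero_mem
        · exact Or.inl (hs₂.subset hx)
      · exact hC₁.one_mem
    have hpp : pool hqW₁ hC₂ = pool hV hC₂ := pool_pool hV hC₁ hC₂ hsub
    rw [hpp]
    refine hS _ hC₂ b (Or.inl (by simp)) fun c hc => ?_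
    rcases hc with hc | rfl
    · rcases List.mem_cons.1 hc with rfl | hc
      · exact Or.inl le_rfl
      · rcases List.mem_cons.1 hc with rfl | hc
        · exact Or.inr le_rfl
        · exact Or.inr ((List.pairwise_cons.1 hp₂).1 c hc).le
    · exact Or.inr b.2.2.le

/-- Revenue from finer and finer pooled versions of `W` is in the limit at least that from `W`.
Hence a revenue bound for common partitions is a bound for all feasible pairs. -/
theorem revenue_le_of_forall_pool (hV : IsQuantileFunction V) (hQ : IsQuantileFunction Q)
    {S : ℝ≥0∞}
    (hS : ∀ (C : Set ℝ) (hC : IsCut C) (b : ℝ), b ∈ C → (∀ c ∈ C, c ≤ 0 ∨ b ≤ c) →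
      revenue (pool hV hC) (pool (isQuantileFunction_cut hQ b) hC) ≤ S)
    (hW : W ∈ feasibleValues V) (hX : X ∈ feasibleAllocations Q) : revenue W X ≤ S := by
  obtain ⟨D₀, hD₀c, hD₀d⟩ := TopologicalSpace.exists_countable_dense Quantile
  -- the grid points run through a dense set that contains all jumps of `W`
  have hDc : (D₀ ∪ {t | ¬ ContinuousAt W t}).Countable :=
    hD₀c.union W.mono.countable_not_continuousAt
  obtain ⟨e, he⟩ := hDc.exists_eq_range (hD₀d.nonempty.mono subset_union_left)
  let F : ℕ → Finset ℝ := fun n =>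
    ((Finset.range n).image fun k => (e k : ℝ)).filter (0 < ·)
  let l : ℕ → List ℝ := fun n => (F n).sort (· ≤ ·)
  have hmem : ∀ n x, x ∈ l n ↔ (∃ k < n, (e k : ℝ) = x) ∧ 0 < x := fun n x => by
    simp [l, F, Finset.mem_sort]
  have hl : ∀ n, ∀ x ∈ l n, 0 ≤ x ∧ x < 1 := fun n x hx => by
    obtain ⟨⟨k, -, rfl⟩, h0⟩ := (hmem n x).1 hx
    exact ⟨h0.le, (e k).2.2⟩
  have hp : ∀ n, ((0 : ℝ) :: l n).Pairwise (· < ·) := fun n =>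
    List.pairwise_cons.2 ⟨fun x hx => ((hmem n x).1 hx).2, (F n).sortedLT_sort.pairwise⟩
  have hC : ∀ n, IsCut (gridSet (l n)) := fun n => isCut_gridSet (hl n)
  have he_mem : ∀ n k, k < n → (e k : ℝ) ∈ gridSet (l n) := fun n k hk => by
    refine Or.inl (List.mem_cons.2 ?_)
    rcases (e k).2.1.eq_or_lt with h | h
    · exact Or.inl h.symm
    · exact Or.inr ((hmem n _).2 ⟨⟨k, hk, rfl⟩, h⟩)
  have hbound : ∀ n, ∫⁻ t : Quantile, ENNReal.ofReal ((1 - (t : ℝ)) * pool hW.1 (hC n) t)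
      ∂jumpMeasure X ≤ S := fun n => by
    rw [← revenue_eq_lintegral _ X (isQuantileFunction_pool hW.1 (hC n))]
    exact revenue_pool_gridSet_le hV hQ hS hW hX (hp n) (hl n)
  -- pooling on the grids does not lower `W` in the limit
  have hlim : ∀ t : Quantile, ∀ a < W t, ∀ᶠ n in atTop, a ≤ pool hW.1 (hC n) t := by
    intro t a ha
    obtain ⟨s, hst, hs, has⟩ : ∃ s ≤ t, (s = 0 ∨ s ∈ range e) ∧ a ≤ W s := by
      by_cases ht0 : t = 0
      · exact ⟨t, le_rfl, Or.inl ht0, ha.le⟩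
      by_cases hc : ContinuousAt W t
      · have hev := hc.eventually_const_lt ha
        obtain ⟨u, hut, hu⟩ := exists_Ioc_subset_of_mem_nhds hev
          ⟨0, lt_of_le_of_ne (zero_le t) (Ne.symm ht0)⟩
        obtain ⟨s, hsD, hs⟩ := hD₀d.exists_between hut
        exact ⟨s, hs.2.le, Or.inr (he ▸ Or.inl hsD), (hu ⟨hs.1, hs.2.le⟩).le⟩
      · exact ⟨t, le_rfl, Or.inr (he ▸ Or.inr hc), ha.le⟩
    rcases hs with rfl | ⟨k, rfl⟩
    · exact Eventually.of_forall fun n => has.trans (le_poolFun hW.1 (hC n) hst (hC n).zero_mem)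
    · filter_upwards [eventually_gt_atTop k] with n hn
      exact has.trans (le_poolFun hW.1 (hC n) hst (he_mem n k hn))
  rw [revenue_eq_lintegral W X hW.1]
  calc ∫⁻ t : Quantile, ENNReal.ofReal ((1 - (t : ℝ)) * W t) ∂jumpMeasure X
      ≤ ∫⁻ t : Quantile, liminf (fun n => ENNReal.ofReal ((1 - (t : ℝ)) * pool hW.1 (hC n) t)) atTop
        ∂jumpMeasure X := by
        refine lintegral_mono fun t => ?_
        have hcont : Tendsto (fun a : ℝ => ENNReal.ofReal ((1 - (t : ℝ)) * a)) (𝓝[<] (W t))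
            (𝓝 (ENNReal.ofReal ((1 - (t : ℝ)) * W t))) :=
          ((ENNReal.continuous_ofReal.comp
            (continuous_const.mul continuous_id)).tendsto _).mono_left nhdsWithin_le_nhds
        refine le_of_tendsto hcont ?_
        filter_upwards [self_mem_nhdsWithin] with a ha
        refine le_liminf_of_le (by isBoundedDefault) ?_
        filter_upwards [hlim t a ha] with n hn
        exact ENNReal.ofReal_le_ofReal (mul_le_mul_of_nonneg_left hn (sub_nonneg.2 t.2.2.le))
    _ ≤ liminf (fun n => ∫⁻ t : Quantile, ENNReal.ofReal ((1 - (t : ℝ)) * pool hW.1 (hC n) t)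
        ∂jumpMeasure X) atTop := lintegral_liminf_le fun n => measurable_payoff _
    _ ≤ S := by
        refine (liminf_le_liminf (Eventually.of_forall hbound)).trans ?_
        rw [liminf_const]

end

section

/-! ### Upper semicontinuity of revenue -/

variable {W X : StieltjesFunction Quantile}

/-- An upper Riemann-Stieltjes sum for the revenue from the quantiles `≤ s N`. -/
noncomputable def upperSum (W X : Quantile → ℝ) (s : ℕ → Quantile) (N : ℕ) : ℝ≥0∞ :=
  ENNReal.ofReal (W (s 0) * X (s 0)) + ∑ j ∈ Finset.range N,
    ENNReal.ofReal ((1 - (s j : ℝ)) * W (s (j + 1))) * ENNReal.ofReal (X (s (j + 1)) - X (s j))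

lemma Iic_eq_Icc (t : Quantile) : Iic t = Icc 0 t := by
  ext u
  exact ⟨fun h => ⟨zero_le u, h⟩, fun h => h.2⟩

lemma lintegral_le_upperSum (hW : IsQuantileFunction W) (hX : IsQuantileFunction X)
    {s : ℕ → Quantile} {N : ℕ} (hs : ∀ j < N, s j ≤ s (j + 1)) :
    ∫⁻ t in Iic (s N), ENNReal.ofReal ((1 - (t : ℝ)) * W t) ∂jumpMeasure X ≤ upperSum W X s N := by
  induction N with
  | zero =>
    have : ∫⁻ t in Iic (s 0), ENNReal.ofReal ((1 - (t : ℝ)) * W t) ∂jumpMeasure X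
        ≤ ∫⁻ _ in Iic (s 0), ENNReal.ofReal (W (s 0)) ∂jumpMeasure X := by
      refine setLIntegral_mono measurable_const fun t ht => ENNReal.ofReal_le_ofReal ?_
      have h1 := W.mono ht
      have h2 := hW.nonneg t
      nlinarith [t.2.1]
    refine this.trans ?_
    rw [setLIntegral_const, Iic_eq_Icc, jumpMeasure_Icc_zero hX, upperSum,
      ENNReal.ofReal_mul (hW.nonneg _)]
    simp
  | succ N ih =>
    have hu : Iic (s (N + 1)) = Iic (s N) ∪ Ioc (s N) (s (N + 1)) :=
      (Iic_union_Ioc_eq_Iic (hs N N.lt_succ_self)).symm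
    rw [hu]
    refine (lintegral_union_le _ _ _).trans ?_
    rw [upperSum, Finset.sum_range_succ, ← add_assoc]
    refine add_le_add (ih fun j hj => hs j (hj.trans N.lt_succ_self)) ?_
    rw [← jumpMeasure_Ioc, ← setLIntegral_const]
    refine setLIntegral_mono measurable_const fun t ht => ENNReal.ofReal_le_ofReal ?_
    have h1 : (s N : ℝ) < t := ht.1
    exact mul_le_mul (by linarith) (W.mono ht.2) (hW.nonneg t) (sub_nonneg.2 (s N).2.2.le)

lemma upperSum_le_lintegral (hW : IsQuantileFunction W) (hX : IsQuantileFunction X)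
    {s : ℕ → Quantile} {N : ℕ} (hs : ∀ j < N, s j ≤ s (j + 1)) {φ : Quantile → ℝ≥0∞}
    (h0 : ∀ t ≤ s 0, ENNReal.ofReal (W (s 0)) ≤ φ t)
    (hφ : ∀ j < N, ∀ t ∈ Ioc (s j) (s (j + 1)),
      ENNReal.ofReal ((1 - (s j : ℝ)) * W (s (j + 1))) ≤ φ t) :
    upperSum W X s N ≤ ∫⁻ t in Iic (s N), φ t ∂jumpMeasure X := by
  induction N with
  | zero =>
    have : upperSum W X s 0 = ∫⁻ _ in Iic (s 0), ENNReal.ofReal (W (s 0)) ∂jumpMeasure X := by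
      rw [setLIntegral_const, Iic_eq_Icc, jumpMeasure_Icc_zero hX, upperSum,
        ENNReal.ofReal_mul (hW.nonneg _)]
      simp
    rw [this]
    exact setLIntegral_mono' measurableSet_Iic fun t ht => h0 t ht
  | succ N ih =>
    have hu : Iic (s (N + 1)) = Iic (s N) ∪ Ioc (s N) (s (N + 1)) :=
      (Iic_union_Ioc_eq_Iic (hs N N.lt_succ_self)).symm
    have hd : Disjoint (Iic (s N)) (Ioc (s N) (s (N + 1))) :=
      Set.disjoint_left.2 fun t ht ht' => absurd ht'.1 (not_lt.2 ht)
    rw [hu, lintegral_union measurableSet_Ioc hd, upperSum, Finset.sum_range_succ, ← add_assoc]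
    refine add_le_add (ih (fun j hj => hs j (hj.trans N.lt_succ_self))
      fun j hj => hφ j (hj.trans N.lt_succ_self)) ?_
    rw [← jumpMeasure_Ioc, ← setLIntegral_const]
    exact setLIntegral_mono' measurableSet_Ioc fun t ht => hφ N N.lt_succ_self t ht

lemma tendsto_upperSum {ι : Type*} {l : Filter ι} {Wn Xn : ι → Quantile → ℝ} {W X : Quantile → ℝ}
    {s : ℕ → Quantile} {N : ℕ} (hW : ∀ j ≤ N, Tendsto (fun n => Wn n (s j)) l (𝓝 (W (s j))))
    (hX : ∀ j ≤ N, Tendsto (fun n => Xn n (s j)) l (𝓝 (X (s j)))) :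
    Tendsto (fun n => upperSum (Wn n) (Xn n) s N) l (𝓝 (upperSum W X s N)) := by
  refine (ENNReal.tendsto_ofReal ((hW 0 N.zero_le).mul (hX 0 N.zero_le))).add
    (tendsto_finsetSum _ fun j hj => ?_)
  have hj' : j + 1 ≤ N := Finset.mem_range.1 hj
  exact ENNReal.Tendsto.mul (ENNReal.tendsto_ofReal ((hW _ hj').const_mul _))
    (Or.inr ENNReal.ofReal_ne_top)
    (ENNReal.tendsto_ofReal ((hX _ hj').sub (hX _ (j.le_succ.trans hj'))))
    (Or.inr ENNReal.ofReal_ne_top)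

/-- The quantile `t + h`, capped at `c`. -/
noncomputable def shift (h : ℝ) (hh : 0 ≤ h) (c t : Quantile) : Quantile :=
  ⟨min (t + h) c, le_min (add_nonneg t.2.1 hh) c.2.1, (min_le_right _ _).trans_lt c.2.2⟩

lemma shift_le (h : ℝ) (hh : 0 ≤ h) (c t : Quantile) : shift h hh c t ≤ c :=
  Subtype.coe_le_coe.1 (min_le_right _ _)

lemma le_shift {h : ℝ} (hh : 0 ≤ h) {c t s : Quantile} (hs : (s : ℝ) ≤ t + h) (hc : s ≤ c) :
    s ≤ shift h hh c t :=
  Subtype.coe_le_coe.1 (le_min hs hc)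

/-- If `Wn → W` and `Xn → X` on a dense set of quantiles, with revenue from the high quantiles
uniformly small, then revenue in the limit is at least the limit of the revenues. -/
theorem le_revenue_of_tendsto {l : Filter ℕ} [l.NeBot] {Wn Xn : ℕ → StieltjesFunction Quantile}
    (hWn : ∀ n, IsQuantileFunction (Wn n)) (hXn : ∀ n, IsQuantileFunction (Xn n))
    (hW : IsQuantileFunction W) (hX : IsQuantileFunction X) {G : Set Quantile}
    (hG : ∀ p q : Quantile, p < q → ∃ t ∈ G, p < t ∧ t < q)
    (hWG : ∀ t ∈ G, Tendsto (fun n => Wn n t) l (𝓝 (W t)))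
    (hXG : ∀ t ∈ G, Tendsto (fun n => Xn n t) l (𝓝 (X t)))
    {T : Quantile → ℝ≥0∞} (hTa : Antitone T) (hT : ∀ ε : ℝ≥0∞, ε ≠ 0 → ∃ c, T c ≤ ε)
    (hTn : ∀ n c, ∫⁻ t in Ici c, ENNReal.ofReal ((1 - (t : ℝ)) * Wn n t) ∂jumpMeasure (Xn n) ≤ T c)
    {S : ℝ≥0∞} (hS : Tendsto (fun n => revenue (Wn n) (Xn n)) l (𝓝 S)) :
    S ≤ revenue W X := by
  refine ENNReal.le_of_forall_pos_le_add fun ε hε _ => ?_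
  obtain ⟨c, hc⟩ := hT ε (by exact_mod_cast hε.ne')
  obtain ⟨c₁, hc₁⟩ := exists_between c.2.2
  let c' : Quantile := ⟨c₁, c.2.1.trans hc₁.1.le, hc₁.2⟩
  have hcc' : (c : ℝ) < c' := hc₁.1
  let h : ℕ → ℝ := fun k => 1 / ((k : ℝ) + 1)
  have hpos : ∀ k, 0 < h k := fun k => Nat.one_div_pos_of_nat
  have hh : Tendsto h atTop (𝓝 0) := tendsto_one_div_add_atTop_nhds_zero_nat
  have h2h : ∀ k, 0 ≤ 2 * h k := fun k => by have := hpos k; linarith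
  let φ : ℕ → Quantile → ℝ≥0∞ := fun k t =>
    ENNReal.ofReal ((1 - (t : ℝ) + 2 * h k) * W (shift (2 * h k) (h2h k) c' t))
  -- upper sums with good grid points and mesh `≤ 2 h` bound the limit of the revenues
  have hbound : ∀ᶠ k in atTop, S ≤ (∫⁻ t in Iic c', φ k t ∂jumpMeasure X) + T c := by
    have hev : ∀ᶠ k in atTop, 2 * h k < c' - c := by
      have : Tendsto (fun k => 2 * h k) atTop (𝓝 (2 * 0)) := hh.const_mul 2
      rw [mul_zero] at this
      exact this.eventually_lt_const (sub_pos.2 hcc')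
    filter_upwards [hev] with k hk
    have hex : ∀ j : ℕ, ∃ s : Quantile, (j + 1) * h k ≤ 1 →
        s ∈ G ∧ j * h k < (s : ℝ) ∧ (s : ℝ) < (j + 1) * h k := by
      intro j
      by_cases hj : ((j : ℝ) + 1) * h k ≤ 1
      · have hj0 : 0 ≤ (j : ℝ) * h k := mul_nonneg j.cast_nonneg (hpos k).le
        have hlt : (j : ℝ) * h k < (j + 1) * h k := by linarith [hpos k]
        let p : Quantile := ⟨j * h k, hj0, by linarith⟩
        rcases lt_or_eq_of_le hj with hj1 | hj1
        · obtain ⟨t, htG, ht1, ht2⟩ := hG p ⟨(j + 1) * h k, hj0.trans hlt.le, hj1⟩ hlt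
          exact ⟨t, fun _ => ⟨htG, ht1, ht2⟩⟩
        · obtain ⟨x, hx⟩ := exists_between p.2.2
          obtain ⟨t, htG, ht1, -⟩ := hG p ⟨x, p.2.1.trans hx.1.le, hx.2⟩ hx.1
          exact ⟨t, fun _ => ⟨htG, ht1, by rw [hj1]; exact t.2.2⟩⟩
      · exact ⟨0, fun h' => absurd h' hj⟩
    choose s hs using hex
    let N := ⌈(c : ℝ) / h k⌉₊
    have hN1 : (c : ℝ) ≤ N * h k := (div_le_iff₀ (hpos k)).1 (Nat.le_ceil _)
    have hN2 : N * h k < c + h k := by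
      have := Nat.ceil_lt_add_one (div_nonneg c.2.1 (hpos k).le)
      have h3 := mul_lt_mul_of_pos_right this (hpos k)
      rwa [add_mul, div_mul_cancel₀ _ (hpos k).ne', one_mul] at h3
    have hj1 : ∀ j ≤ N, ((j : ℝ) + 1) * h k ≤ 1 := fun j hj => by
      have h4 : (j : ℝ) * h k ≤ N * h k :=
        mul_le_mul_of_nonneg_right (by exact_mod_cast hj) (hpos k).le
      have := c'.2.2
      rw [add_mul, one_mul]
      linarith
    have hs' : ∀ j ≤ N, s j ∈ G ∧ j * h k < (s j : ℝ) ∧ (s j : ℝ) < (j + 1) * h k := fun j hj =>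
      hs j (hj1 j hj)
    have hsm : ∀ j < N, s j ≤ s (j + 1) := fun j hj => by
      have h1 := (hs' j hj.le).2.2
      have h2 := (hs' (j + 1) hj).2.1
      push_cast at h2
      exact (h1.trans h2).le
    have hsN : c ≤ s N := hN1.trans (hs' N le_rfl).2.1.le
    have hsN' : ∀ j ≤ N, s j ≤ c' := fun j hj => by
      have h4 : (j : ℝ) * h k ≤ N * h k :=
        mul_le_mul_of_nonneg_right (by exact_mod_cast hj) (hpos k).le
      have := (hs' j hj).2.2
      rw [add_mul, one_mul] at this
      exact (show (s j : ℝ) ≤ c' by linarith)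
    have hR : ∀ n, revenue (Wn n) (Xn n) ≤ upperSum (Wn n) (Xn n) s N + T c := fun n => by
      rw [revenue_eq_lintegral _ _ (hWn n), ← setLIntegral_univ, ← Iic_union_Ici (a := s N)]
      refine (lintegral_union_le _ _ _).trans (add_le_add ?_ ((hTn n _).trans (hTa hsN)))
      exact lintegral_le_upperSum (hWn n) (hXn n) hsm
    have hlim : Tendsto (fun n => upperSum (Wn n) (Xn n) s N + T c) l
        (𝓝 (upperSum W X s N + T c)) :=
      (tendsto_upperSum (fun j hj => hWG _ (hs' j hj).1) fun j hj => hXG _ (hs' j hj).1).add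
        tendsto_const_nhds
    refine (le_of_tendsto_of_tendsto' hS hlim hR).trans (add_le_add ?_ le_rfl)
    refine (upperSum_le_lintegral hW hX hsm (φ := φ k) ?_ ?_).trans
      (lintegral_mono_set (Iic_subset_Iic.2 (hsN' N le_rfl)))
    · intro t ht
      have h0 := (hs' 0 N.zero_le).2.2
      rw [Nat.cast_zero, zero_add, one_mul] at h0
      have h1 : s 0 ≤ shift (2 * h k) (h2h k) c' t :=
        le_shift _ (by linarith [t.2.1, hpos k]) (hsN' 0 N.zero_le)
      have h2 : (t : ℝ) ≤ s 0 := ht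
      refine ENNReal.ofReal_le_ofReal ((W.mono h1).trans ?_)
      have h3 := hW.nonneg (shift (2 * h k) (h2h k) c' t)
      nlinarith [hpos k]
    · intro j hj t ht
      have h1 := (hs' j hj.le).2
      have h2 := (hs' (j + 1) hj).2
      push_cast at h2
      have h3 : (s j : ℝ) < t := ht.1
      have h4 : (t : ℝ) ≤ s (j + 1) := ht.2
      have h5 : s (j + 1) ≤ shift (2 * h k) (h2h k) c' t :=
        le_shift _ (by linarith [h2.2, h1.1]) (hsN' _ hj)
      refine ENNReal.ofReal_le_ofReal (mul_le_mul (by linarith [h2.2, h1.1]) (W.mono h5)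
        (hW.nonneg _) ?_)
      linarith [t.2.2, hpos k]
  -- as the mesh shrinks, the upper sums decrease to the revenue by right-continuity of `W`
  have hconv : Tendsto (fun k => ∫⁻ t in Iic c', φ k t ∂jumpMeasure X) atTop
      (𝓝 (∫⁻ t in Iic c', ENNReal.ofReal ((1 - (t : ℝ)) * W t) ∂jumpMeasure X)) := by
    have hshift : ∀ k, Monotone (shift (2 * h k) (h2h k) c') := fun k t u htu =>
      min_le_min_right _ (add_le_add_left (show (t : ℝ) ≤ u from htu) _)
    refine tendsto_lintegral_of_dominated_convergence (fun _ => ENNReal.ofReal (3 * W c'))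
      (fun k => ?_) (fun k => ?_) ?_ ?_
    · exact (((measurable_const.sub measurable_subtype_coe).add_const _).mul
        (W.mono.comp (hshift k)).measurable).ennreal_ofReal
    · refine Eventually.of_forall fun t => ENNReal.ofReal_le_ofReal ?_
      have h1 : h k ≤ 1 := by
        have : (0 : ℝ) ≤ k := k.cast_nonneg
        exact (div_le_one (by linarith)).2 (by linarith)
      exact mul_le_mul (by linarith [t.2.1]) (W.mono (shift_le _ _ _ _)) (hW.nonneg _) (by norm_num)
    · rw [setLIntegral_const, Iic_eq_Icc, jumpMeasure_Icc_zero hX]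
      exact ENNReal.mul_ne_top ENNReal.ofReal_ne_top ENNReal.ofReal_ne_top
    · filter_upwards [ae_restrict_mem measurableSet_Iic] with t ht
      have ht' : (t : ℝ) ≤ c' := ht
      have h2 : Tendsto (fun k => 2 * h k) atTop (𝓝 0) := by simpa using hh.const_mul 2
      have h3 : Tendsto (fun k => shift (2 * h k) (h2h k) c' t) atTop (𝓝[≥] t) := by
        refine tendsto_nhdsWithin_iff.2 ⟨tendsto_subtype_rng.2 ?_, Eventually.of_forall fun k =>
          le_min (by linarith [hpos k]) ht'⟩
        have h4 : Tendsto (fun k => min ((t : ℝ) + 2 * h k) c') atTop (𝓝 (min ((t : ℝ) + 0) c')) :=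
          (tendsto_const_nhds.add h2).min tendsto_const_nhds
        rwa [add_zero, min_eq_left ht'] at h4
      have h5 : Tendsto (fun k => W (shift (2 * h k) (h2h k) c' t)) atTop (𝓝 (W t)) :=
        (W.right_continuous t).tendsto.comp h3
      have h6 := (tendsto_const_nhds (x := 1 - (t : ℝ))).add h2
      rw [add_zero] at h6
      exact ENNReal.tendsto_ofReal (h6.mul h5)
  have hfin := ge_of_tendsto (hconv.add (tendsto_const_nhds (x := T c))) hbound
  refine hfin.trans (add_le_add ?_ hc)
  rw [revenue_eq_lintegral W X hW]
  exact setLIntegral_le_lintegral _ _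

end

section

/-! ### Limits of partitions -/

variable {f V Q : StieltjesFunction Quantile} {D : Set ℝ}

/-- `D` is the limit of the sets `C n` along `l`: its points are approximated by points of `C n`,
and it contains the limits of points of `C n`. -/
structure IsCutLimit (l : Filter ℕ) (C : ℕ → Set ℝ) (D : Set ℝ) : Prop where
  approx : ∀ d ∈ D, ∀ ε > 0, ∀ᶠ n in l, ∃ c ∈ C n, |c - d| < ε
  mem : ∀ c : ℕ → ℝ, (∀ᶠ n in l, c n ∈ C n) → ∀ x, Tendsto c l (𝓝 x) → x ∈ D

/-- Closed sets of cut points converge along every ultrafilter. -/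
lemma exists_isCutLimit (U : Ultrafilter ℕ) {C : ℕ → Set ℝ} (hC : ∀ n, IsCut (C n)) :
    ∃ D, IsCut D ∧ IsCutLimit U C D := by
  let D : Set ℝ := {t | ∀ ε > 0, ∀ᶠ n in (U : Filter ℕ), ∃ c ∈ C n, |c - t| < ε}
  have hmem : ∀ c : ℕ → ℝ, (∀ᶠ n in (U : Filter ℕ), c n ∈ C n) →
      ∀ x, Tendsto c U (𝓝 x) → x ∈ D := by
    intro c hc x hx ε hε
    filter_upwards [hc, Metric.tendsto_nhds.1 hx ε hε] with n h1 h2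
    exact ⟨c n, h1, h2⟩
  refine ⟨D, ⟨?_, ?_, ?_, ?_⟩, fun d hd => hd, hmem⟩
  · refine isClosed_of_closure_subset fun t ht ε hε => ?_
    obtain ⟨d, hd, htd⟩ := Metric.mem_closure_iff.1 ht (ε / 2) (half_pos hε)
    filter_upwards [hd (ε / 2) (half_pos hε)] with n hn
    obtain ⟨c, hc, hcd⟩ := hn
    refine ⟨c, hc, ?_⟩
    rw [Real.dist_eq, abs_sub_comm] at htd
    calc |c - t| ≤ |c - d| + |d - t| := abs_sub_le c d t
      _ < ε := by linarith
  · intro t ht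
    refine isClosed_Icc.closure_subset (Metric.mem_closure_iff.2 fun ε hε => ?_)
    obtain ⟨n, c, hc, hct⟩ := (ht ε hε).exists
    exact ⟨c, (hC n).subset hc, by rwa [dist_comm, Real.dist_eq]⟩
  · exact fun ε hε => Eventually.of_forall fun n => ⟨0, (hC n).zero_mem, by simpa using hε⟩
  · exact fun ε hε => Eventually.of_forall fun n => ⟨1, (hC n).one_mem, by simpa using hε⟩

/-- A compact interval without limit cut points eventually contains no cut points. -/
lemma IsCutLimit.eventually_notMem {U : Ultrafilter ℕ} {C : ℕ → Set ℝ} (hD : IsCutLimit U C D)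
    {p q : ℝ} (h : ∀ d ∈ D, d ∉ Icc p q) :
    ∀ᶠ n in (U : Filter ℕ), ∀ c ∈ C n, c ∉ Icc p q := by
  by_contra hcon
  have hex : ∀ᶠ n in (U : Filter ℕ), ∃ c, c ∈ C n ∧ c ∈ Icc p q := by
    filter_upwards [Ultrafilter.eventually_not.2 hcon] with n hn
    push Not at hn
    exact hn
  obtain ⟨c, hc⟩ : ∃ c : ℕ → ℝ, ∀ᶠ n in (U : Filter ℕ), c n ∈ C n ∧ c n ∈ Icc p q := by
    classical
    refine ⟨fun n => if h : ∃ c, c ∈ C n ∧ c ∈ Icc p q then h.choose else 0, ?_⟩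
    filter_upwards [hex] with n hn
    rw [dif_pos hn]
    exact hn.choose_spec
  obtain ⟨x, hx, hlim⟩ := isCompact_Icc.ultrafilter_le_nhds (U.map c)
    (le_principal_iff.2 (hc.mono fun n hn => hn.2))
  exact h x (hD.mem c (hc.mono fun n hn => hn.1) x hlim) hx

/-- Pooled functions converge at quantiles inside the pooling intervals of the limit. -/
lemma tendsto_pool_of_notMem {U : Ultrafilter ℕ} {C : ℕ → Set ℝ} (hf : IsQuantileFunction f)
    (hC : ∀ n, IsCut (C n)) (hDc : IsCut D) (hD : IsCutLimit U C D) {t : Quantile}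
    (ht : (t : ℝ) ∉ D) :
    Tendsto (fun n => pool hf (hC n) t) U (𝓝 (pool hf hDc t)) := by
  have h1 : lo D t < t := lt_of_le_of_ne (hDc.lo_le t) fun h => ht (h ▸ hDc.lo_mem t)
  have h2 : t < hi D t := lt_of_le_of_ne (hDc.le_hi t) fun h => ht (h ▸ hDc.hi_mem t)
  have hgap : ∀ d ∈ D, d ≤ lo D t ∨ hi D t ≤ d := fun d hd =>
    (le_or_gt d t).imp (hDc.le_lo t hd) (hDc.hi_le t hd)
  have hlo : Tendsto (fun n => lo (C n) t) U (𝓝 (lo D t)) := by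
    refine tendsto_order.2 ⟨fun a ha => ?_, fun a ha => ?_⟩
    · filter_upwards [hD.approx _ (hDc.lo_mem t) (min (lo D t - a) (t - lo D t))
        (lt_min (sub_pos.2 ha) (sub_pos.2 h1))] with n hn
      obtain ⟨c, hc, hcd⟩ := hn
      have h3 := abs_lt.1 (hcd.trans_le (min_le_left _ _))
      have h4 := abs_lt.1 (hcd.trans_le (min_le_right _ _))
      exact lt_of_lt_of_le (by linarith) ((hC n).le_lo t hc (by linarith))
    · filter_upwards [hD.eventually_notMem (p := a) (q := t) fun d hd hd' => by
        rcases hgap d hd with h | h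
        · linarith [hd'.1]
        · linarith [hd'.2]] with n hn
      by_contra! h
      exact hn _ ((hC n).lo_mem t) ⟨h, (hC n).lo_le t⟩
  have hhi : Tendsto (fun n => hi (C n) t) U (𝓝 (hi D t)) := by
    refine tendsto_order.2 ⟨fun a ha => ?_, fun a ha => ?_⟩
    · filter_upwards [hD.eventually_notMem (p := t) (q := a) fun d hd hd' => by
        rcases hgap d hd with h | h
        · linarith [hd'.1]
        · linarith [hd'.2]] with n hn
      by_contra! h
      exact hn _ ((hC n).hi_mem t) ⟨(hC n).le_hi t, h⟩
    · filter_upwards [hD.approx _ (hDc.hi_mem t) (min (a - hi D t) (hi D t - t))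
        (lt_min (sub_pos.2 ha) (sub_pos.2 h2))] with n hn
      obtain ⟨c, hc, hcd⟩ := hn
      have h3 := abs_lt.1 (hcd.trans_le (min_le_left _ _))
      have h4 := abs_lt.1 (hcd.trans_le (min_le_right _ _))
      exact lt_of_le_of_lt ((hC n).hi_le t hc (by linarith)) (by linarith)
  rw [pool_apply, poolFun_of_lt (h1.trans h2)]
  refine (tendsto_avg hf hlo hhi (h1.trans h2)).congr' ?_
  filter_upwards [hhi.eventually_const_lt h2] with n hn
  exact (poolFun_of_lt (((hC n).lo_le t).trans_lt hn)).symm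

/-- Pooled functions converge at continuity points that are interior to the limit of the cut
points. -/
lemma tendsto_pool_of_Ioo_subset {l : Filter ℕ} {C : ℕ → Set ℝ} (hf : IsQuantileFunction f)
    (hC : ∀ n, IsCut (C n)) (hDc : IsCut D) (hD : IsCutLimit l C D) {p t q : Quantile}
    (hpt : p < t) (htq : t < q) (hpq : ∀ s : Quantile, p < s → s < q → (s : ℝ) ∈ D)
    (hcont : ContinuousAt f t) :
    Tendsto (fun n => pool hf (hC n) t) l (𝓝 (pool hf hDc t)) := by
  -- both sides are squeezed between values of `f` at cut points near `t`
  have hup : ∀ a > f t, ∃ u v : Quantile, t < u ∧ u < v ∧ f v < a ∧ (u : ℝ) ∈ D := by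
    intro a ha
    obtain ⟨v', hv', hsub⟩ := exists_Ico_subset_of_mem_nhds (hcont.eventually_lt_const ha) ⟨q, htq⟩
    obtain ⟨v, hv⟩ := exists_between (lt_min hv' htq)
    obtain ⟨u, hu⟩ := exists_between hv.1
    exact ⟨u, v, hu.1, hu.2, hsub ⟨hv.1.le, hv.2.trans_le (min_le_left _ _)⟩,
      hpq u (hpt.trans hu.1) (hu.2.trans (hv.2.trans_le (min_le_right _ _)))⟩
  have hdown : ∀ a < f t, ∃ u v : Quantile, u < v ∧ v < t ∧ a < f u ∧ (v : ℝ) ∈ D := by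
    intro a ha
    obtain ⟨u', hu', hsub⟩ := exists_Ioc_subset_of_mem_nhds (hcont.eventually_const_lt ha) ⟨p, hpt⟩
    obtain ⟨u, hu⟩ := exists_between (max_lt hu' hpt)
    obtain ⟨v, hv⟩ := exists_between hu.2
    exact ⟨u, v, hv.1, hv.2, hsub ⟨(le_max_left _ _).trans_lt hu.1, hu.2.le⟩,
      hpq v (((le_max_right _ _).trans_lt hu.1).trans hv.1) (hv.2.trans htq)⟩
  have heq : pool hf hDc t = f t := by
    refine le_antisymm (le_of_forall_gt_imp_ge_of_dense fun a ha => ?_)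
      (le_poolFun hf hDc le_rfl (hpq t hpt htq))
    obtain ⟨u, v, htu, huv, hva, hu⟩ := hup a ha
    exact (poolFun_le hf hDc htu hu).trans ((f.mono huv.le).trans hva.le)
  rw [heq]
  refine tendsto_order.2 ⟨fun a ha => ?_, fun a ha => ?_⟩
  · obtain ⟨u, v, huv, hvt, hau, hv⟩ := hdown a ha
    filter_upwards [hD.approx _ hv (min (v - u) (t - v))
      (lt_min (sub_pos.2 huv) (sub_pos.2 hvt))] with n hn
    obtain ⟨c, hc, hcd⟩ := hn
    have h3 := abs_lt.1 (hcd.trans_le (min_le_left _ _))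
    have h4 := abs_lt.1 (hcd.trans_le (min_le_right _ _))
    lift c to Quantile using ⟨by linarith [u.2.1], by linarith [t.2.2]⟩
    exact (hau.trans_le (f.mono (show (u : ℝ) ≤ c by linarith))).trans_le
      (le_poolFun hf (hC n) (show (c : ℝ) ≤ t by linarith) hc)
  · obtain ⟨u, v, htu, huv, hva, hu⟩ := hup a ha
    filter_upwards [hD.approx _ hu (min (u - t) (v - u))
      (lt_min (sub_pos.2 htu) (sub_pos.2 huv))] with n hn
    obtain ⟨c, hc, hcd⟩ := hn
    have h3 := abs_lt.1 (hcd.trans_le (min_le_left _ _))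
    have h4 := abs_lt.1 (hcd.trans_le (min_le_right _ _))
    lift c to Quantile using ⟨by linarith [t.2.1], by linarith [v.2.2]⟩
    exact (poolFun_le hf (hC n) (show (t : ℝ) < c by linarith) hc).trans_lt
      ((f.mono (show (c : ℝ) ≤ v by linarith)).trans_lt hva)

/-- Countably many quantiles do not exhaust an interval. -/
lemma exists_between_notMem {E : Set Quantile} (hE : E.Countable) {p q : Quantile} (hpq : p < q) :
    ∃ t ∉ E, p < t ∧ t < q := by
  have hd : Dense (Subtype.val '' E : Set ℝ)ᶜ := (hE.image _).dense_compl ℝ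
  obtain ⟨x, hx, hpx, hxq⟩ := hd.exists_between (show (p : ℝ) < q from hpq)
  exact ⟨⟨x, p.2.1.trans hpx.le, hxq.trans q.2.2⟩, fun h => hx ⟨_, h, rfl⟩, hpx, hxq⟩

/-- If the surplus `∫ V Q` is finite, some common partition is optimal. -/
theorem exists_optimal_of_surplus_ne_top (hV : IsQuantileFunction V) (hQ : IsQuantileFunction Q)
    (hfin : ∫⁻ u : Quantile, ENNReal.ofReal (Q u) * ENNReal.ofReal (V u) ≠ ∞) :
    ∃ (C : Set ℝ) (hC : IsCut C) (b : ℝ), b ∈ C ∧ (∀ c ∈ C, c ≤ 0 ∨ b ≤ c) ∧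
      ∀ W ∈ feasibleValues V, ∀ X ∈ feasibleAllocations Q,
        revenue W X ≤ revenue (pool hV hC) (pool (isQuantileFunction_cut hQ b) hC) := by
  let A : Set ℝ≥0∞ := {r | ∃ (C : Set ℝ) (hC : IsCut C) (b : ℝ), b ∈ C ∧
    (∀ c ∈ C, c ≤ 0 ∨ b ≤ c) ∧
    r = revenue (pool hV hC) (pool (isQuantileFunction_cut hQ b) hC)}
  have hA : A.Nonempty := by
    have h01 : IsCut (Icc (0 : ℝ) 1) := ⟨isClosed_Icc, Subset.rfl, by simp, by simp⟩
    exact ⟨_, _, h01, 0, h01.zero_mem, fun c hc => Or.inr hc.1, rfl⟩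
  obtain ⟨r, -, hr, hrA⟩ := exists_seq_tendsto_sSup hA (OrderTop.bddAbove A)
  choose C hC b hb hgap hrev using hrA
  let U : Ultrafilter ℕ := hyperfilter ℕ
  have hU : (U : Filter ℕ) ≤ atTop := Nat.hyperfilter_le_atTop
  obtain ⟨D, hDc, hD⟩ := exists_isCutLimit U hC
  obtain ⟨β, hβ, hlimβ⟩ := isCompact_Icc.ultrafilter_le_nhds (U.map b)
    (show Tendsto b U (𝓟 (Icc 0 1)) from
      tendsto_principal.2 (Eventually.of_forall fun n => (hC n).subset (hb n)))
  have hβt : Tendsto b U (𝓝 β) := hlimβ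
  have hβD : β ∈ D := hD.mem b (Eventually.of_forall hb) β hβt
  have hgapD : ∀ d ∈ D, d ≤ 0 ∨ β ≤ d := by
    intro d hd
    by_contra! h
    obtain ⟨n, ⟨c, hc, hcd⟩, hn⟩ := ((hD.approx d hd (min d ((β - d) / 2))
      (lt_min h.1 (by linarith))).and
      (hβt.eventually_const_lt (show β - (β - d) / 2 < β by linarith))).exists
    have h3 := abs_lt.1 (hcd.trans_le (min_le_left _ _))
    have h4 := abs_lt.1 (hcd.trans_le (min_le_right _ _))
    rcases hgap n c hc with h5 | h5 <;> linarith
  refine ⟨D, hDc, β, hβD, hgapD, fun W hW X hX => ?_⟩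
  have hsup : revenue W X ≤ sSup A := revenue_le_of_forall_pool hV hQ
    (fun C hC b hb hg => le_sSup ⟨C, hC, b, hb, hg, rfl⟩) hW hX
  refine hsup.trans ?_
  let G : Set Quantile := {t | Tendsto (fun n => pool hV (hC n) t) U (𝓝 (pool hV hDc t)) ∧
    Tendsto (fun n => pool hQ (hC n) t) U (𝓝 (pool hQ hDc t)) ∧ (t : ℝ) ≠ β}
  have hG : ∀ p q : Quantile, p < q → ∃ t ∈ G, p < t ∧ t < q := by
    intro p q hpq
    by_cases hsub : ∀ s : Quantile, p < s → s < q → (s : ℝ) ∈ D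
    · have hE : ({t | ¬ ContinuousAt V t} ∪ {t | ¬ ContinuousAt Q t} ∪
          {t : Quantile | (t : ℝ) = β}).Countable := by
        refine (V.mono.countable_not_continuousAt.union Q.mono.countable_not_continuousAt).union ?_
        refine Set.Subsingleton.countable fun s hs t ht => Subtype.ext ?_
        exact (show (s : ℝ) = β from hs).trans (show (t : ℝ) = β from ht).symm
      obtain ⟨t, ht, hpt, htq⟩ := exists_between_notMem hE hpq
      simp only [mem_union, mem_ofPred_eq, not_or, not_not] at ht
      exact ⟨t, ⟨tendsto_pool_of_Ioo_subset hV hC hDc hD hpt htq hsub ht.1.1,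
        tendsto_pool_of_Ioo_subset hQ hC hDc hD hpt htq hsub ht.1.2, ht.2⟩, hpt, htq⟩
    · push Not at hsub
      obtain ⟨t, hpt, htq, ht⟩ := hsub
      exact ⟨t, ⟨tendsto_pool_of_notMem hV hC hDc hD ht, tendsto_pool_of_notMem hQ hC hDc hD ht,
        fun h => ht (h ▸ hβD)⟩, hpt, htq⟩
  have hXG : ∀ t ∈ G, Tendsto (fun n => pool (isQuantileFunction_cut hQ (b n)) (hC n) t) U
      (𝓝 (pool (isQuantileFunction_cut hQ β) hDc t)) := by
    rintro t ⟨-, hQt, hne⟩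
    simp only [pool_apply] at hQt ⊢
    simp only [poolFun_cut hQ (hC _) (hb _), poolFun_cut hQ hDc hβD]
    rcases lt_or_gt_of_ne hne with h | h
    · rw [if_neg (not_le.2 h)]
      refine tendsto_const_nhds.congr' ?_
      filter_upwards [hβt.eventually_const_lt h] with n hn
      rw [if_neg (not_le.2 hn)]
    · rw [if_pos (le_of_lt h)]
      refine hQt.congr' ?_
      filter_upwards [hβt.eventually_lt_const h] with n hn
      rw [if_pos hn.le]
  refine le_revenue_of_tendsto (l := U) (G := G) (fun n => isQuantileFunction_pool hV (hC n))
    (fun n => isQuantileFunction_pool (isQuantileFunction_cut hQ (b n)) (hC n))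
    (isQuantileFunction_pool hV hDc) (isQuantileFunction_pool (isQuantileFunction_cut hQ β) hDc)
    hG (fun t ht => ht.1) hXG
    (T := fun c => ∫⁻ u in Ici c, ENNReal.ofReal (Q u) * ENNReal.ofReal (V u))
    (fun c c' h => lintegral_mono_set (Ici_subset_Ici.2 h)) ?_ (fun n c => revenue_tail_le hV hQ
      (pool_mem_feasibleValues hV (hC n))
      (pool_cut_mem_feasibleAllocations hQ (hC n) ((hC n).subset (hb n)).2) c) ?_
  · intro ε hε
    obtain ⟨δ, hδ, h⟩ := exists_pos_setLIntegral_lt_of_measure_lt hfin hε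
    obtain ⟨x, hx0, hx⟩ := ENNReal.lt_iff_exists_nnreal_btwn.1 hδ
    have hx0' : (0 : ℝ) < x := by exact_mod_cast hx0
    refine ⟨⟨max 0 (1 - x), le_max_left _ _, max_lt zero_lt_one (by linarith)⟩, (h _ ?_).le⟩
    refine lt_of_le_of_lt ?_ hx
    rw [volume_Ici, ← ENNReal.ofReal_coe_nnreal]
    refine ENNReal.ofReal_le_ofReal ?_
    have := le_max_right 0 (1 - (x : ℝ))
    dsimp only
    linarith
  · have : r = fun n => revenue (pool hV (hC n)) (pool (isQuantileFunction_cut hQ (b n)) (hC n)) :=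
      funext hrev
    rw [← this]
    exact hr.mono_left hU

end

section

/-! ### Infinite surplus -/

variable {V Q : StieltjesFunction Quantile}

lemma lintegral_Ici_lt_top_of_le (hV : IsQuantileFunction V) {c : Quantile} {M : ℝ}
    (h : ∀ t, c ≤ t → Q t ≤ M) :
    ∫⁻ u in Ici c, ENNReal.ofReal (Q u) * ENNReal.ofReal (V u) < ∞ := by
  calc ∫⁻ u in Ici c, ENNReal.ofReal (Q u) * ENNReal.ofReal (V u)
      ≤ ∫⁻ u in Ici c, ENNReal.ofReal M * ENNReal.ofReal (V u) :=
        setLIntegral_mono' measurableSet_Ici fun u hu =>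
          mul_le_mul_left (ENNReal.ofReal_le_ofReal (h u hu)) _
    _ = ENNReal.ofReal M * ENNReal.ofReal (tailInt V c) := by
        rw [lintegral_const_mul _ (measurable_ofReal_apply V), ofReal_tailInt hV]
    _ < ∞ := ENNReal.mul_lt_top ENNReal.ofReal_lt_top ENNReal.ofReal_lt_top

/-- Infinite surplus comes from the quantiles close to `1`. -/
lemma lintegral_Ici_eq_top
    (hinf : ∫⁻ u : Quantile, ENNReal.ofReal (Q u) * ENNReal.ofReal (V u) = ∞) (c : Quantile) :
    ∫⁻ u in Ici c, ENNReal.ofReal (Q u) * ENNReal.ofReal (V u) = ∞ := by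
  have hlow : ∫⁻ u in Iio c, ENNReal.ofReal (Q u) * ENNReal.ofReal (V u) < ∞ := by
    refine lt_of_le_of_lt (setLIntegral_mono' (g := fun _ => ENNReal.ofReal (Q c) *
      ENNReal.ofReal (V c)) measurableSet_Iio fun u hu => ?_) ?_
    · exact mul_le_mul' (ENNReal.ofReal_le_ofReal (Q.mono (le_of_lt hu)))
        (ENNReal.ofReal_le_ofReal (V.mono (le_of_lt hu)))
    · rw [setLIntegral_const]
      exact ENNReal.mul_lt_top (ENNReal.mul_lt_top ENNReal.ofReal_lt_top ENNReal.ofReal_lt_top)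
        (measure_lt_top _ _)
  by_contra h
  have := lintegral_union_le (μ := volume)
    (fun u : Quantile => ENNReal.ofReal (Q u) * ENNReal.ofReal (V u)) (Iio c) (Ici c)
  rw [Iio_union_Ici, setLIntegral_univ, hinf] at this
  exact absurd this (not_le.2 (ENNReal.add_lt_top.2 ⟨hlow, lt_top_iff_ne_top.2 h⟩))

/-- From `a` on, `Q` is at most twice its running average until it reaches twice that average. -/
lemma exists_next_double (hV : IsQuantileFunction V) (hQ : IsQuantileFunction Q)
    (hinf : ∫⁻ u : Quantile, ENNReal.ofReal (Q u) * ENNReal.ofReal (V u) = ∞)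
    {a : Quantile} (ha : 0 < Q a) :
    ∃ t, a < t ∧ 2 * avg Q a t ≤ Q t ∧ ∀ u, a ≤ u → u < t → Q u ≤ 2 * avg Q a t := by
  let S : Set ℝ := {x | ∃ t : Quantile, (t : ℝ) = x ∧ a < t ∧ 2 * avg Q a t ≤ Q t}
  have hne : S.Nonempty := by
    obtain ⟨c₁, hc₁⟩ := exists_between a.2.2
    let c : Quantile := ⟨c₁, a.2.1.trans hc₁.1.le, hc₁.2⟩
    have hac : (a : ℝ) < c := hc₁.1
    by_contra hS
    refine absurd (lintegral_Ici_eq_top hinf c) (lintegral_Ici_lt_top_of_le hV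
      (M := 2 * (tailInt Q a / (c - a))) fun t hct => ?_).ne
    have hct' : (c : ℝ) ≤ t := hct
    have hat : (a : ℝ) < t := hac.trans_le hct'
    have h1 : Q t < 2 * avg Q a t := by
      by_contra! h
      exact hS ⟨t, t, rfl, hat, h⟩
    refine h1.le.trans (mul_le_mul_of_nonneg_left ?_ zero_le_two)
    exact div_le_div₀ (tailInt_nonneg hQ _) (by linarith [tailInt_nonneg hQ t]) (sub_pos.2 hac)
      (by linarith)
  have hbdd : BddBelow S := ⟨a, by rintro x ⟨t, rfl, hat, -⟩; exact hat.le⟩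
  obtain ⟨v, hav, hv⟩ : ∃ v, a < v ∧ ∀ u, a ≤ u → u < v → Q u < 2 * Q a := by
    have hev : ∀ᶠ u in 𝓝[≥] a, Q u < 2 * Q a :=
      (Q.right_continuous a).eventually_lt_const (by linarith)
    obtain ⟨x, hx⟩ := exists_between a.2.2
    have hlt : a < (⟨x, a.2.1.trans hx.1.le, hx.2⟩ : Quantile) := hx.1
    obtain ⟨v, hv, hsub⟩ := (mem_nhdsGE_iff_exists_Ico_subset' hlt).1 hev
    exact ⟨v, hv, fun u h1 h2 => hsub ⟨h1, h2⟩⟩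
  have hvS : (v : ℝ) ≤ sInf S := by
    refine le_csInf hne ?_
    rintro x ⟨t, rfl, hat, ht⟩
    by_contra! h
    have h1 := hv t hat.le h
    have h2 := apply_le_avg hQ a (show (a : ℝ) < t from hat) t.2.2.le
    linarith
  have hav' : (a : ℝ) < v := hav
  obtain ⟨t, ht⟩ : ∃ t : Quantile, (t : ℝ) = sInf S := by
    obtain ⟨x, hx⟩ := hne
    refine ⟨⟨sInf S, by linarith [a.2.1], (csInf_le hbdd hx).trans_lt ?_⟩, rfl⟩
    obtain ⟨s, rfl, -⟩ := hx
    exact s.2.2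
  have hat : (a : ℝ) < t := by rw [ht]; linarith
  refine ⟨t, hat, ?_, fun u hau hut => ?_⟩
  · refine ge_of_tendsto ((Q.right_continuous t).mono_left
      (nhdsWithin_mono _ Ioi_subset_Ici_self) : Tendsto Q (𝓝[>] t) (𝓝 (Q t))) ?_
    filter_upwards [self_mem_nhdsWithin] with u hu
    obtain ⟨x, ⟨s, rfl, has, hs⟩, hsu⟩ := exists_lt_of_csInf_lt hne
      (show sInf S < u by rw [← ht]; exact hu)
    have hts : (t : ℝ) ≤ s := ht ▸ csInf_le hbdd ⟨s, rfl, has, hs⟩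
    have h1 := avg_mono_right hQ a.2.1 hat hts s.2.2.le
    have h2 := Q.mono (show s ≤ u from hsu.le)
    linarith
  · rcases hau.eq_or_lt with rfl | hau
    · have h1 := apply_le_avg hQ a hat t.2.2.le
      linarith
    · by_contra! h
      have h1 := avg_mono_right hQ a.2.1 (show (a : ℝ) < u from hau)
        (show (u : ℝ) ≤ t from hut.le) t.2.2.le
      have h2 : sInf S ≤ u := csInf_le hbdd ⟨u, rfl, hau, by linarith⟩
      rw [← ht] at h2
      exact absurd hut (not_lt.2 h2)

/-- If the surplus `∫ V Q` is infinite, some common partition has infinite revenue. Its intervals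
end where `Q` reaches twice its average, so that pooling costs at most a constant factor of the
surplus on an interval, and the averages of `Q` at least double from one interval to the next. -/
theorem exists_revenue_eq_top (hV : IsQuantileFunction V) (hQ : IsQuantileFunction Q)
    (hinf : ∫⁻ u : Quantile, ENNReal.ofReal (Q u) * ENNReal.ofReal (V u) = ∞) :
    ∃ (C : Set ℝ) (hC : IsCut C), revenue (pool hV hC) (pool hQ hC) = ∞ := by
  obtain ⟨a, ha⟩ : ∃ a, 0 < Q a := by
    by_contra! h
    refine absurd (lintegral_Ici_eq_top hinf 0) (lintegral_Ici_lt_top_of_le hV (M := 0)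
      fun t _ => h t).ne
  choose nxt hnxt using fun a : {a : Quantile // 0 < Q a} => exists_next_double hV hQ hinf a.2
  let step : {a : Quantile // 0 < Q a} → {a : Quantile // 0 < Q a} := fun a =>
    ⟨nxt a, a.2.trans_le (Q.mono (hnxt a).1.le)⟩
  let G : ℕ → {a : Quantile // 0 < Q a} := fun n => step^[n] ⟨a, ha⟩
  let p : ℕ → Quantile := fun n => (G n).1
  have hG : ∀ n, p (n + 1) = nxt (G n) := fun n => by
    simp only [p, G, Function.iterate_succ_apply']
    rfl
  have hlt : ∀ n, p n < p (n + 1) := fun n => by rw [hG]; exact (hnxt (G n)).1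
  have hmono : StrictMono p := strictMono_nat_of_lt_succ hlt
  set x : ℕ → ℝ := fun n => avg Q (p n) (p (n + 1)) with hx
  have hQx : ∀ n, Q (p n) ≤ x n := fun n => apply_le_avg hQ _ (hlt n) (p (n + 1)).2.2.le
  have hxQ : ∀ n, 2 * x n ≤ Q (p (n + 1)) := fun n => by
    simp only [hx, hG]
    exact (hnxt (G n)).2.1
  have hQle : ∀ n u, p n ≤ u → u < p (n + 1) → Q u ≤ 2 * x n := fun n u h1 h2 => by
    rw [hG] at h2
    simp only [hx, hG]
    exact (hnxt (G n)).2.2 u h1 h2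
  have hpow : ∀ n, 2 ^ n * Q a ≤ Q (p n) := fun n => by
    induction n with
    | zero => simp [p, G]
    | succ n ih =>
      have h1 := hQx n
      have h2 := hxQ n
      rw [pow_succ]
      linarith
  have hunb : ∀ t : Quantile, ∃ n, t < p n := fun t => by
    obtain ⟨n, hn⟩ := pow_unbounded_of_one_lt (Q t / Q a) one_lt_two
    rw [div_lt_iff₀ ha] at hn
    exact ⟨n, Q.mono.reflect_lt (hn.trans_le (hpow n))⟩
  have htend : Tendsto (fun n => (p n : ℝ)) atTop (𝓝 1) := by
    refine tendsto_order.2 ⟨fun y hy => ?_, fun y hy => Eventually.of_forall fun n =>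
      (p n).2.2.trans hy⟩
    obtain ⟨n, hn⟩ := hunb ⟨max 0 y, le_max_left _ _, max_lt zero_lt_one hy⟩
    filter_upwards [eventually_ge_atTop n] with k hk
    exact (le_max_right 0 y).trans_lt (lt_of_lt_of_le
      (show max 0 y < (p n : ℝ) from hn) (hmono.monotone hk))
  let C : Set ℝ := insert 0 (insert 1 (range fun n => (p n : ℝ)))
  have hC : IsCut C := by
    refine ⟨(htend.isCompact_insert_range.insert 0).isClosed, ?_, by simp [C], by simp [C]⟩
    rintro c (rfl | rfl | ⟨n, rfl⟩)
    · simp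
    · simp
    · exact ⟨(p n).2.1, (p n).2.2.le⟩
  have hpC : ∀ n, (p n : ℝ) ∈ C := fun n => Or.inr (Or.inr ⟨n, rfl⟩)
  have hcons : ∀ n, ∀ c ∈ C, c ≤ p n ∨ (p (n + 1) : ℝ) ≤ c := by
    rintro n c (rfl | rfl | ⟨k, rfl⟩)
    · exact Or.inl (p n).2.1
    · exact Or.inr (p (n + 1)).2.2.le
    · rcases Nat.lt_or_ge n k with h | h
      · exact Or.inr (hmono.monotone h)
      · exact Or.inl (hmono.monotone h)
  have hpool : ∀ {f : StieltjesFunction Quantile} (hf : IsQuantileFunction f) n,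
      ∀ t ∈ cell ((p n : ℝ), (p (n + 1) : ℝ)), pool hf hC t = avg f (p n) (p (n + 1)) :=
    fun hf n t ht => poolFun_eq_avg hC (hpC n) (hpC (n + 1)) (hcons n) ht
  refine ⟨C, hC, ?_⟩
  set w : ℕ → ℝ := fun n => avg V (p n) (p (n + 1)) with hw
  have hleft : ∀ n, leftVal (pool hQ hC) (p (n + 1)) = x n := fun n => by
    have h1 : pool hQ hC (p n) = x n := hpool hQ n (p n) ⟨le_rfl, hlt n⟩
    rw [← h1]
    exact leftVal_eq_of_const (hlt n) fun s hs => (hpool hQ n s hs).trans h1.symm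
  have hterm : ∀ n, ∫⁻ u in Ico (p (n + 1)) (p (n + 2)),
      ENNReal.ofReal (Q u) * ENNReal.ofReal (V u) ≤ 4 * ∫⁻ t in Ico (p (n + 1)) (p (n + 2)),
        ENNReal.ofReal ((1 - (t : ℝ)) * pool hV hC t) ∂jumpMeasure (pool hQ hC) := by
    intro n
    have hx0 : 0 ≤ x (n + 1) := avg_nonneg hQ (hlt (n + 1)).le (p (n + 2)).2.2.le
    have hw0 : 0 ≤ w (n + 1) := avg_nonneg hV (hlt (n + 1)).le (p (n + 2)).2.2.le
    have hL : ∫⁻ u in Ico (p (n + 1)) (p (n + 2)), ENNReal.ofReal (Q u) * ENNReal.ofReal (V u)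
        ≤ ENNReal.ofReal (2 * x (n + 1) * (w (n + 1) * (p (n + 2) - p (n + 1)))) := by
      calc ∫⁻ u in Ico (p (n + 1)) (p (n + 2)), ENNReal.ofReal (Q u) * ENNReal.ofReal (V u)
          ≤ ∫⁻ u in Ico (p (n + 1)) (p (n + 2)),
            ENNReal.ofReal (2 * x (n + 1)) * ENNReal.ofReal (V u) :=
            setLIntegral_mono' measurableSet_Ico fun u hu =>
              mul_le_mul_left (ENNReal.ofReal_le_ofReal (hQle (n + 1) u hu.1 hu.2)) _
        _ = _ := by
            rw [lintegral_const_mul _ (measurable_ofReal_apply V),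
              ENNReal.ofReal_mul (p := 2 * x (n + 1)) (by positivity),
              ← tailInt_sub V (hlt (n + 1)),
              ← integral_cell hV (hlt (n + 1)).le (p (n + 2)).2.2.le,
              ofReal_integral_eq_lintegral_ofReal hV.integrable.integrableOn
                (Eventually.of_forall fun s => hV.nonneg s)]
            rfl
    have hR : ENNReal.ofReal ((1 - (p (n + 1) : ℝ)) * w (n + 1) * (x (n + 1) - x n))
        ≤ ∫⁻ t in Ico (p (n + 1)) (p (n + 2)),
          ENNReal.ofReal ((1 - (t : ℝ)) * pool hV hC t) ∂jumpMeasure (pool hQ hC) := by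
      have hmem : p (n + 1) ∈ cell ((p (n + 1) : ℝ), (p (n + 2) : ℝ)) := ⟨le_rfl, hlt (n + 1)⟩
      refine le_trans (le_of_eq ?_) (lintegral_mono_set
        (singleton_subset_iff.2 (show p (n + 1) ∈ Ico (p (n + 1)) (p (n + 2)) from hmem)))
      rw [lintegral_singleton, jumpMeasure_singleton (isQuantileFunction_pool hQ hC), hleft,
        hpool hQ (n + 1) _ hmem, hpool hV (n + 1) _ hmem, ENNReal.ofReal_mul]
      exact mul_nonneg (sub_nonneg.2 (p (n + 1)).2.2.le) hw0
    refine hL.trans (le_trans ?_ (mul_le_mul_right hR 4))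
    rw [← ENNReal.ofReal_ofNat 4, ← ENNReal.ofReal_mul (by norm_num)]
    refine ENNReal.ofReal_le_ofReal ?_
    have h1 := hxQ n
    have h2 := hQx (n + 1)
    have h3 := (p (n + 2)).2.2
    have h4 := (p (n + 1)).2.2
    have h5 : (p (n + 2) : ℝ) - p (n + 1) ≤ 1 - p (n + 1) := by linarith
    calc 2 * x (n + 1) * (w (n + 1) * (p (n + 2) - p (n + 1)))
        ≤ 2 * x (n + 1) * (w (n + 1) * (1 - p (n + 1))) := by gcongr
      _ ≤ 2 * (2 * (x (n + 1) - x n)) * (w (n + 1) * (1 - p (n + 1))) := by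
          refine mul_le_mul_of_nonneg_right (by linarith) (mul_nonneg hw0 (by linarith))
      _ = _ := by ring
  have hdisj : Pairwise (Function.onFun Disjoint fun n => Ico (p (n + 1)) (p (n + 2))) :=
    Monotone.pairwise_disjoint_on_Ico_succ (f := fun n => p (n + 1))
      fun _ _ h => hmono.monotone (Nat.succ_le_succ h)
  have hcover : Ici (p 1) ⊆ ⋃ n, Ico (p (n + 1)) (p (n + 2)) := by
    intro t ht
    have hex : ∃ n, t < p (n + 2) := by
      obtain ⟨n, hn⟩ := hunb t
      exact ⟨n, hn.trans (hmono (by omega))⟩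
    refine mem_iUnion.2 ⟨Nat.find hex, ?_, Nat.find_spec hex⟩
    rcases h : Nat.find hex with _ | k
    · exact ht
    · exact not_lt.1 (Nat.find_min hex (h ▸ k.lt_succ_self))
  have htop : (∞ : ℝ≥0∞) ≤ 4 * revenue (pool hV hC) (pool hQ hC) := by
    calc (∞ : ℝ≥0∞) = ∫⁻ u in Ici (p 1), ENNReal.ofReal (Q u) * ENNReal.ofReal (V u) :=
          (lintegral_Ici_eq_top hinf _).symm
      _ ≤ ∫⁻ u in ⋃ n, Ico (p (n + 1)) (p (n + 2)), ENNReal.ofReal (Q u) * ENNReal.ofReal (V u) :=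
          lintegral_mono_set hcover
      _ = ∑' n, ∫⁻ u in Ico (p (n + 1)) (p (n + 2)), ENNReal.ofReal (Q u) * ENNReal.ofReal (V u) :=
          lintegral_iUnion (fun n => measurableSet_Ico) hdisj _
      _ ≤ ∑' n, 4 * ∫⁻ t in Ico (p (n + 1)) (p (n + 2)),
          ENNReal.ofReal ((1 - (t : ℝ)) * pool hV hC t) ∂jumpMeasure (pool hQ hC) :=
          ENNReal.tsum_le_tsum hterm
      _ = 4 * ∫⁻ t in ⋃ n, Ico (p (n + 1)) (p (n + 2)),
          ENNReal.ofReal ((1 - (t : ℝ)) * pool hV hC t) ∂jumpMeasure (pool hQ hC) := by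
          rw [ENNReal.tsum_mul_left, lintegral_iUnion (fun n => measurableSet_Ico) hdisj]
      _ ≤ 4 * revenue (pool hV hC) (pool hQ hC) := by
          rw [revenue_eq_lintegral _ _ (isQuantileFunction_pool hV hC)]
          exact mul_le_mul_right (setLIntegral_le_lintegral _ _) _
  by_contra h
  exact absurd htop (not_le.2 (ENNReal.mul_lt_top (by norm_num) (lt_top_iff_ne_top.2 h)))

/-- Some common partition is optimal. -/
theorem exists_optimal_pool (hV : IsQuantileFunction V) (hQ : IsQuantileFunction Q) :
    ∃ (C : Set ℝ) (hC : IsCut C) (b : ℝ), b ∈ C ∧ (∀ c ∈ C, c ≤ 0 ∨ b ≤ c) ∧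
      ∀ W ∈ feasibleValues V, ∀ X ∈ feasibleAllocations Q,
        revenue W X ≤ revenue (pool hV hC) (pool (isQuantileFunction_cut hQ b) hC) := by
  by_cases h : ∫⁻ u : Quantile, ENNReal.ofReal (Q u) * ENNReal.ofReal (V u) = ∞
  · obtain ⟨C, hC, hr⟩ := exists_revenue_eq_top hV hQ h
    refine ⟨C, hC, 0, hC.zero_mem, fun c hc => Or.inr (hC.subset hc).1, fun W _ X _ => ?_⟩
    have : pool (isQuantileFunction_cut hQ 0) hC = pool hQ hC := by
      congr 1
      exact cut_zero hQ
    rw [this, hr]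
    exact le_top
  · exact exists_optimal_of_surplus_ne_top hV hQ h

end

section

/-! ### Common support -/

variable {f V Q : StieltjesFunction Quantile} {C : Set ℝ}

/-- The monotone function `W` is constant on a neighbourhood of `c`. -/
def ConstNear (W : Quantile → ℝ) (c : ℝ) : Prop :=
  ∃ s t : Quantile, (s : ℝ) < c ∧ c < t ∧ W s = W t

/-- The cut points around which `W` is not constant. -/
def activeCuts (C : Set ℝ) (W : Quantile → ℝ) : Set ℝ := {c ∈ C | ¬ ConstNear W c}

lemma isCut_activeCuts (hC : IsCut C) (W : Quantile → ℝ) : IsCut (activeCuts C W) := by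
  refine ⟨hC.isClosed.inter (isClosed_compl_iff.2 ?_), fun c hc => hC.subset hc.1,
    ⟨hC.zero_mem, ?_⟩, ⟨hC.one_mem, ?_⟩⟩
  · refine isOpen_iff_mem_nhds.2 ?_
    rintro c ⟨s, t, hs, ht, h⟩
    filter_upwards [Ioi_mem_nhds hs, Iio_mem_nhds ht] with x hx hx'
    exact ⟨s, t, hx, hx', h⟩
  · rintro ⟨s, t, hs, -, -⟩
    exact absurd hs (not_lt.2 s.2.1)
  · rintro ⟨s, t, -, ht, -⟩
    exact absurd ht (not_lt.2 t.2.2.le)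

/-- A step function is still a step function without the cut points around which it is constant. -/
lemma stepOn_activeCuts (hC : IsCut C) (hf : StepOn C f) : StepOn (activeCuts C f) f := by
  intro s t hst h
  refine le_antisymm (f.mono hst) ?_
  -- the first quantile after `s` at which `f` reaches `f t`
  set S : Set ℝ := {x | ∃ u : Quantile, (u : ℝ) = x ∧ s ≤ u ∧ f t ≤ f u} with hS
  have hne : S.Nonempty := ⟨t, t, rfl, hst, le_rfl⟩
  have hbdd : BddBelow S := ⟨s, by rintro x ⟨u, rfl, hu, -⟩; exact hu⟩
  have hsm : (s : ℝ) ≤ sInf S := le_csInf hne (by rintro x ⟨u, rfl, hu, -⟩; exact hu)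
  have hmt : sInf S ≤ t := csInf_le hbdd ⟨t, rfl, hst, le_rfl⟩
  obtain ⟨m, hm⟩ : ∃ m : Quantile, (m : ℝ) = sInf S :=
    ⟨⟨sInf S, s.2.1.trans hsm, hmt.trans_lt t.2.2⟩, rfl⟩
  have hsm' : s ≤ m := show (s : ℝ) ≤ m by rw [hm]; exact hsm
  have hval : ∀ u : Quantile, m < u → f t ≤ f u := by
    intro u hu
    obtain ⟨x, ⟨v, rfl, -, hv⟩, hvu⟩ := exists_lt_of_csInf_lt hne
      (show sInf S < u by rw [← hm]; exact hu)
    exact hv.trans (f.mono (show v ≤ u from hvu.le))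
  rcases hsm'.eq_or_lt with heq | hlt
  · refine ge_of_tendsto ((f.right_continuous s).mono_left
      (nhdsWithin_mono _ Ioi_subset_Ici_self) : Tendsto f (𝓝[>] s) (𝓝 (f s))) ?_
    filter_upwards [self_mem_nhdsWithin] with u hu
    exact hval u (heq ▸ hu)
  · exfalso
    have hnear : ConstNear f m := by
      by_cases hmC : (m : ℝ) ∈ C
      · by_contra hn
        have := h m ⟨hmC, hn⟩ (by rw [hm]; exact hmt)
        exact absurd hlt (not_lt.2 this)
      · obtain ⟨l, r, ⟨hl, hr⟩, hlr⟩ := mem_nhds_iff_exists_Ioo_subset.1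
          (hC.isClosed.isOpen_compl.mem_nhds hmC)
        obtain ⟨x, hx1, hx2⟩ := exists_between (max_lt hl (show (s : ℝ) < m from hlt))
        obtain ⟨y, hy1, hy2⟩ := exists_between (lt_min hr m.2.2)
        rw [max_lt_iff] at hx1
        rw [lt_min_iff] at hy2
        refine ⟨⟨x, s.2.1.trans hx1.2.le, hx2.trans m.2.2⟩,
          ⟨y, m.2.1.trans hy1.le, hy2.2⟩, hx2, hy1,
          hf _ _ (show x ≤ y from (hx2.trans hy1).le) fun c hc hcy => ?_⟩
        by_contra! hxc
        exact hlr ⟨hx1.1.trans hxc, lt_of_le_of_lt hcy hy2.1⟩ hc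
    obtain ⟨p, q, hpm, hmq, hpq⟩ := hnear
    have hmem : ((max p s : Quantile) : ℝ) ∈ S :=
      ⟨max p s, rfl, le_max_right _ _,
        ((hval q hmq).trans hpq.ge).trans (f.mono (le_max_left _ _))⟩
    have h1 : (m : ℝ) ≤ (max p s : Quantile) := hm ▸ csInf_le hbdd hmem
    exact absurd (max_lt (show p < m from hpm) hlt) (not_lt.2 h1)

/-- A pooled function is also generated by those cut points around which it is not constant. -/
lemma pool_activeCuts (hf : IsQuantileFunction f) (hC : IsCut C) :
    pool hf (isCut_activeCuts hC (pool hf hC)) = pool hf hC :=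
  (eq_pool_of_stepOn hf _ (isQuantileFunction_pool hf hC)
    (stepOn_activeCuts hC (stepOn_poolFun hC)) fun _ hc => tailInt_pool_of_mem hf hC hc.1).symm

/-- Pooling does not flatten a function around a cut point: the tail integrals at the cut point
agree, and those nearby do not increase. -/
lemma constNear_of_constNear_pool (hf : IsQuantileFunction f) (hC : IsCut C) {c : ℝ} (hc : c ∈ C)
    (h : ConstNear (pool hf hC) c) : ConstNear f c := by
  obtain ⟨s, t, hsc, hct, hst⟩ := h
  have hp := isQuantileFunction_pool hf hC
  have hconst : ∀ u : Quantile, s ≤ u → u ≤ t → pool hf hC u = pool hf hC s := fun u h1 h2 =>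
    le_antisymm (((pool hf hC).mono h2).trans hst.ge) ((pool hf hC).mono h1)
  set v := pool hf hC s with hv
  have hc0 : 0 ≤ c := (hC.subset hc).1
  have e1 : avg (pool hf hC) s c = v :=
    le_antisymm (avg_le hp s.2.1 hsc (hC.subset hc).2 fun u hu =>
      (hconst u hu.1 (hu.2.trans hct).le).le)
    (le_avg hp s.2.1 hsc (hC.subset hc).2 fun u hu => (hconst u hu.1 (hu.2.trans hct).le).ge)
  have e2 : avg (pool hf hC) c t = v :=
    le_antisymm (avg_le hp hc0 hct t.2.2.le fun u hu => (hconst u (hsc.le.trans hu.1) hu.2.le).le)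
    (le_avg hp hc0 hct t.2.2.le fun u hu => (hconst u (hsc.le.trans hu.1) hu.2.le).ge)
  have hl := tailInt_sub (pool hf hC) hsc
  have hr := tailInt_sub (pool hf hC) hct
  rw [e1, tailInt_pool_of_mem hf hC hc] at hl
  rw [e2, tailInt_pool_of_mem hf hC hc] at hr
  have hls := tailInt_pool_le hf hC s
  have hrt := tailInt_pool_le hf hC t
  lift c to Quantile using ⟨hc0, hct.trans t.2.2⟩
  obtain ⟨x, hx1, hx2⟩ := exists_between hsc
  obtain ⟨y, hy1, hy2⟩ := exists_between hct
  obtain ⟨p, rfl⟩ : ∃ p : Quantile, (p : ℝ) = x := ⟨⟨x, s.2.1.trans hx1.le, hx2.trans c.2.2⟩, rfl⟩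
  obtain ⟨q, rfl⟩ : ∃ q : Quantile, (q : ℝ) = y := ⟨⟨y, c.2.1.trans hy1.le, hy2.trans t.2.2⟩, rfl⟩
  have hcv : f c ≤ v := by
    have h1 := apply_le_avg hf c hct t.2.2.le
    have h2 := tailInt_sub f hct
    have h3 : avg f c t * (t - c) ≤ v * (t - c) := by linarith
    exact h1.trans (le_of_mul_le_mul_right h3 (sub_pos.2 hct))
  have hpv : v ≤ f p := by
    have h1 := tailInt_sub f hx1
    have h2 := tailInt_sub f hx2
    have h3 : avg f s p ≤ f p :=
      avg_le hf s.2.1 hx1 p.2.2.le fun u hu => f.mono (show u ≤ p from hu.2.le)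
    have h4 : avg f p c ≤ f c :=
      avg_le hf p.2.1 hx2 c.2.2.le fun u hu => f.mono (show u ≤ c from hu.2.le)
    have h5 := mul_le_mul_of_nonneg_right h3 (sub_pos.2 hx1).le
    have h6 := mul_le_mul_of_nonneg_right (h4.trans hcv) (sub_pos.2 hx2).le
    have h7 : v * (p - s) ≤ f p * (p - s) := by linarith
    exact le_of_mul_le_mul_right h7 (sub_pos.2 hx1)
  have hqv : f q ≤ v := by
    have h1 := tailInt_sub f hy1
    have h2 := tailInt_sub f hy2
    have h3 : v ≤ avg f c q := (hpv.trans (f.mono (show p ≤ c from hx2.le))).trans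
      (apply_le_avg hf c hy1 q.2.2.le)
    have h4 : f q ≤ avg f q t := apply_le_avg hf q hy2 t.2.2.le
    have h5 := mul_le_mul_of_nonneg_right h3 (sub_pos.2 hy1).le
    have h6 := mul_le_mul_of_nonneg_right h4 (sub_pos.2 hy2).le
    have h7 : f q * (t - q) ≤ v * (t - q) := by linarith
    exact le_of_mul_le_mul_right h7 (sub_pos.2 hy2)
  exact ⟨p, q, hx2, hy1,
    le_antisymm (f.mono (show (p : ℝ) ≤ q from (hx2.trans hy1).le)) (hqv.trans hpv)⟩

/-- The revenue is affine in the allocation, hence on a segment at most its larger end value. -/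
lemma revenue_segment_le {W X A B : StieltjesFunction Quantile} {θ : ℝ} (h0 : 0 ≤ θ) (h1 : θ ≤ 1)
    (hW : IsQuantileFunction W) (hA : IsQuantileFunction A) (hB : IsQuantileFunction B)
    (hX : ∀ t, X t = (1 - θ) * A t + θ * B t) :
    revenue W X ≤ max (revenue W A) (revenue W B) := by
  lift θ to NNReal using h0
  obtain ⟨η, hη⟩ : ∃ η : NNReal, (η : ℝ) = 1 - θ := ⟨⟨1 - θ, sub_nonneg.2 h1⟩, rfl⟩
  have hsum : (η : ℝ≥0∞) + θ = 1 := by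
    rw [← ENNReal.coe_add, show η + θ = 1 from NNReal.coe_injective (by push_cast; linarith),
      ENNReal.coe_one]
  have hXe : X = η • A + θ • B := StieltjesFunction.ext fun t => by
    rw [hX, ← hη]
    rfl
  have hrev : revenue W X = η * revenue W A + θ * revenue W B := by
    have h0' : ENNReal.ofReal (W 0 * X 0)
        = η * ENNReal.ofReal (W 0 * A 0) + θ * ENNReal.ofReal (W 0 * B 0) := by
      have hWA := mul_nonneg (hW.nonneg 0) (hA.nonneg 0)
      have hWB := mul_nonneg (hW.nonneg 0) (hB.nonneg 0)
      rw [← ENNReal.ofReal_coe_nnreal, ← ENNReal.ofReal_coe_nnreal,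
        ← ENNReal.ofReal_mul η.coe_nonneg, ← ENNReal.ofReal_mul θ.coe_nonneg,
        ← ENNReal.ofReal_add (mul_nonneg η.coe_nonneg hWA) (mul_nonneg θ.coe_nonneg hWB), hX, ← hη]
      congr 1
      ring
    have hm : X.measure = η • A.measure + θ • B.measure := by
      rw [hXe, StieltjesFunction.measure_add, StieltjesFunction.measure_smul,
        StieltjesFunction.measure_smul]
    rw [revenue, revenue, revenue, h0', hm, lintegral_add_measure, lintegral_smul_measure,
      lintegral_smul_measure, ENNReal.smul_def, ENNReal.smul_def, smul_eq_mul, smul_eq_mul]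
    ring
  calc revenue W X ≤ η * max (revenue W A) (revenue W B) + θ * max (revenue W A) (revenue W B) := by
        rw [hrev]
        gcongr
        exacts [le_max_left _ _, le_max_right _ _]
    _ = _ := by rw [← add_mul, hsum, one_mul]

/-- Excluding the quantiles below a point `b` that is not a cut point is no better than excluding
all or none of the lowest pooling interval. -/
lemma exists_revenue_pool_cut_le {W : StieltjesFunction Quantile} (hW : IsQuantileFunction W)
    (hQ : IsQuantileFunction Q) (hC : IsCut C) {b : ℝ} (hb0 : 0 ≤ b) (hb1 : b ≤ 1)
    (hgap : ∀ c ∈ C, c ≤ 0 ∨ b ≤ c) :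
    ∃ r ∈ C, (∀ c ∈ C, c ≤ 0 ∨ r ≤ c) ∧
      revenue W (pool (isQuantileFunction_cut hQ b) hC)
        ≤ revenue W (pool (isQuantileFunction_cut hQ r) hC) := by
  by_cases hbC : b ∈ C
  · exact ⟨b, hbC, hgap, le_rfl⟩
  set r := hi C (0 : Quantile) with hr
  have hrC : r ∈ C := hC.hi_mem 0
  have hr1 : r ≤ 1 := hC.hi_le_one 0
  have hgapr : ∀ c ∈ C, c ≤ 0 ∨ r ≤ c := fun c hc =>
    (le_or_gt c 0).imp id fun h => hC.hi_le 0 hc h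
  have hb0' : 0 < b := lt_of_le_of_ne hb0 fun h => hbC (h ▸ hC.zero_mem)
  have hbr : b ≤ r := le_csInf ⟨1, hC.one_mem, (0 : Quantile).2.2⟩ fun c hc =>
    (hgap c hc.1).resolve_left (not_le.2 hc.2)
  have hr0 : 0 < r := hb0'.trans_le hbr
  have hqb := isQuantileFunction_cut hQ b
  set α := avg (cut hQ b) 0 r with hα
  set β := avg Q 0 r with hβ
  have hα0 : 0 ≤ α := avg_nonneg hqb hr0.le hr1
  have hαβ : α ≤ β := by
    rw [hα, hβ, avg, avg, tailInt_cut_of_le hQ hbr, tailInt_cut_of_ge hQ hb0 hb1]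
    have := tailInt_antitone hQ hb0 hb1
    gcongr
  have hθβ : α / β * β = α := by
    rcases (hα0.trans hαβ).eq_or_lt with h | h
    · rw [← h] at hαβ ⊢
      rw [mul_zero]
      exact le_antisymm hα0 hαβ
    · exact div_mul_cancel₀ _ h.ne'
  have hmax := revenue_segment_le (div_nonneg hα0 (hα0.trans hαβ))
    (div_le_one_of_le₀ hαβ (hα0.trans hαβ)) hW
    (isQuantileFunction_pool (isQuantileFunction_cut hQ r) hC)
    (isQuantileFunction_pool (isQuantileFunction_cut hQ 0) hC)
    (X := pool hqb hC) fun t => by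
      rw [pool_apply, pool_apply, pool_apply, poolFun_cut hQ hC hrC,
        poolFun_cut hQ hC hC.zero_mem, if_pos t.2.1]
      split_ifs with h
      · have : poolFun (cut hQ b) C t = poolFun Q C t := by
          by_cases hl : lo C t < hi C t
          · have h1 : b ≤ lo C t := hbr.trans (hC.le_lo t hrC h)
            rw [poolFun_of_lt hl, poolFun_of_lt hl, avg, avg, tailInt_cut_of_le hQ h1,
              tailInt_cut_of_le hQ (h1.trans hl.le)]
          · rw [poolFun_of_not_lt hl, poolFun_of_not_lt hl, cut_of_le hQ (hbr.trans h)]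
        rw [this]
        ring
      · have ht : t ∈ cell (0, r) := ⟨t.2.1, not_le.1 h⟩
        rw [poolFun_eq_avg hC hC.zero_mem hrC hgapr ht, poolFun_eq_avg hC hC.zero_mem hrC hgapr ht,
          mul_zero, zero_add, hθβ]
  rcases le_max_iff.1 hmax with h | h
  · exact ⟨r, hrC, hgapr, h⟩
  · exact ⟨0, hC.zero_mem, fun c hc => Or.inr (hC.subset hc).1, h⟩

/-- Some optimal common partition has no cut point around which one of the two functions is
constant. -/
theorem exists_optimal_activeCuts (hV : IsQuantileFunction V) (hQ : IsQuantileFunction Q) :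
    ∃ (C : Set ℝ) (hC : IsCut C) (b : ℝ), b ∈ C ∧ (∀ c ∈ C, c ≤ 0 ∨ b ≤ c) ∧
      (∀ c ∈ C, ¬ ConstNear (pool hV hC) c) ∧
      (∀ c ∈ C, ¬ ConstNear (pool (isQuantileFunction_cut hQ b) hC) c) ∧
      ∀ W ∈ feasibleValues V, ∀ X ∈ feasibleAllocations Q,
        revenue W X ≤ revenue (pool hV hC) (pool (isQuantileFunction_cut hQ b) hC) := by
  obtain ⟨C, hC, b, hbC, hgap, hopt⟩ := exists_optimal_pool hV hQ
  -- drop the cut points around which the value function is constant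
  set C₁ := activeCuts C (pool hV hC) with hC₁
  have hc₁ : IsCut C₁ := isCut_activeCuts hC _
  have hsub₁ : C₁ ⊆ C := sep_subset _ _
  have hV₁ : pool hV hc₁ = pool hV hC := pool_activeCuts hV hC
  obtain ⟨r, hrC, hgapr, hr⟩ := exists_revenue_pool_cut_le (isQuantileFunction_pool hV hc₁) hQ hc₁
    (hC.subset hbC).1 (hC.subset hbC).2 fun c hc => hgap c (hsub₁ hc)
  have hle₁ : revenue (pool hV hC) (pool (isQuantileFunction_cut hQ b) hC)
      ≤ revenue (pool hV hc₁) (pool (isQuantileFunction_cut hQ r) hc₁) := by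
    refine le_trans ?_ hr
    rw [← pool_pool (isQuantileFunction_cut hQ b) hC hc₁ hsub₁, ← hV₁]
    exact revenue_le_pool_right (isQuantileFunction_pool hV hc₁) _ hc₁ (stepOn_poolFun hc₁)
  -- drop the cut points around which the allocation is constant
  set X := pool (isQuantileFunction_cut hQ r) hc₁ with hX
  set C₂ := activeCuts C₁ X with hC₂
  have hc₂ : IsCut C₂ := isCut_activeCuts hc₁ _
  have hsub₂ : C₂ ⊆ C₁ := sep_subset _ _
  have hX₂ : pool (isQuantileFunction_cut hQ r) hc₂ = X := pool_activeCuts _ hc₁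
  have hW₂ : pool (isQuantileFunction_pool hV hc₁) hc₂ = pool hV hc₂ := pool_pool hV hc₁ hc₂ hsub₂
  have hle₂ : revenue (pool hV hc₁) X ≤ revenue (pool hV hc₂) X := by
    rw [← hW₂]
    exact revenue_le_pool_left _ hc₂ (stepOn_activeCuts hc₁ (stepOn_poolFun hc₁))
  -- if the exclusion threshold was dropped, then nothing of value was excluded
  obtain ⟨d, hd, hgapd, hcut⟩ : ∃ d ∈ C₂, (∀ c ∈ C₂, c ≤ 0 ∨ d ≤ c) ∧ cut hQ d = cut hQ r := by
    by_cases hr₂ : r ∈ C₂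
    · exact ⟨r, hr₂, fun c hc => hgapr c (hsub₂ hc), rfl⟩
    refine ⟨0, hc₂.zero_mem, fun c hc => Or.inr (hc₂.subset hc).1, ?_⟩
    obtain ⟨s, t, hsr, hrt, hst⟩ : ConstNear X r := by
      by_contra h
      exact hr₂ ⟨hrC, h⟩
    rw [hX, pool_apply, pool_apply, poolFun_cut hQ hc₁ hrC, poolFun_cut hQ hc₁ hrC,
      if_neg (not_le.2 hsr), if_pos hrt.le] at hst
    refine StieltjesFunction.ext fun u => ?_
    rw [cut_of_le hQ u.2.1]
    rcases le_or_gt r u with hu | hu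
    · rw [cut_of_le hQ hu]
    · rw [cut_of_lt hQ hu]
      have h1 := le_poolFun hQ hc₁ (c := ⟨r, (hc₁.subset hrC).1, hrt.trans t.2.2⟩)
        (t := t) (show r ≤ t from hrt.le) hrC
      exact le_antisymm (((Q.mono (show (u : ℝ) ≤ r from hu.le)).trans h1).trans hst.ge)
        (hQ.nonneg u)
  have hXd : pool (isQuantileFunction_cut hQ d) hc₂ = X := by
    rw [← hX₂]
    congr 1
  refine ⟨C₂, hc₂, d, hd, hgapd, fun c hc h => ?_, fun c hc h => ?_, fun W hW Y hY => ?_⟩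
  · rw [← hW₂] at h
    have h1 := constNear_of_constNear_pool _ hc₂ hc h
    rw [hV₁] at h1
    exact (hsub₂ hc).2 h1
  · rw [hXd] at h
    exact hc.2 h
  · rw [hXd]
    exact ((hopt W hW Y hY).trans hle₁).trans hle₂

/-- Where `W` is constant there are no cut points, so there `X` is constant too. -/
lemma const_of_const {W X : Quantile → ℝ} (hX : StepOn C X) (hW : ∀ c ∈ C, ¬ ConstNear W c)
    {s t : Quantile} (h : ∀ u ∈ Ico s t, W u = W s) : ∀ u ∈ Ico s t, X u = X s := by
  refine fun u hu => (hX s u hu.1 fun c hc hcu => ?_).symm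
  by_contra! hsc
  obtain ⟨x, hx1, hx2⟩ := exists_between (show (u : ℝ) < t from hu.2)
  have hx : x ∈ Ico (0 : ℝ) 1 := ⟨u.2.1.trans hx1.le, hx2.trans t.2.2⟩
  exact hW c hc ⟨s, ⟨x, hx⟩, hsc, hcu.trans_lt hx1, (h ⟨x, hx⟩
    ⟨hu.1.trans (show (u : ℝ) ≤ x from hx1.le), hx2⟩).symm⟩

/-- Functions that are steps on the same partition, and constant around none of its cut points,
have the same pools. -/
lemma haveSamePools_of_stepOn {W X : Quantile → ℝ} (hW : StepOn C W) (hX : StepOn C X)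
    (hWC : ∀ c ∈ C, ¬ ConstNear W c) (hXC : ∀ c ∈ C, ¬ ConstNear X c) : HaveSamePools W X :=
  fun _ _ => ⟨const_of_const hX hWC, const_of_const hW hXC⟩

end

section

/-! ### Extreme points -/

variable {V Q : StieltjesFunction Quantile} {C : Set ℝ}

lemma mem_extremePoints_of_forall {S : Set (StieltjesFunction Quantile)}
    {W : StieltjesFunction Quantile} (hW : W ∈ S)
    (h : ∀ A ∈ S, ∀ B ∈ S, ∀ α β : ℝ, 0 < α → 0 < β → α + β = 1 →
      (∀ t, α * A t + β * B t = W t) → A = W) : IsExtremePointOf W S := by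
  refine mem_extremePoints_iff_left.2 ⟨⟨W, hW, rfl⟩, ?_⟩
  rintro _ ⟨A, hA, rfl⟩ _ ⟨B, hB, rfl⟩ ⟨α, β, hα, hβ, hαβ, heq⟩
  have := h A hA B hB α β hα hβ hαβ fun t => congrFun heq t
  rw [this]

lemma tailInt_combo {A B W : StieltjesFunction Quantile} (hA : IsQuantileFunction A)
    (hB : IsQuantileFunction B) {α β : ℝ} (h : ∀ t, α * A t + β * B t = W t) (c : ℝ) :
    α * tailInt A c + β * tailInt B c = tailInt W c := by
  simp only [tailInt, ← h]
  rw [integral_add (hA.integrable.integrableOn.const_mul α)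
    (hB.integrable.integrableOn.const_mul β), integral_const_mul, integral_const_mul]

lemma eq_of_combo_eq {α β a b m : ℝ} (hα : 0 < α) (hβ : 0 < β) (hαβ : α + β = 1) (ha : a ≤ m)
    (hb : b ≤ m) (h : α * a + β * b = m) : a = m := by
  refine le_antisymm ha ?_
  have h1 := mul_le_mul_of_nonneg_left hb hβ.le
  have h2 : α * m ≤ α * a := by
    have : (α + β) * m = m := by rw [hαβ, one_mul]
    linarith
  exact le_of_mul_le_mul_left h2 hα

/-- If a convex combination of monotone functions is a step function, then so are they. -/
lemma stepOn_of_combo {A B W : StieltjesFunction Quantile} (hW : StepOn C W) {α β : ℝ}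
    (hα : 0 < α) (hβ : 0 < β) (h : ∀ t, α * A t + β * B t = W t) : StepOn C A := by
  intro s t hst hs
  refine le_antisymm (A.mono hst) ?_
  have h1 := hW s t hst hs
  rw [← h, ← h] at h1
  have h2 := mul_le_mul_of_nonneg_left (B.mono hst) hβ.le
  exact le_of_mul_le_mul_left (by linarith : α * A t ≤ α * A s) hα

lemma isExtremePointOf_pool (hV : IsQuantileFunction V) (hC : IsCut C) :
    IsExtremePointOf (pool hV hC) (feasibleValues V) := by
  refine mem_extremePoints_of_forall (pool_mem_feasibleValues hV hC)
    fun A hA B hB α β hα hβ hαβ h => ?_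
  refine eq_pool_of_stepOn hV hC hA.1 (stepOn_of_combo (stepOn_poolFun hC) hα hβ h) fun c hc => ?_
  have h1 := tailInt_combo hA.1 hB.1 h c
  rw [tailInt_pool_of_mem hV hC hc] at h1
  have hc' := hC.subset hc
  exact eq_of_combo_eq hα hβ hαβ (tailInt_le_of_weaklyMajorizedBy hA.2.1 hc')
    (tailInt_le_of_weaklyMajorizedBy hB.2.1 hc') h1

lemma isExtremePointOf_pool_cut (hQ : IsQuantileFunction Q) (hC : IsCut C) {b : ℝ} (hb : b ∈ C) :
    IsExtremePointOf (pool (isQuantileFunction_cut hQ b) hC) (feasibleAllocations Q) := by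
  have hqb := isQuantileFunction_cut hQ b
  have hb' := hC.subset hb
  refine mem_extremePoints_of_forall (pool_cut_mem_feasibleAllocations hQ hC hb'.2)
    fun A hA B hB α β hα hβ hαβ h => ?_
  refine eq_pool_of_stepOn hqb hC hA.1 (stepOn_of_combo (stepOn_poolFun hC) hα hβ h) ?_
  have hle : ∀ c ∈ C, b ≤ c → tailInt A c = tailInt (cut hQ b) c := by
    intro c hc hbc
    have h1 := tailInt_combo hA.1 hB.1 h c
    rw [tailInt_pool_of_mem hqb hC hc] at h1
    have hc' := hC.subset hc
    have h2 := tailInt_cut_of_le hQ hbc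
    refine eq_of_combo_eq hα hβ hαβ ?_ ?_ h1
    · rw [h2]
      exact tailInt_le_of_weaklyMajorizedBy hA.2 hc'
    · rw [h2]
      exact tailInt_le_of_weaklyMajorizedBy hB.2 hc'
  have hzero : ∀ t : Quantile, (t : ℝ) < b → A t = 0 := by
    intro t ht
    have h1 := h t
    rw [pool_apply, poolFun_cut hQ hC hb, if_neg (not_le.2 ht)] at h1
    have h2 := mul_nonneg hα.le (hA.1.nonneg t)
    have h3 := mul_nonneg hβ.le (hB.1.nonneg t)
    exact (mul_eq_zero.1 (by linarith : α * A t = 0)).resolve_left hα.ne'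
  intro c hc
  rcases le_total b c with hbc | hcb
  · exact hle c hc hbc
  · rw [tailInt_cut_of_ge hQ hcb hb'.2, ← tailInt_cut_of_le hQ (le_refl b), ← hle b hb le_rfl,
      ← sub_eq_zero, ← integral_cell hA.1 hcb hb'.2,
      setIntegral_congr_fun (measurableSet_cell (c, b)) fun s hs => hzero s hs.2]
    simp

end

end QuantilePooling

theorem mainTheorem4 (V Q : StieltjesFunction Quantile)
    (hV : IsQuantileFunction V) (hQ : IsQuantileFunction Q) :
    ∃ (W X : StieltjesFunction Quantile) (P : Set (ℝ × ℝ)),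
      IsJointSolution V Q W X ∧
      IsQuantilePartition P ∧
      IsMonotonePartitional V P W ∧
      IsWeakMonotonePartitional Q P X ∧
      HaveSamePools W X ∧
      IsExtremePointOf W (feasibleValues V) ∧
      IsExtremePointOf X (feasibleAllocations Q) := by
  obtain ⟨C, hC, b, hb, hgap, hWC, hXC, hopt⟩ := QuantilePooling.exists_optimal_activeCuts hV hQ
  exact ⟨QuantilePooling.pool hV hC,
    QuantilePooling.pool (QuantilePooling.isQuantileFunction_cut hQ b) hC,
    QuantilePooling.cells C,
    ⟨⟨QuantilePooling.pool_mem_feasibleValues hV hC,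
      QuantilePooling.pool_cut_mem_feasibleAllocations hQ hC (hC.subset hb).2⟩, hopt⟩,
    QuantilePooling.isQuantilePartition_cells hC,
    QuantilePooling.isMonotonePartitional_pool hV hC,
    QuantilePooling.isWeakMonotonePartitional_pool_cut hQ hC hb hgap,
    QuantilePooling.haveSamePools_of_stepOn (QuantilePooling.stepOn_poolFun hC)
      (QuantilePooling.stepOn_poolFun hC) hWC hXC,
    QuantilePooling.isExtremePointOf_pool hV hC,
    QuantilePooling.isExtremePointOf_pool_cut hQ hC hb⟩
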